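/- Let $u_0\in\mathbb R$, $e_1,e_2>0$, $x_1^0<x_2^0$, and consider the Cauchy problem for the Hopf equation $$L_H[u]=u_t+(u^2)_x=0,\qquad u(x,0)=u^{*0}(x)=\begin{cases}u_0+e_1+e_2,&x<x_1^0,\\ u_0+e_2,&x_1^0<x<x_2^0,\\ u_0,&x>x_2^0.\end{cases}$$ Let $H$ be the Heaviside function, $t^*=\dfrac{x_2^0-x_1^0}{e_1+e_2}$, and for $t\ge 0$ put $$u^*(x,t)=u_0+\sum_{k=1}^2 e_kH(-x+\phi_k(t)),$$ $$\phi_1(t)=x_1^0+(2u_0+e_1+2e_2)t-e_2(t-t^*)H(t-t^*),\qquad \phi_2(t)=x_2^0+(2u_0+e_2)t+e_1(t-t^*)H(t-t^*).$$ (1) $u^*$ is a generalized solution of the problem in the sense of the weak asymptotics method. That is, let $\omega_1,\omega_2\ge 0$ be any $C^\infty$ functions on $\mathbb R$ with $\int\omega_k=1$ and $|\omega_k(z)|\le C_N(1+|z|)^{-N}$ for all $N$, and let $H_k(\xi,\varepsilon)=\int_{-\infty}^{\xi/\varepsilon}\omega_k(\eta)\,d\eta$. Then there are phases $\phi_k(t,\varepsilon)$,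 smooth in $t$ for every $\varepsilon>0$, with $\phi_k(t,\varepsilon)\to\phi_k(t)$ as $\varepsilon\to+0$ for every $t\ge 0$, such that for every $T>0$: - $L_H\big[u_0+\sum_k e_kH_k(-x+\phi_k(t,\varepsilon),\varepsilon)\big]=O_{\mathcal D'}(\varepsilon)$ uniformly in $t\in[0,T]$; - $u_0+\sum_k e_kH(-x+\phi_k(0,\varepsilon))=u^{*0}(x)+O_{\mathcal D'}(\varepsilon)$; - for every $t\in[0,T]$, $u_0+\sum_k e_kH(-x+\phi_k(t,\varepsilon))\to u^*(x,t)$ weakly as $\varepsilon\to+0$. Here distributions act in $x$ and $t$ is a parameter; $g=O_{\mathcal D'}(\varepsilon)$ means $\langle g,\psi\rangle=O(\varepsilon)$ for every $\psi\in\mathcal D(\mathbb R)$. (2) For every $0<T\le\infty$, $u^*$ is the unique (up to equality almost everywhere) generalized solution of the Cauchy problem in $\Omega=\mathbb R\times(0,T)$ in the sense of the integral identity, in the class of bounded piecewise smooth functions satisfying the Oleinik stability condition. That is, $u^*$ is such a solution, and every such solution equals $u^*$ a.e. in $\Omega$. A function $v$ is such a solution if - $\int_\Omega(v\varphi_t+v^2\varphi_x)\,dx\,dt=0$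 for all $\varphi\in\mathcal D(\Omega)$; - $v(\cdot,t)\to u^{*0}$ in $\mathcal D'(\mathbb R)$ as $t\to+0$; - $v$ is (essentially) bounded in $\Omega$; - except for a set of points having only finitely many elements in every compact subset of $\Omega$, each point of $\Omega$ has a neighbourhood in which either $v$ is $C^1$, or $v$ is $C^1$ on each side of a $C^1$ line $x=\gamma(t)$ through the point, is continuous up to the line from each side, and satisfies $v(x-0,t)>v(x+0,t)$ wherever these one-sided limits on the line differ. -/

import Mathlib

open MeasureTheory Set Filter
open scoped Topology

noncomputable section

/-! ### Test functions, Heaviside function, estimates in the sense of distributions in `x` -/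

/-- Test functions on a normed space, i.e. elements of `𝓓`: smooth with compact support. -/
def IsTestFunction {E : Type*} [NormedAddCommGroup E] [NormedSpace ℝ E] (ψ : E → ℝ) : Prop :=
  ContDiff ℝ (⊤ : ℕ∞) ψ ∧ HasCompactSupport ψ

/-- The Heaviside function (its value at `0` is immaterial). -/
def heavisideFn (ξ : ℝ) : ℝ := if 0 < ξ then 1 else 0

/-- `g(x, t, ε) = O_{𝓓'}(ε)` as `ε → +0`, uniformly in `t ∈ S`. Distributions act in the variable
`x`, and `t` is a parameter. -/
def IsBigODistrib (S : Set ℝ) (g : ℝ → ℝ → ℝ → ℝ) : Prop :=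
  ∀ ψ : ℝ → ℝ, IsTestFunction ψ → ∃ C : ℝ, ∀ᶠ ε in 𝓝[>] (0 : ℝ), ∀ t ∈ S,
    |∫ x, g x t ε * ψ x| ≤ C * ε

/-- Kernels `ω` which regularize the Heaviside function: smooth, nonnegative, of integral one, and
either compactly supported or decreasing faster than every power (the former implies the latter). -/
structure IsRegKernel (ω : ℝ → ℝ) : Prop where
  smooth : ContDiff ℝ (⊤ : ℕ∞) ω
  nonneg : ∀ z, 0 ≤ ω z
  decay : ∀ N : ℕ, ∃ C : ℝ, ∀ z, (1 + |z|) ^ N * |ω z| ≤ C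
  integral_eq_one : ∫ z, ω z = 1

/-- The approximation `H(ξ, ε) = ∫_{-∞}^{ξ/ε} ω(η) dη` of the Heaviside function. -/
def regHeaviside (ω : ℝ → ℝ) (ξ ε : ℝ) : ℝ := ∫ η in Iic (ξ / ε), ω η

/-! ### The weak asymptotics method -/

/-- The data of a two-phase shock wave ansatz: background `u₀(x, t)`, amplitudes `e_k(x, t)`,
phases `φ_k(t, ε)` and regularizing kernels `ω_k`. -/
structure ShockAnsatz where
  u₀ : ℝ → ℝ → ℝ
  e : Fin 2 → ℝ → ℝ → ℝ
  φ : Fin 2 → ℝ → ℝ → ℝ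
  ω : Fin 2 → ℝ → ℝ
  smooth_u₀ : ContDiff ℝ (⊤ : ℕ∞) fun p : ℝ × ℝ => u₀ p.1 p.2
  smooth_e : ∀ k, ContDiff ℝ (⊤ : ℕ∞) fun p : ℝ × ℝ => e k p.1 p.2
  smooth_φ : ∀ k, ∀ ε > 0, ContDiff ℝ (⊤ : ℕ∞) fun t => φ k t ε
  kernel : ∀ k, IsRegKernel (ω k)

/-- The singular ansatz `u*_ε(x, t) = u₀(x, t) + ∑_k e_k(x, t) H(-x + φ_k(t, ε))`. -/
def ShockAnsatz.singular (A : ShockAnsatz) (x t ε : ℝ) : ℝ :=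
  A.u₀ x t + ∑ k, A.e k x t * heavisideFn (-x + A.φ k t ε)

/-- The smooth ansatz `u*(x, t, ε) = u₀(x, t) + ∑_k e_k(x, t) H_k(-x + φ_k(t, ε), ε)`. -/
def ShockAnsatz.smooth (A : ShockAnsatz) (x t ε : ℝ) : ℝ :=
  A.u₀ x t + ∑ k, A.e k x t * regHeaviside (A.ω k) (-x + A.φ k t ε) ε

/-- The (classical) operator `L[u] = u_t + (f(u))_x`. -/
def conservationOp (f : ℝ → ℝ) (u : ℝ → ℝ → ℝ) (x t : ℝ) : ℝ :=
  deriv (fun s => u x s) t + deriv (fun y => f (u y t)) x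

/-- The ansatz is a generalized asymptotic solution of `L[u] = 0` for `t ∈ [0, T]` with initial
value `uinit`: `L[u*(x, t, ε)] = O_{𝓓'}(ε)` uniformly in `t ∈ [0, T]`, and
`u*_ε(x, 0) = uinit(x) + O_{𝓓'}(ε)`. -/
structure ShockAnsatz.IsAsymptoticSolution (A : ShockAnsatz) (f : ℝ → ℝ) (T : ℝ)
    (uinit : ℝ → ℝ) : Prop where
  equation : IsBigODistrib (Icc 0 T)
    fun x t ε => conservationOp f (fun y s => A.smooth y s ε) x t
  initial : IsBigODistrib {0} fun x t ε => A.singular x t ε - uinit x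

/-- `u` is the generalized solution of the Cauchy problem for `L[u] = 0` on `[0, T]` produced by
the ansatz `A`: the ansatz is a generalized asymptotic solution, and `u(·, t)` is the weak limit
of `u*_ε(·, t)` as `ε → +0`, for every `t ∈ [0, T]`. -/
structure ShockAnsatz.YieldsSolution (A : ShockAnsatz) (f : ℝ → ℝ) (T : ℝ) (uinit : ℝ → ℝ)
    (u : ℝ → ℝ → ℝ) : Prop where
  asymptotic : A.IsAsymptoticSolution f T uinit
  weak_limit : ∀ t ∈ Icc 0 T, ∀ ψ : ℝ → ℝ, IsTestFunction ψ →
    Tendsto (fun ε => ∫ x, A.singular x t ε * ψ x) (𝓝[>] 0) (𝓝 (∫ x, u x t * ψ x))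

/-! ### Generalized solutions in the sense of the integral identity -/

/-- The domain `ℝ × (0, T)` of the `(x, t)`-plane, where `0 < T ≤ ∞`. -/
def timeStrip (T : EReal) : Set (ℝ × ℝ) := {p | 0 < p.2 ∧ (p.2 : EReal) < T}

/-- `v` satisfies `∫_Ω [v ψ_t + f(v) ψ_x] dx dt = 0` for all `ψ ∈ 𝓓(Ω)`. -/
structure IsIntegralSolution (f : ℝ → ℝ) (Ω : Set (ℝ × ℝ)) (v : ℝ → ℝ → ℝ) : Prop where
  locInt : LocallyIntegrableOn (fun p : ℝ × ℝ => v p.1 p.2) Ω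
  locInt_flux : LocallyIntegrableOn (fun p : ℝ × ℝ => f (v p.1 p.2)) Ω
  identity : ∀ ψ : ℝ × ℝ → ℝ, IsTestFunction ψ → tsupport ψ ⊆ Ω →
    ∫ p in Ω, (v p.1 p.2 * fderiv ℝ ψ p (0, 1) + f (v p.1 p.2) * fderiv ℝ ψ p (1, 0)) = 0

/-- Near `p` the function `v` is continuously differentiable on either side of a `C¹` line
`x = γ(t)` through `p` and has one-sided limits `vl = v(x - 0, t)`, `vr = v(x + 0, t)` on it, which
are continuous along the line and satisfy the stability condition `v(x - 0, t) > v(x + 0, t)` at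
every point of the line where they differ. (If they agree at a point, only the derivatives of `v`
may jump there.) -/
def IsStableLinePoint (v : ℝ → ℝ → ℝ) (p : ℝ × ℝ) : Prop :=
  ∃ (γ : ℝ → ℝ) (vl vr : ℝ × ℝ → ℝ) (U : Set (ℝ × ℝ)),
    γ p.2 = p.1 ∧ ContDiffAt ℝ 1 γ p.2 ∧ IsOpen U ∧ p ∈ U ∧
    ContinuousOn vl (U ∩ {q | q.1 ≤ γ q.2}) ∧ ContDiffOn ℝ 1 vl (U ∩ {q | q.1 < γ q.2}) ∧
    ContinuousOn vr (U ∩ {q | γ q.2 ≤ q.1}) ∧ ContDiffOn ℝ 1 vr (U ∩ {q | γ q.2 < q.1}) ∧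
    (∀ q ∈ U, q.1 < γ q.2 → v q.1 q.2 = vl q) ∧
    (∀ q ∈ U, γ q.2 < q.1 → v q.1 q.2 = vr q) ∧
    (∀ q ∈ U, q.1 = γ q.2 → vl q ≠ vr q → vr q < vl q)

/-- `v` is piecewise smooth in `Ω` and satisfies the stability condition on its discontinuity lines.
Exceptional points (where lines begin, end, meet, ...) are allowed, but only finitely many of them
in every compact part of `Ω`. -/
def IsStablePiecewiseSmooth (Ω : Set (ℝ × ℝ)) (v : ℝ → ℝ → ℝ) : Prop :=
  ∃ P : Set (ℝ × ℝ), (∀ K ⊆ Ω, IsCompact K → (K ∩ P).Finite) ∧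
    ∀ p ∈ Ω \ P, ContDiffAt ℝ 1 (fun q : ℝ × ℝ => v q.1 q.2) p ∨ IsStableLinePoint v p

/-- `v` is a generalized solution, in the sense of the integral identity, of the Cauchy problem
`v_t + (f(v))_x = 0`, `v(x, 0) = uinit(x)` in `ℝ × (0, T)`, in the class of bounded piecewise smooth
functions that satisfy the stability condition. The initial value is attained in `𝓓'(ℝ)`. -/
structure IsGeneralizedCauchySolution (f : ℝ → ℝ) (T : EReal) (uinit : ℝ → ℝ)
    (v : ℝ → ℝ → ℝ) : Prop where
  integral : IsIntegralSolution f (timeStrip T) v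
  initial : ∀ ψ : ℝ → ℝ, IsTestFunction ψ →
    Tendsto (fun t => ∫ x, v x t * ψ x) (𝓝[>] 0) (𝓝 (∫ x, uinit x * ψ x))
  bounded : ∃ M : ℝ, ∀ᵐ p ∂(volume.restrict (timeStrip T)), |v p.1 p.2| ≤ M
  stable : IsStablePiecewiseSmooth (timeStrip T) v

/-! ### The two-jump Cauchy problem for the Hopf equation -/

/-- The flux of the Hopf equation `u_t + (u²)_x = 0`. -/
def hopfFlux (v : ℝ) : ℝ := v ^ 2

/-- The two-jump initial value. -/
def twoJumpData (u₀ e₁ e₂ x₁ x₂ x : ℝ) : ℝ :=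
  if x < x₁ then u₀ + e₁ + e₂ else if x < x₂ then u₀ + e₂ else u₀

/-- The merging time `t* = (x₂ - x₁) / (e₁ + e₂)`. -/
def mergeTime (e₁ e₂ x₁ x₂ : ℝ) : ℝ := (x₂ - x₁) / (e₁ + e₂)

/-- `φ₁(t) = x₁ + (2u₀ + e₁ + 2e₂) t - e₂ (t - t*) H(t - t*)`. -/
def hopfPhase₁ (u₀ e₁ e₂ x₁ x₂ t : ℝ) : ℝ :=
  x₁ + (2 * u₀ + e₁ + 2 * e₂) * t
    - e₂ * (t - mergeTime e₁ e₂ x₁ x₂) * heavisideFn (t - mergeTime e₁ e₂ x₁ x₂)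

/-- `φ₂(t) = x₂ + (2u₀ + e₂) t + e₁ (t - t*) H(t - t*)`. -/
def hopfPhase₂ (u₀ e₁ e₂ x₁ x₂ t : ℝ) : ℝ :=
  x₂ + (2 * u₀ + e₂) * t
    + e₁ * (t - mergeTime e₁ e₂ x₁ x₂) * heavisideFn (t - mergeTime e₁ e₂ x₁ x₂)

/-- `u*(x, t) = u₀ + e₁ H(-x + φ₁(t)) + e₂ H(-x + φ₂(t))`. -/
def hopfTwoShock (u₀ e₁ e₂ x₁ x₂ x t : ℝ) : ℝ :=
  u₀ + e₁ * heavisideFn (-x + hopfPhase₁ u₀ e₁ e₂ x₁ x₂ t)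
    + e₂ * heavisideFn (-x + hopfPhase₂ u₀ e₁ e₂ x₁ x₂ t)

end

/-! For uniqueness, pass to a potential `V` with `V_x = v`, `V_t = -v²`; the conservation law
becomes the Hamilton–Jacobi equation `V_t + V_x² = 0`. A bounded weak solution has a Lipschitz
potential (`exists_potential`: mollify, apply the Poincaré lemma, pass to the limit). Since `v q -
v² ≤ q²/4` for all `q`, such a potential never grows faster along a ray than the Hopf–Lax formula
allows. The potential `U` of `u*` is the minimum of three affine functions, one for each constant
state. It satisfies the same inequality, and each of its values is reached along a characteristic
from time zero. This gives `V ≤ U + c`.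

The reverse inequality is where stability enters. At a point of a shock with `v(x-0) > v(x+0)`, at
least one of the two backward characteristics runs into its own side of the line, whatever the slope
of the line; along it `V` grows at almost the Hopf–Lax rate
(`IsHopfPotential.exists_backward_direction`). A maximum principle in a backward cone then excludes
`V < U + c` (`IsHopfPotential.eq_of_hopfLax`). The exceptional points are finite in number in the
cone and are avoided by a generic choice of the level. Differentiating `V = U + c` in `x` gives `v =
u*` a.e. Conversely, `u*` is an integral solution because its field is the gradient of the Lipschitz
function `U` (`integral_lineDeriv_potential_eq_zero`).

For the weak asymptotics, the centre of mass of the jumps moves with constant speed, while their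
distance is the positive part of a linear function of `t`. The phases are obtained by smoothing this
positive part at scale `ε`. Tested against `ψ`, the residual concentrates at the two phases with
opposite coefficients, so that up to `O(ε)` it is a multiple of `ψ(φ₁) - ψ(φ₂)`. If the phases are
within `O(ε)` this is small; if they are farther apart, the coefficient decays like the inverse of
the rescaled distance, by the first moments of the kernels. The product is `O(ε)` uniformly in time
(`exists_residual_bound`). -/

/-! ### Potentials of bounded weakly closed fields in the plane. -/

/-- The points whose closed `ε`-ball lies in a convex set form a convex set. -/
theorem convex_setOf_closedBall_subset {E : Type*} [NormedAddCommGroup E] [NormedSpace ℝ E]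
    {Ω : Set E} (hΩ : Convex ℝ Ω) (ε : ℝ) : Convex ℝ {p | Metric.closedBall p ε ⊆ Ω} := by
  intro p hp q hq a b ha hb hab y hy
  have hy' : ‖y - (a • p + b • q)‖ ≤ ε := by simpa [dist_eq_norm] using hy
  have h1 : p + (y - (a • p + b • q)) ∈ Ω := hp (by simpa [dist_eq_norm] using hy')
  have h2 : q + (y - (a • p + b • q)) ∈ Ω := hq (by simpa [dist_eq_norm] using hy')
  have h := hΩ h1 h2 ha hb hab
  have e : a • (p + (y - (a • p + b • q))) + b • (q + (y - (a • p + b • q))) = y := by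
    have : a • (p + (y - (a • p + b • q))) + b • (q + (y - (a • p + b • q)))
        = (a • p + b • q) + (a + b) • (y - (a • p + b • q)) := by
      module
    rw [this, hab]; simp
  rwa [e] at h

/-- The mollification `p ↦ ∫ g(y) ρ(p - y) dy`. -/
noncomputable def mollify (ρ : ContDiffBump (0 : ℝ × ℝ)) (g : ℝ × ℝ → ℝ) : ℝ × ℝ → ℝ :=
  MeasureTheory.convolution g (ρ.normed volume) (ContinuousLinearMap.lsmul ℝ ℝ) volume

theorem mollify_apply (ρ : ContDiffBump (0 : ℝ × ℝ)) (g : ℝ × ℝ → ℝ) (p : ℝ × ℝ) :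
    mollify ρ g p = ∫ y, g y * ρ.normed volume (p - y) := by
  simp [mollify, MeasureTheory.convolution]

theorem hasFDerivAt_mollify (ρ : ContDiffBump (0 : ℝ × ℝ)) {g : ℝ × ℝ → ℝ}
    (hg : LocallyIntegrable g) (p : ℝ × ℝ) :
    DifferentiableAt ℝ (mollify ρ g) p ∧
    ∀ w, fderiv ℝ (mollify ρ g) p w = ∫ y, g y * fderiv ℝ (ρ.normed volume) (p - y) w := by
  have h := HasCompactSupport.hasFDerivAt_convolution_right (μ := volume)
    (ContinuousLinearMap.lsmul ℝ ℝ) (ρ.hasCompactSupport_normed (μ := volume)) hg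
    (ρ.contDiff_normed (n := 1)) p
  refine ⟨h.differentiableAt, fun w => ?_⟩
  have h2 : fderiv ℝ (mollify ρ g) p = _ := h.fderiv
  rw [h2, convolution_precompR_apply]
  · simp [MeasureTheory.convolution]
  · exact hg
  · exact (ρ.hasCompactSupport_normed (μ := volume)).fderiv (𝕜 := ℝ)
  · exact (ρ.contDiff_normed (n := 1)).continuous_fderiv one_ne_zero

theorem integrable_mul_normed_sub (ρ : ContDiffBump (0 : ℝ × ℝ)) {g : ℝ × ℝ → ℝ}
    (hg : LocallyIntegrable g) (p : ℝ × ℝ) :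
    Integrable fun y => g y * ρ.normed volume (p - y) := by
  have h1 : Continuous fun y => ρ.normed volume (p - y) :=
    ρ.continuous_normed.comp (by fun_prop)
  have h2 : HasCompactSupport fun y => ρ.normed volume (p - y) :=
    (ρ.hasCompactSupport_normed (μ := volume)).comp_homeomorph (Homeomorph.subLeft p)
  simpa [mul_comm] using hg.integrable_smul_left_of_hasCompactSupport h1 h2

/-- The mollified value is an average, with nonnegative weights of total mass one, of the values in
the ball of radius `ρ.rOut` about `p`; averaging preserves one-sided bounds. -/
theorem mollify_le (ρ : ContDiffBump (0 : ℝ × ℝ)) {f₁ f₂ : ℝ × ℝ → ℝ}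
    (h₁ : LocallyIntegrable f₁) (h₂ : LocallyIntegrable f₂) {p d : ℝ × ℝ} {κ : ℝ}
    {B : Set (ℝ × ℝ)} (hB : Metric.closedBall p ρ.rOut ⊆ B)
    (h : ∀ᵐ z, z ∈ B → f₁ z * d.1 + f₂ z * d.2 ≤ κ) :
    mollify ρ f₁ p * d.1 + mollify ρ f₂ p * d.2 ≤ κ := by
  have e : mollify ρ f₁ p * d.1 + mollify ρ f₂ p * d.2
      = ∫ y, (f₁ y * d.1 + f₂ y * d.2) * ρ.normed volume (p - y) := by
    rw [mollify_apply, mollify_apply, ← integral_mul_const, ← integral_mul_const,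
      ← integral_add ((integrable_mul_normed_sub ρ h₁ p).mul_const _)
        ((integrable_mul_normed_sub ρ h₂ p).mul_const _)]
    congr 1; ext y; ring
  have e2 : κ = ∫ y, κ * ρ.normed volume (p - y) := by
    rw [integral_const_mul, integral_sub_left_eq_self (fun y => ρ.normed volume y) volume p,
      ρ.integral_normed, mul_one]
  rw [e, e2]
  apply integral_mono_ae
  · have := ((integrable_mul_normed_sub ρ h₁ p).mul_const d.1).add
        ((integrable_mul_normed_sub ρ h₂ p).mul_const d.2)
    refine this.congr (Eventually.of_forall fun y => ?_)
    simp only [Pi.add_apply]; ring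
  · exact integrable_mul_normed_sub ρ (locallyIntegrable_const κ) p
  · filter_upwards [h] with y hy
    by_cases hyB : y ∈ B
    · exact mul_le_mul_of_nonneg_right (hy hyB) (ρ.nonneg_normed _)
    · have : ρ.normed volume (p - y) = 0 := by
        by_contra hne
        have : p - y ∈ Function.support (ρ.normed volume) := hne
        rw [ρ.support_normed_eq] at this
        apply hyB; apply hB
        rw [Metric.mem_closedBall, dist_comm, dist_eq_norm]
        simpa [dist_eq_norm] using (Metric.mem_ball.1 this).le
      simp [this]

/-- A bounded field `(f₁, f₂)` is closed in `Ω` in the sense of distributions. -/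
def IsWeaklyClosed (Ω : Set (ℝ × ℝ)) (f₁ f₂ : ℝ × ℝ → ℝ) : Prop :=
  ∀ ψ : ℝ × ℝ → ℝ, IsTestFunction ψ → tsupport ψ ⊆ Ω →
    ∫ p, (f₁ p * fderiv ℝ ψ p (0, 1) - f₂ p * fderiv ℝ ψ p (1, 0)) = 0

/-- The weak identity is tested with `y ↦ ρ(p - y)`, which is supported in `Ω` by the condition on
the ball. -/
theorem fderiv_mollify_eq (ρ : ContDiffBump (0 : ℝ × ℝ)) {f₁ f₂ : ℝ × ℝ → ℝ}
    {Ω : Set (ℝ × ℝ)}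
    (h₁ : LocallyIntegrable f₁) (h₂ : LocallyIntegrable f₂) (hcl : IsWeaklyClosed Ω f₁ f₂)
    {p : ℝ × ℝ} (hp : Metric.closedBall p ρ.rOut ⊆ Ω) :
    fderiv ℝ (mollify ρ f₁) p (0, 1) = fderiv ℝ (mollify ρ f₂) p (1, 0) := by
  have hρ : ContDiff ℝ (⊤ : ℕ∞) (ρ.normed volume) := ρ.contDiff_normed
  have hs : HasCompactSupport fun y => ρ.normed volume (p - y) :=
    (ρ.hasCompactSupport_normed (μ := volume)).comp_homeomorph (Homeomorph.subLeft p)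
  have hψ : IsTestFunction fun y => ρ.normed volume (p - y) :=
    ⟨hρ.comp (by fun_prop), hs⟩
  have hsupp : tsupport (fun y => ρ.normed volume (p - y)) ⊆ Ω := by
    refine Subset.trans (closure_minimal ?_ Metric.isClosed_closedBall) hp
    intro y hy
    have : p - y ∈ Function.support (ρ.normed volume) := hy
    rw [ρ.support_normed_eq] at this
    rw [Metric.mem_closedBall, dist_comm, dist_eq_norm]
    simpa [dist_eq_norm] using (Metric.mem_ball.1 this).le
  have hd : ∀ y w, fderiv ℝ (fun y => ρ.normed volume (p - y)) y w
      = - fderiv ℝ (ρ.normed volume) (p - y) w := by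
    intro y w
    have h1 : HasFDerivAt (fun y => p - y) (-ContinuousLinearMap.id ℝ (ℝ × ℝ)) y :=
      (hasFDerivAt_id y).const_sub p
    have h2 := (hρ.differentiable (by simp) (p - y)).hasFDerivAt.comp y h1
    have h3 := h2.fderiv
    simp only [Function.comp_def] at h3
    rw [h3]; simp
  have hint : ∀ {f : ℝ × ℝ → ℝ}, LocallyIntegrable f → ∀ w,
      Integrable fun y => f y * fderiv ℝ (ρ.normed volume) (p - y) w := by
    intro f hf w
    have c1 : Continuous fun y => fderiv ℝ (ρ.normed volume) (p - y) w :=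
      ((hρ.continuous_fderiv (by simp)).comp (by fun_prop)).clm_apply continuous_const
    have c2 : HasCompactSupport fun y => fderiv ℝ (ρ.normed volume) (p - y) w :=
      ((ρ.hasCompactSupport_normed (μ := volume)).fderiv_apply (𝕜 := ℝ) w).comp_homeomorph
        (Homeomorph.subLeft p)
    simpa [mul_comm] using hf.integrable_smul_left_of_hasCompactSupport c1 c2
  have key := hcl _ hψ hsupp
  rw [(hasFDerivAt_mollify ρ h₁ p).2, (hasFDerivAt_mollify ρ h₂ p).2]
  have e : ∫ y, (f₁ y * fderiv ℝ (fun y => ρ.normed volume (p - y)) y (0, 1)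
      - f₂ y * fderiv ℝ (fun y => ρ.normed volume (p - y)) y (1, 0))
      = - ((∫ y, f₁ y * fderiv ℝ (ρ.normed volume) (p - y) (0, 1))
        - ∫ y, f₂ y * fderiv ℝ (ρ.normed volume) (p - y) (1, 0)) := by
    rw [← integral_sub (hint h₁ _) (hint h₂ _), ← integral_neg]
    congr 1; ext y; rw [hd, hd]; ring
  rw [e] at key
  linarith

/-- The mollified field is smooth and closed on a convex open set, so the Poincaré lemma applies;
increments are then controlled by the mean value inequality on the segment. The normalization at `c`
keeps the potentials bounded when the mollification parameter tends to zero. -/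
theorem exists_mollified_potential (ρ : ContDiffBump (0 : ℝ × ℝ)) {f₁ f₂ : ℝ × ℝ → ℝ}
    {Ω : Set (ℝ × ℝ)} (hΩ : Convex ℝ Ω)
    (h₁ : LocallyIntegrable f₁) (h₂ : LocallyIntegrable f₂) (hcl : IsWeaklyClosed Ω f₁ f₂)
    (c : ℝ × ℝ) :
    ∃ W : ℝ × ℝ → ℝ, W c = 0 ∧ ∀ (p d : ℝ × ℝ) (κ : ℝ) (B : Set (ℝ × ℝ)),
      (∀ z ∈ segment ℝ p (p + d), z ∈ interior {q | Metric.closedBall q ρ.rOut ⊆ Ω} ∧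
        Metric.closedBall z ρ.rOut ⊆ B) →
      (∀ᵐ z, z ∈ B → f₁ z * d.1 + f₂ z * d.2 ≤ κ) → W (p + d) - W p ≤ κ := by
  set S : Set (ℝ × ℝ) := interior {q | Metric.closedBall q ρ.rOut ⊆ Ω} with hS
  have hSc : Convex ℝ S := (convex_setOf_closedBall_subset hΩ _).interior
  set w : ℝ × ℝ → ℝ × ℝ →L[ℝ] ℝ := fun p =>
    mollify ρ f₁ p • ContinuousLinearMap.fst ℝ ℝ ℝ + mollify ρ f₂ p • ContinuousLinearMap.snd ℝ ℝ ℝ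
    with hw
  have hD : ∀ p, HasFDerivAt w ((fderiv ℝ (mollify ρ f₁) p).smulRight
      (ContinuousLinearMap.fst ℝ ℝ ℝ) + (fderiv ℝ (mollify ρ f₂) p).smulRight
      (ContinuousLinearMap.snd ℝ ℝ ℝ)) p := by
    intro p
    have a := (hasFDerivAt_mollify ρ h₁ p).1.hasFDerivAt.smul_const (ContinuousLinearMap.fst ℝ ℝ ℝ)
    have b := (hasFDerivAt_mollify ρ h₂ p).1.hasFDerivAt.smul_const (ContinuousLinearMap.snd ℝ ℝ ℝ)
    exact a.add b
  obtain ⟨W, hW⟩ := hSc.exists_forall_hasFDerivAt_of_fderiv_symmetric isOpen_interior (ω := w)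
    (fun p _ => (hD p).differentiableAt.differentiableWithinAt) (by
      intro p hp x y
      have hp' := fderiv_mollify_eq ρ h₁ h₂ hcl (interior_subset hp)
      rw [(hD p).fderiv]
      obtain ⟨x1, x2⟩ := x
      obtain ⟨y1, y2⟩ := y
      have hx : ∀ (L : ℝ × ℝ →L[ℝ] ℝ) (a b : ℝ), L (a, b) = a * L (1, 0) + b * L (0, 1) := by
        intro L a b
        have : ((a, b) : ℝ × ℝ) = a • (1, 0) + b • (0, 1) := by simp
        rw [this, map_add, map_smul, map_smul]; simp
      simp only [_root_.add_apply, ContinuousLinearMap.smulRight_apply,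
        _root_.smul_apply, ContinuousLinearMap.coe_fst', ContinuousLinearMap.coe_snd',
        smul_eq_mul]
      rw [hx _ x1 x2, hx _ x1 x2, hx _ y1 y2, hx _ y1 y2, hp']
      ring)
  refine ⟨fun p => W p - W c, by simp, fun p d κ B hseg hB => ?_⟩
  have hmem : ∀ s ∈ Icc (0 : ℝ) 1, p + s • d ∈ segment ℝ p (p + d) := by
    intro s hs
    rw [segment_eq_image']
    exact ⟨s, hs, by simp⟩
  have hder : ∀ s ∈ Icc (0 : ℝ) 1,
      HasDerivAt (fun s : ℝ => W (p + s • d)) (w (p + s • d) d) s := by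
    intro s hs
    have h1 : HasDerivAt (fun s : ℝ => p + s • d) d s := by
      simpa using ((hasDerivAt_id s).smul_const d).const_add p
    exact (hW _ (hseg _ (hmem s hs)).1).comp_hasDerivAt s h1
  have := Convex.image_sub_le_mul_sub_of_deriv_le (convex_Icc (0 : ℝ) 1)
    (f := fun s : ℝ => W (p + s • d)) (C := κ)
    (fun s hs => (hder s hs).continuousAt.continuousWithinAt)
    (fun s hs => (hder s (interior_subset hs)).differentiableAt.differentiableWithinAt)
    (fun s hs => by
      rw [(hder s (interior_subset hs)).deriv]
      have := mollify_le ρ h₁ h₂ (hseg _ (hmem s (interior_subset hs))).2 hB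
      simpa [hw] using this)
    0 (by simp) 1 (by simp) zero_le_one
  simpa using this

/-- A bounded field that is closed in the sense of distributions in a convex open set has a
(Lipschitz) potential, whose increments along segments are bounded by the bounds of the field
near the segments. -/
theorem exists_potential {f₁ f₂ : ℝ × ℝ → ℝ} {Ω : Set (ℝ × ℝ)} (hΩ : Convex ℝ Ω)
    (hΩo : IsOpen Ω) (h₁ : LocallyIntegrable f₁) (h₂ : LocallyIntegrable f₂)
    (hcl : IsWeaklyClosed Ω f₁ f₂) {M : ℝ} (hM₁ : ∀ᵐ z, |f₁ z| ≤ M) (hM₂ : ∀ᵐ z, |f₂ z| ≤ M) :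
    ∃ V : ℝ × ℝ → ℝ, ∀ (p d : ℝ × ℝ) (κ : ℝ) (B : Set (ℝ × ℝ)), IsOpen B → B ⊆ Ω →
      segment ℝ p (p + d) ⊆ B → (∀ᵐ z, z ∈ B → f₁ z * d.1 + f₂ z * d.2 ≤ κ) →
      V (p + d) - V p ≤ κ := by
  rcases Ω.eq_empty_or_nonempty with rfl | ⟨c, hc⟩
  · refine ⟨0, fun p d κ B _ hB hs => ?_⟩
    exact absurd (hB (hs (left_mem_segment ℝ p (p + d)))) (by simp)
  let ρ : ℕ → ContDiffBump (0 : ℝ × ℝ) := fun n =>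
    ⟨1 / (n + 1 : ℝ) / 2, 1 / (n + 1 : ℝ), by positivity, half_lt_self (by positivity)⟩
  have hρ : Tendsto (fun n => (ρ n).rOut) atTop (𝓝 0) := tendsto_one_div_add_atTop_nhds_zero_nat
  choose W hW0 hW using fun n => exists_mollified_potential (ρ n) hΩ h₁ h₂ hcl c
  have hev : ∀ (K B : Set (ℝ × ℝ)), IsCompact K → IsOpen B → K ⊆ B → B ⊆ Ω →
      ∀ᶠ n in atTop, ∀ z ∈ K, z ∈ interior {q | Metric.closedBall q (ρ n).rOut ⊆ Ω} ∧
        Metric.closedBall z (ρ n).rOut ⊆ B := by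
    intro K B hK hB hKB hBΩ
    obtain ⟨δ, hδ, hδB⟩ := hK.exists_cthickening_subset_open hB hKB
    filter_upwards [hρ.eventually_lt_const (half_pos hδ)] with n hn z hz
    have hball : Metric.closedBall z δ ⊆ B :=
      (Metric.closedBall_subset_cthickening hz δ).trans hδB
    refine ⟨?_, (Metric.closedBall_subset_closedBall (by linarith)).trans hball⟩
    rw [mem_interior]
    refine ⟨Metric.ball z (δ / 2), fun q hq => ?_, Metric.isOpen_ball,
      Metric.mem_ball_self (by linarith)⟩
    refine Subset.trans ?_ (hball.trans hBΩ)
    apply Metric.closedBall_subset_closedBall'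
    have := Metric.mem_ball.1 hq
    linarith
  -- The values at a fixed point are bounded by the increment from `c`, so they converge along an
  -- ultrafilter. This gives one limit for all points at once, with no diagonal subsequence, and
  -- inequalities between increments pass to it.
  let F : Ultrafilter ℕ := Ultrafilter.of atTop
  have hF : (F : Filter ℕ) ≤ atTop := Ultrafilter.of_le atTop
  have hlim : ∀ p ∈ Ω, ∃ y, Tendsto (fun n => W n p) F (𝓝 y) := by
    intro p hp
    set R := M * |p.1 - c.1| + M * |p.2 - c.2| with hR
    have hbd : ∀ d : ℝ × ℝ, |d.1| = |p.1 - c.1| → |d.2| = |p.2 - c.2| →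
        ∀ᵐ z, z ∈ Ω → f₁ z * d.1 + f₂ z * d.2 ≤ R := by
      intro d hd1 hd2
      filter_upwards [hM₁, hM₂] with z hz1 hz2 _
      have a1 : f₁ z * d.1 ≤ M * |p.1 - c.1| := by
        rw [← hd1]
        exact (le_abs_self _).trans ((abs_mul _ _).trans_le (by gcongr))
      have a2 : f₂ z * d.2 ≤ M * |p.2 - c.2| := by
        rw [← hd2]
        exact (le_abs_self _).trans ((abs_mul _ _).trans_le (by gcongr))
      linarith
    have hcomp : IsCompact (segment ℝ c p) := by
      rw [segment_eq_image_lineMap]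
      exact isCompact_Icc.image AffineMap.lineMap_continuous
    have e1 : ∀ᶠ n in atTop, W n p ∈ Icc (-R) R := by
      filter_upwards [hev _ Ω hcomp hΩo (hΩ.segment_subset hc hp) subset_rfl] with n hn
      have b1 := hW n c (p - c) R Ω (by simpa using hn) (hbd _ rfl rfl)
      have b2 := hW n p (c - p) R Ω (by simpa [segment_symm] using hn)
        (hbd _ (by simp [abs_sub_comm]) (by simp [abs_sub_comm]))
      simp only [add_sub_cancel, hW0] at b1 b2
      constructor <;> linarith
    have e2 : ((F.map fun n => W n p : Ultrafilter ℝ) : Filter ℝ) ≤ 𝓟 (Icc (-R) R) := by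
      rw [le_principal_iff]
      exact hF e1
    obtain ⟨y, -, hy⟩ := isCompact_Icc.ultrafilter_le_nhds _ e2
    exact ⟨y, hy⟩
  choose! V hV using hlim
  refine ⟨V, fun p d κ B hB hBΩ hseg hκ => ?_⟩
  have hcomp : IsCompact (segment ℝ p (p + d)) := by
    rw [segment_eq_image_lineMap]
    exact isCompact_Icc.image AffineMap.lineMap_continuous
  have hp : p ∈ Ω := hBΩ (hseg (left_mem_segment ℝ _ _))
  have hpd : p + d ∈ Ω := hBΩ (hseg (right_mem_segment ℝ _ _))
  refine le_of_tendsto ((hV _ hpd).sub (hV _ hp)) (hF ?_)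
  filter_upwards [hev _ B hcomp hB hseg hBΩ] with n hn
  exact hW n p d κ B hn hκ

/-! ### Hopf potentials and Hopf–Lax inequalities along segments. -/

theorem isOpen_timeStrip (T : EReal) : IsOpen (timeStrip T) := by
  have h1 : IsOpen {p : ℝ × ℝ | 0 < p.2} := isOpen_lt continuous_const continuous_snd
  have h2 : IsOpen {p : ℝ × ℝ | (p.2 : EReal) < T} :=
    isOpen_lt (continuous_coe_real_ereal.comp continuous_snd) continuous_const
  exact h1.inter h2

theorem convex_timeStrip (T : EReal) : Convex ℝ (timeStrip T) := by
  have hc : Convex ℝ {t : ℝ | 0 < t ∧ (t : EReal) < T} := by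
    apply Set.OrdConnected.convex
    refine ⟨fun a ha b hb t ht => ⟨ha.1.trans_le ht.1, lt_of_le_of_lt ?_ hb.2⟩⟩
    exact_mod_cast ht.2
  exact hc.linear_preimage (LinearMap.snd ℝ ℝ ℝ)

/-- `V` is a potential of the field `(v, -v²)` in `Ω`: its increments along segments are bounded by
the bounds of the field near the segments. -/
def IsHopfPotential (Ω : Set (ℝ × ℝ)) (v : ℝ → ℝ → ℝ) (V : ℝ × ℝ → ℝ) : Prop :=
  ∀ (p d : ℝ × ℝ) (κ : ℝ) (B : Set (ℝ × ℝ)), IsOpen B → B ⊆ Ω → segment ℝ p (p + d) ⊆ B →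
    (∀ᵐ z : ℝ × ℝ, z ∈ B → v z.1 z.2 * d.1 - v z.1 z.2 ^ 2 * d.2 ≤ κ) → V (p + d) - V p ≤ κ

/-- The integral identity says exactly that `(v, -v²)` is weakly closed. Extension by zero makes the
field globally bounded and locally integrable without changing the identity for test functions
supported in `Ω`. -/
theorem IsIntegralSolution.exists_hopfPotential {Ω : Set (ℝ × ℝ)} (hΩ : Convex ℝ Ω)
    (hΩo : IsOpen Ω) {v : ℝ → ℝ → ℝ} (hv : IsIntegralSolution hopfFlux Ω v) {M : ℝ}
    (hM : ∀ᵐ p ∂(volume.restrict Ω), |v p.1 p.2| ≤ M) :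
    ∃ V, IsHopfPotential Ω v V := by
  have hM0 : ∀ᵐ p : ℝ × ℝ, p ∈ Ω → |v p.1 p.2| ≤ M := (ae_restrict_iff' hΩo.measurableSet).1 hM
  have hm : ∀ {g : ℝ × ℝ → ℝ}, LocallyIntegrableOn g Ω → ∀ {N : ℝ},
      (∀ᵐ p, |Ω.indicator g p| ≤ N) → LocallyIntegrable (Ω.indicator g) := by
    intro g hg N hN
    have h1 : AEStronglyMeasurable (Ω.indicator g) :=
      (aestronglyMeasurable_indicator_iff hΩo.measurableSet).2 hg.aestronglyMeasurable
    refine (locallyIntegrable_const N).mono h1 ?_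
    filter_upwards [hN] with p hp
    exact hp.trans (le_abs_self _)
  set f₁ : ℝ × ℝ → ℝ := Ω.indicator fun p => v p.1 p.2 with hf₁
  set f₂ : ℝ × ℝ → ℝ := Ω.indicator fun p => - hopfFlux (v p.1 p.2) with hf₂
  have b₁ : ∀ᵐ p, |f₁ p| ≤ |M| + M ^ 2 := by
    filter_upwards [hM0] with p hp
    by_cases h : p ∈ Ω
    · rw [hf₁, indicator_of_mem h]
      have := hp h
      nlinarith [le_abs_self M, sq_nonneg M]
    · rw [hf₁, indicator_of_notMem h]
      simp; positivity
  have b₂ : ∀ᵐ p, |f₂ p| ≤ |M| + M ^ 2 := by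
    filter_upwards [hM0] with p hp
    by_cases h : p ∈ Ω
    · rw [hf₂, indicator_of_mem h]
      have := hp h
      rw [abs_neg, hopfFlux, abs_pow]
      nlinarith [abs_nonneg M, abs_nonneg (v p.1 p.2)]
    · rw [hf₂, indicator_of_notMem h]
      simp; positivity
  have l₁ := hm hv.locInt b₁
  have l₂ : LocallyIntegrable f₂ := hm hv.locInt_flux.neg (N := |M| + M ^ 2) b₂
  obtain ⟨V, hV⟩ := exists_potential (f₁ := f₁) (f₂ := f₂) hΩ hΩo l₁ l₂ (by
    intro ψ hψ hs
    refine Eq.trans ?_ (hv.identity ψ hψ hs)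
    rw [← integral_indicator hΩo.measurableSet]
    congr 1; ext p
    by_cases h : p ∈ Ω
    · simp only [hf₁, hf₂, indicator_of_mem h]; ring
    · simp only [hf₁, hf₂, indicator_of_notMem h]; ring) b₁ b₂
  refine ⟨V, fun p d κ B hB hBΩ hs h => hV p d κ B hB hBΩ hs ?_⟩
  filter_upwards [h] with z hz hzB
  have := hz hzB
  simp only [hf₁, hf₂, indicator_of_mem (hBΩ hzB), hopfFlux]
  linarith

namespace IsHopfPotential

variable {Ω : Set (ℝ × ℝ)} {v : ℝ → ℝ → ℝ} {V : ℝ × ℝ → ℝ}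

theorem le_sub (hV : IsHopfPotential Ω v V) {p d : ℝ × ℝ} {κ : ℝ} {B : Set (ℝ × ℝ)}
    (hB : IsOpen B) (hBΩ : B ⊆ Ω) (hs : segment ℝ p (p + d) ⊆ B)
    (h : ∀ᵐ z : ℝ × ℝ, z ∈ B → κ ≤ v z.1 z.2 * d.1 - v z.1 z.2 ^ 2 * d.2) :
    κ ≤ V (p + d) - V p := by
  have := hV (p + d) (-d) (-κ) B hB hBΩ (by simpa [segment_symm] using hs) (by
    filter_upwards [h] with z hz hzB
    have := hz hzB
    simp only [Prod.fst_neg, Prod.snd_neg]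
    linarith)
  simp only [add_neg_cancel_right] at this
  linarith

theorem sub_le (hV : IsHopfPotential Ω v V) (hΩ : Convex ℝ Ω) (hΩo : IsOpen Ω) {M : ℝ}
    (hM : ∀ᵐ z : ℝ × ℝ, z ∈ Ω → |v z.1 z.2| ≤ M) {p q : ℝ × ℝ} (hp : p ∈ Ω) (hq : q ∈ Ω) :
    V q - V p ≤ M * |q.1 - p.1| + M ^ 2 * |q.2 - p.2| := by
  have := hV p (q - p) (M * |q.1 - p.1| + M ^ 2 * |q.2 - p.2|) Ω hΩo subset_rfl
    (by simpa using hΩ.segment_subset hp hq) (by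
      filter_upwards [hM] with z hz hzΩ
      have hz := hz hzΩ
      have h1 : v z.1 z.2 * (q.1 - p.1) ≤ M * |q.1 - p.1| :=
        (le_abs_self _).trans ((abs_mul _ _).trans_le (by gcongr))
      have h2 : -v z.1 z.2 ^ 2 * (q.2 - p.2) ≤ M ^ 2 * |q.2 - p.2| := by
        refine (le_abs_self _).trans ((abs_mul _ _).trans_le ?_)
        rw [abs_neg, abs_pow]
        gcongr
      simp only [Prod.fst_sub, Prod.snd_sub]
      linarith)
  simpa using this

theorem abs_sub_le (hV : IsHopfPotential Ω v V) (hΩ : Convex ℝ Ω) (hΩo : IsOpen Ω) {M : ℝ}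
    (hM : ∀ᵐ z : ℝ × ℝ, z ∈ Ω → |v z.1 z.2| ≤ M) {p q : ℝ × ℝ} (hp : p ∈ Ω) (hq : q ∈ Ω) :
    |V q - V p| ≤ M * |q.1 - p.1| + M ^ 2 * |q.2 - p.2| := by
  have h1 := hV.sub_le hΩ hΩo hM hp hq
  have h2 := hV.sub_le hΩ hΩo hM hq hp
  rw [abs_sub_comm p.1, abs_sub_comm p.2] at h2
  rw [abs_le]; constructor <;> linarith

theorem continuousOn (hV : IsHopfPotential Ω v V) (hΩ : Convex ℝ Ω) (hΩo : IsOpen Ω) {M : ℝ}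
    (hM : ∀ᵐ z : ℝ × ℝ, z ∈ Ω → |v z.1 z.2| ≤ M) : ContinuousOn V Ω := by
  intro p hp
  rw [ContinuousWithinAt, tendsto_iff_dist_tendsto_zero]
  refine squeeze_zero' (Eventually.of_forall fun _ => dist_nonneg)
    (g := fun q : ℝ × ℝ => M * |q.1 - p.1| + M ^ 2 * |q.2 - p.2|) ?_ ?_
  · filter_upwards [self_mem_nhdsWithin] with q hq
    exact hV.abs_sub_le hΩ hΩo hM hp hq
  · have : Continuous fun q : ℝ × ℝ => M * |q.1 - p.1| + M ^ 2 * |q.2 - p.2| := by fun_prop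
    simpa using (this.tendsto p).mono_left nhdsWithin_le_nhds

/-- The potential is a subsolution of the Hopf–Lax formula. -/
theorem add_smul_sub_le (hV : IsHopfPotential Ω v V) (hΩ : Convex ℝ Ω) (hΩo : IsOpen Ω)
    {p : ℝ × ℝ} {h q : ℝ} (hh : 0 ≤ h) (hp : p ∈ Ω) (hq : p + h • (q, 1) ∈ Ω) :
    V (p + h • (q, 1)) - V p ≤ h * (q ^ 2 / 4) := by
  refine hV p (h • (q, 1)) _ Ω hΩo subset_rfl (hΩ.segment_subset hp hq) ?_
  filter_upwards with z _
  simp only [Prod.smul_fst, Prod.smul_snd, smul_eq_mul]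
  -- Legendre inequality: `v q - v² = q²/4 - (v - q/2)²`.
  nlinarith [mul_nonneg hh (sq_nonneg (v z.1 z.2 - q / 2))]

/-- Where the field is continuous, the potential is differentiable in `x`. -/
theorem hasDerivAt_fst (hV : IsHopfPotential Ω v V) (hΩo : IsOpen Ω) {p : ℝ × ℝ} (hp : p ∈ Ω)
    (hv : ContinuousAt (fun q : ℝ × ℝ => v q.1 q.2) p) :
    HasDerivAt (fun x => V (x, p.2)) (v p.1 p.2) p.1 := by
  rw [hasDerivAt_iff_isLittleO_nhds_zero, Asymptotics.isLittleO_iff]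
  intro η hη
  have h1 : ∀ᶠ z in 𝓝 p, z ∈ Ω ∧ |v z.1 z.2 - v p.1 p.2| ≤ η := by
    filter_upwards [hΩo.mem_nhds hp, hv.eventually (Metric.closedBall_mem_nhds _ hη)] with z hz0 hz
    exact ⟨hz0, by simpa [Real.dist_eq] using hz⟩
  obtain ⟨r, hr, hball⟩ := Metric.eventually_nhds_iff_ball.1 h1
  filter_upwards [Metric.ball_mem_nhds (0 : ℝ) hr] with h hh
  have hh' : |h| < r := by simpa using hh
  have hmem : p + (h, 0) ∈ Metric.ball p r := by
    simp [dist_eq_norm, Prod.norm_def, hh']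
  have hseg : segment ℝ p (p + (h, 0)) ⊆ Metric.ball p r :=
    (convex_ball p r).segment_subset (Metric.mem_ball_self hr) hmem
  have hb : ∀ z ∈ Metric.ball p r, |v z.1 z.2 * h - v p.1 p.2 * h| ≤ η * |h| := by
    intro z hz
    rw [← sub_mul, abs_mul]
    have := (hball z hz).2
    gcongr
  have u := hV p (h, 0) (v p.1 p.2 * h + η * |h|) _ Metric.isOpen_ball (fun z hz => (hball z hz).1)
    hseg (Eventually.of_forall fun z hz => by
      have := abs_le.1 (hb z hz); simp only; linarith)
  have l := hV.le_sub (κ := v p.1 p.2 * h - η * |h|) Metric.isOpen_ball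
    (fun z hz => (hball z hz).1) hseg (Eventually.of_forall fun z hz => by
      have := abs_le.1 (hb z hz); simp only; linarith)
  have e : p + (h, 0) = (p.1 + h, p.2) := by ext <;> simp
  rw [e] at u l
  rw [Real.norm_eq_abs, Real.norm_eq_abs, smul_eq_mul, abs_le]
  constructor <;> linarith

/-- If the open segment from `p` backwards in the direction of the characteristic enters a region
where `v` is close to `a`, then the potential increases along it as the Hopf–Lax formula asks. -/
theorem eventually_le_sub_of_tendsto (hV : IsHopfPotential Ω v V) (hΩ : Convex ℝ Ω)
    (hΩo : IsOpen Ω) {M : ℝ} (hM : ∀ᵐ z : ℝ × ℝ, z ∈ Ω → |v z.1 z.2| ≤ M) {p : ℝ × ℝ} (hp : p ∈ Ω)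
    {a : ℝ} {R : Set (ℝ × ℝ)}
    (hR : ∀ᶠ r in 𝓝 p, r ∈ R → R ∈ 𝓝 r)
    (ha : ∀ η > 0, ∃ N ∈ 𝓝 p, ∀ᵐ z : ℝ × ℝ, z ∈ N ∩ R → |v z.1 z.2 - a| ≤ η)
    (hray : ∀ᶠ h in 𝓝[>] (0 : ℝ), p - h • (2 * a, (1 : ℝ)) ∈ R) {η : ℝ} (hη : 0 < η) :
    ∀ᶠ h in 𝓝[>] (0 : ℝ), h * (a ^ 2 - η) ≤ V p - V (p - h • (2 * a, (1 : ℝ))) := by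
  -- In the characteristic direction `(2a, 1)` the rate of growth is `2 a v - v² = a² - (v - a)²`,
  -- so closeness `√η` of `v` to `a` costs exactly `η`.
  obtain ⟨N, hN, hNa⟩ := ha (Real.sqrt η) (Real.sqrt_pos.2 hη)
  have hB : ∀ᶠ r in 𝓝 p, r ∈ N ∩ Ω ∧ (r ∈ R → R ∈ 𝓝 r) := by
    filter_upwards [hN, hΩo.mem_nhds hp, hR] with r h1 h2 h3 using ⟨⟨h1, h2⟩, h3⟩
  obtain ⟨U, hU, hUo, hpU⟩ := eventually_nhds_iff.1 hB
  have hBo : IsOpen (U ∩ R) := by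
    rw [isOpen_iff_mem_nhds]
    rintro r ⟨hrU, hrR⟩
    exact inter_mem (hUo.mem_nhds hrU) ((hU r hrU).2 hrR)
  have hcont : Continuous fun h : ℝ => p - h • (2 * a, (1 : ℝ)) := by fun_prop
  have hrayU : ∀ᶠ h in 𝓝[>] (0 : ℝ), p - h • (2 * a, (1 : ℝ)) ∈ U := by
    refine (hcont.tendsto 0).mono_left nhdsWithin_le_nhds (hUo.mem_nhds ?_)
    simpa using hpU
  obtain ⟨h₀, hh₀, hh₀r⟩ := (mem_nhdsGT_iff_exists_Ioo_subset).1 (hray.and hrayU)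
  filter_upwards [Ioo_mem_nhdsGT (show (0 : ℝ) < h₀ from hh₀)] with h hh
  have hmemΩ : ∀ s ∈ Ioo 0 h₀, p - s • (2 * a, (1 : ℝ)) ∈ Ω := fun s hs =>
    (hU _ (hh₀r hs).2).1.2
  -- The end point `p` need not belong to `R`, so the increment is estimated only up to the
  -- parameter `s > 0`; continuity of `V` then allows `s → 0`.
  have hinc : ∀ s ∈ Ioo 0 h, (h - s) * (a ^ 2 - η) ≤
      V (p - s • (2 * a, (1 : ℝ))) - V (p - h • (2 * a, (1 : ℝ))) := by
    intro s hs
    have e : p - h • (2 * a, (1 : ℝ)) + (h - s) • (2 * a, (1 : ℝ)) = p - s • (2 * a, (1 : ℝ)) := by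
      module
    have := hV.le_sub (p := p - h • (2 * a, (1 : ℝ))) (d := (h - s) • (2 * a, (1 : ℝ)))
      (κ := (h - s) * (a ^ 2 - η)) hBo (fun r hr => (hU r hr.1).1.2) (by
        rw [e]
        intro z hz
        rw [segment_eq_image] at hz
        obtain ⟨θ, hθ, rfl⟩ := hz
        have e2 : (1 - θ) • (p - h • (2 * a, (1 : ℝ))) + θ • (p - s • (2 * a, (1 : ℝ)))
            = p - ((1 - θ) * h + θ * s) • (2 * a, (1 : ℝ)) := by module
        simp only [e2]
        have hm : (1 - θ) * h + θ * s ∈ Ioo 0 h₀ := by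
          have h1 := hs.1
          have h2 := hs.2
          have h3 := hh.2
          have h4 := hθ.1
          have h5 := hθ.2
          constructor
          · nlinarith
          · nlinarith
        exact ⟨(hh₀r hm).2, (hh₀r hm).1⟩) (by
        filter_upwards [hNa] with z hz hzB
        have hz' := hz ⟨(hU z hzB.1).1.1, hzB.2⟩
        have hsq : (v z.1 z.2 - a) ^ 2 ≤ η := by
          have := Real.sq_sqrt hη.le
          rw [← sq_abs]
          nlinarith [abs_nonneg (v z.1 z.2 - a)]
        simp only [Prod.smul_fst, Prod.smul_snd, smul_eq_mul]
        nlinarith [mul_nonneg (sub_nonneg.2 hs.2.le) (sub_nonneg.2 hsq)])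
    rwa [e] at this
  have hVp : Tendsto (fun s : ℝ => V (p - s • (2 * a, (1 : ℝ)))) (𝓝[>] 0) (𝓝 (V p)) := by
    have h1 : ContinuousAt V p := (hV.continuousOn hΩ hΩo hM).continuousAt (hΩo.mem_nhds hp)
    have h2 : Tendsto (fun s : ℝ => p - s • (2 * a, (1 : ℝ))) (𝓝[>] 0) (𝓝 p) := by
      have := (hcont.tendsto 0).mono_left (nhdsWithin_le_nhds (s := Ioi 0))
      simpa using this
    exact h1.tendsto.comp h2
  have hl : Tendsto (fun s : ℝ => (h - s) * (a ^ 2 - η)) (𝓝[>] 0) (𝓝 (h * (a ^ 2 - η))) := by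
    have : Continuous fun s : ℝ => (h - s) * (a ^ 2 - η) := by fun_prop
    simpa using (this.tendsto 0).mono_left (nhdsWithin_le_nhds (s := Ioi 0))
  refine le_of_tendsto_of_tendsto hl (hVp.sub_const _) ?_
  filter_upwards [Ioo_mem_nhdsGT hh.1] with s hs using hinc s hs

end IsHopfPotential

/-! ### Regular points, shock lines and backward characteristics. -/

theorem volume_eq_zero_of_countable_slices {s : Set (ℝ × ℝ)} (hs : MeasurableSet s)
    (h : ∀ t, {x | (x, t) ∈ s}.Countable) : volume s = 0 := by
  rw [Measure.volume_eq_prod, Measure.prod_apply_symm hs]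
  simp only [lintegral_eq_zero_iff (measurable_measure_prodMk_right hs)]
  filter_upwards with t
  exact (h t).measure_zero volume

theorem countable_of_forall_nhds {X : Type*} [TopologicalSpace X] [SecondCountableTopology X]
    {s : Set X} (h : ∀ x ∈ s, ∃ N ∈ 𝓝 x, (N ∩ s).Countable) : s.Countable := by
  choose! N hN hc using h
  obtain ⟨t, hts, htc, hcov⟩ := TopologicalSpace.countable_cover_nhdsWithin
    (f := N) (s := s) fun x hx => mem_nhdsWithin_of_mem_nhds (hN x hx)
  refine (htc.biUnion fun x hx => hc x (hts hx)).mono fun y hy => ?_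
  obtain ⟨x, hx, hyx⟩ := mem_iUnion₂.1 (hcov hy)
  exact mem_iUnion₂.2 ⟨x, hx, hyx, hy⟩

/-- The points near which `v` is continuously differentiable. -/
def regularPoints (v : ℝ → ℝ → ℝ) : Set (ℝ × ℝ) :=
  {p | ContDiffAt ℝ 1 (fun q : ℝ × ℝ => v q.1 q.2) p}

theorem isOpen_regularPoints (v : ℝ → ℝ → ℝ) : IsOpen (regularPoints v) := by
  rw [isOpen_iff_mem_nhds]
  intro p hp
  exact ContDiffAt.eventually (hp : ContDiffAt ℝ 1 _ p) (by simp)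

theorem ContDiffAt.exists_isOpen_continuousOn {γ : ℝ → ℝ} {t : ℝ} (h : ContDiffAt ℝ 1 γ t) :
    ∃ I, IsOpen I ∧ t ∈ I ∧ ContinuousOn γ I := by
  obtain ⟨I, h1, h2, h3⟩ := eventually_nhds_iff.1 (h.eventually (by simp))
  exact ⟨I, h2, h3, fun s hs => (h1 s hs).continuousAt.continuousWithinAt⟩

/-- This keeps only what the potential argument needs: the traces at `p` as one-sided limits and the
weak inequality between them. The neighbourhood is shrunk to times where `γ` is continuous, which
makes both sides open and all points off the line regular. -/
theorem IsStableLinePoint.exists_sides {v : ℝ → ℝ → ℝ} {p : ℝ × ℝ} (h : IsStableLinePoint v p) :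
    ∃ (γ : ℝ → ℝ) (a b : ℝ) (U : Set (ℝ × ℝ)), γ p.2 = p.1 ∧ DifferentiableAt ℝ γ p.2 ∧
      b ≤ a ∧ IsOpen U ∧ p ∈ U ∧ IsOpen (U ∩ {q | q.1 < γ q.2}) ∧ IsOpen (U ∩ {q | γ q.2 < q.1}) ∧
      (∀ q ∈ U, q.1 ≠ γ q.2 → q ∈ regularPoints v) ∧
      Tendsto (fun q : ℝ × ℝ => v q.1 q.2) (𝓝[{q | q.1 < γ q.2}] p) (𝓝 a) ∧
      Tendsto (fun q : ℝ × ℝ => v q.1 q.2) (𝓝[{q | γ q.2 < q.1}] p) (𝓝 b) := by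
  obtain ⟨γ, vl, vr, U, hγp, hγ, hU, hpU, cl, dl, cr, dr, el, er, hst⟩ := h
  obtain ⟨I, hI, hpI, hγI⟩ := hγ.exists_isOpen_continuousOn
  have hUI : IsOpen (U ∩ Prod.snd ⁻¹' I) := hU.inter (hI.preimage continuous_snd)
  have hc : ContinuousOn (fun q : ℝ × ℝ => γ q.2) (U ∩ Prod.snd ⁻¹' I) :=
    hγI.comp continuous_snd.continuousOn fun q hq => hq.2
  have oL : IsOpen ((U ∩ Prod.snd ⁻¹' I) ∩ {q | q.1 < γ q.2}) := by
    have := (hc.sub continuous_fst.continuousOn).isOpen_inter_preimage hUI (isOpen_Ioi (a := (0 : ℝ)))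
    simpa [preimage, sub_pos] using this
  have oR : IsOpen ((U ∩ Prod.snd ⁻¹' I) ∩ {q | γ q.2 < q.1}) := by
    have := (continuous_fst.continuousOn.sub hc).isOpen_inter_preimage hUI (isOpen_Ioi (a := (0 : ℝ)))
    simpa [preimage, sub_pos] using this
  refine ⟨γ, vl p, vr p, U ∩ Prod.snd ⁻¹' I, hγp, hγ.differentiableAt (by simp), ?_, hUI,
    ⟨hpU, hpI⟩, oL, oR, ?_, ?_, ?_⟩
  · by_cases he : vl p = vr p
    · exact he.ge
    · exact (hst p hpU hγp.symm he).le
  · intro q hq hne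
    rcases lt_or_gt_of_ne hne with hlt | hlt
    · have hn := oL.mem_nhds ⟨hq, hlt⟩
      have h1 : ContDiffAt ℝ 1 vl q :=
        (dl q ⟨hq.1, hlt⟩).contDiffAt (mem_of_superset hn fun r hr => ⟨hr.1.1, hr.2⟩)
      refine h1.congr_of_eventuallyEq ?_
      filter_upwards [hn] with r hr using el r hr.1.1 hr.2
    · have hn := oR.mem_nhds ⟨hq, hlt⟩
      have h1 : ContDiffAt ℝ 1 vr q :=
        (dr q ⟨hq.1, hlt⟩).contDiffAt (mem_of_superset hn fun r hr => ⟨hr.1.1, hr.2⟩)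
      refine h1.congr_of_eventuallyEq ?_
      filter_upwards [hn] with r hr using er r hr.1.1 hr.2
  · have h1 : Tendsto vl (𝓝[{q | q.1 < γ q.2}] p) (𝓝 (vl p)) := by
      have := cl p ⟨hpU, hγp.ge⟩
      refine this.mono_left ?_
      refine le_inf nhdsWithin_le_nhds (le_principal_iff.2 ?_)
      filter_upwards [self_mem_nhdsWithin, mem_nhdsWithin_of_mem_nhds (hU.mem_nhds hpU)]
        with q hq hqU using ⟨hqU, le_of_lt hq⟩
    refine h1.congr' ?_
    filter_upwards [self_mem_nhdsWithin, mem_nhdsWithin_of_mem_nhds (hU.mem_nhds hpU)]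
      with q hq hqU using (el q hqU hq).symm
  · have h1 : Tendsto vr (𝓝[{q | γ q.2 < q.1}] p) (𝓝 (vr p)) := by
      have := cr p ⟨hpU, hγp.le⟩
      refine this.mono_left ?_
      refine le_inf nhdsWithin_le_nhds (le_principal_iff.2 ?_)
      filter_upwards [self_mem_nhdsWithin, mem_nhdsWithin_of_mem_nhds (hU.mem_nhds hpU)]
        with q hq hqU using ⟨hqU, le_of_lt hq⟩
    refine h1.congr' ?_
    filter_upwards [self_mem_nhdsWithin, mem_nhdsWithin_of_mem_nhds (hU.mem_nhds hpU)]
      with q hq hqU using (er q hqU hq).symm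

theorem continuousAt_of_mem_regularPoints {v : ℝ → ℝ → ℝ} {p : ℝ × ℝ}
    (h : p ∈ regularPoints v) : ContinuousAt (fun q : ℝ × ℝ => v q.1 q.2) p := by
  have h' : ContDiffAt ℝ 1 (fun q : ℝ × ℝ => v q.1 q.2) p := h
  exact h'.continuousAt

section PiecewiseSmooth

variable {Ω : Set (ℝ × ℝ)} {v : ℝ → ℝ → ℝ}

/-- A violation at a point of continuity would persist on a neighbourhood, which has positive
measure. -/
theorem abs_le_of_mem_regularPoints (hΩo : IsOpen Ω) {M : ℝ}
    (hM : ∀ᵐ z : ℝ × ℝ, z ∈ Ω → |v z.1 z.2| ≤ M) {p : ℝ × ℝ} (hp : p ∈ Ω)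
    (hr : p ∈ regularPoints v) : |v p.1 p.2| ≤ M := by
  by_contra! hlt
  have hc : ContinuousAt (fun q : ℝ × ℝ => |v q.1 q.2|) p :=
    (continuousAt_of_mem_regularPoints hr).abs
  have hn : {q : ℝ × ℝ | M < |v q.1 q.2|} ∩ Ω ∈ 𝓝 p :=
    inter_mem (hc.eventually_const_lt hlt) (hΩo.mem_nhds hp)
  have hpos := Measure.measure_pos_of_mem_nhds (volume : Measure (ℝ × ℝ)) hn
  refine hpos.ne' (measure_mono_null ?_ (ae_iff.1 hM))
  intro q hq
  simp only [mem_ofPred_eq, Classical.not_imp, not_le]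
  exact ⟨hq.2, hq.1⟩

/-- Exceptional points are locally finite, and near each of its points a line `x = γ(t)` meets the
horizontal slice only once. Countability on every slice, not merely on almost every one, makes the
restrictions `v(·, t)` usable for all `t`. -/
theorem countable_slice_irregular (hΩo : IsOpen Ω) (hv : IsStablePiecewiseSmooth Ω v) (t : ℝ) :
    {x | (x, t) ∈ Ω \ regularPoints v}.Countable := by
  obtain ⟨P, hP, hst⟩ := hv
  have hc : Continuous fun x : ℝ => (x, t) := by fun_prop
  have h1 : {x | (x, t) ∈ Ω ∩ P}.Countable := by
    refine countable_of_forall_nhds fun x hx => ?_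
    obtain ⟨K, hK, hxK, hKΩ⟩ := exists_compact_subset hΩo hx.1
    refine ⟨_, hc.tendsto x (mem_interior_iff_mem_nhds.1 hxK), ?_⟩
    refine ((hP K hKΩ hK).countable.preimage
      (Prod.mk_left_injective t)).mono fun y hy => ?_
    exact ⟨hy.1, hy.2.2⟩
  have h2 : {x | (x, t) ∈ (Ω \ P) \ regularPoints v}.Countable := by
    refine countable_of_forall_nhds fun x hx => ?_
    rcases hst (x, t) hx.1 with h | h
    · exact absurd h hx.2
    · obtain ⟨γ, a, b, U, hγ, -, -, hU, hpU, -, -, hreg, -, -⟩ := h.exists_sides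
      refine ⟨_, hc.tendsto x (hU.mem_nhds hpU), ?_⟩
      refine (countable_singleton x).mono fun y hy => ?_
      by_contra hne
      refine hy.2.2 (hreg (y, t) hy.1 ?_)
      have : γ t = x := hγ
      simpa [this] using hne
  refine (h1.union h2).mono fun x hx => ?_
  by_cases hxP : (x, t) ∈ P
  · exact Or.inl ⟨hx.1, hxP⟩
  · exact Or.inr ⟨⟨hx.1, hxP⟩, hx.2⟩

theorem ae_mem_regularPoints (hΩo : IsOpen Ω) (hv : IsStablePiecewiseSmooth Ω v) :
    ∀ᵐ z : ℝ × ℝ, z ∈ Ω → z ∈ regularPoints v := by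
  have := volume_eq_zero_of_countable_slices
    (hΩo.measurableSet.diff (isOpen_regularPoints v).measurableSet)
    (countable_slice_irregular hΩo hv)
  rw [ae_iff]
  convert! this using 2
  ext z; simp

/-- At every point that is regular or on a stable discontinuity line, there is a backward
characteristic along which the potential increases at least as the Hopf–Lax formula asks. -/
theorem IsHopfPotential.exists_backward_direction {V : ℝ × ℝ → ℝ} (hV : IsHopfPotential Ω v V)
    (hΩ : Convex ℝ Ω) (hΩo : IsOpen Ω) {M : ℝ} (hM : ∀ᵐ z : ℝ × ℝ, z ∈ Ω → |v z.1 z.2| ≤ M)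
    {p : ℝ × ℝ} (hp : p ∈ Ω) (h : p ∈ regularPoints v ∨ IsStableLinePoint v p) :
    ∃ q : ℝ, |q| ≤ 2 * M ∧ ∀ η > 0, ∀ᶠ h in 𝓝[>] (0 : ℝ),
      h * (q ^ 2 / 4 - η) ≤ V p - V (p - h • (q, (1 : ℝ))) := by
  have key : ∀ a : ℝ, |a| ≤ M → (∀ η > 0, ∀ᶠ h in 𝓝[>] (0 : ℝ),
      h * (a ^ 2 - η) ≤ V p - V (p - h • (2 * a, (1 : ℝ)))) → ∃ q : ℝ, |q| ≤ 2 * M ∧ ∀ η > 0,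
      ∀ᶠ h in 𝓝[>] (0 : ℝ), h * (q ^ 2 / 4 - η) ≤ V p - V (p - h • (q, (1 : ℝ))) := by
    intro a ha h
    refine ⟨2 * a, ?_, fun η hη => ?_⟩
    · rw [abs_mul]; simpa using ha
    · have e : (2 * a) ^ 2 / 4 = a ^ 2 := by ring
      rw [e]; exact h η hη
  rcases h with h | h
  · have hc : ContinuousAt (fun q : ℝ × ℝ => v q.1 q.2) p :=
      continuousAt_of_mem_regularPoints h
    refine key (v p.1 p.2) (abs_le_of_mem_regularPoints hΩo hM hp h) fun η hη => ?_
    refine hV.eventually_le_sub_of_tendsto hΩ hΩo hM hp (R := univ) (by simp) ?_ (by simp) hη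
    intro η hη
    refine ⟨_, hc (Metric.closedBall_mem_nhds _ hη), Eventually.of_forall fun z hz => ?_⟩
    simpa [Real.dist_eq] using hz.1
  · obtain ⟨γ, a, b, U, hγp, hγ, hba, hU, hpU, oL, oR, hreg, tl, tr⟩ := h.exists_sides
    have nl : ∀ η > 0, ∃ N ∈ 𝓝 p, ∀ z ∈ N ∩ {q | q.1 < γ q.2}, |v z.1 z.2 - a| ≤ η := by
      intro η hη
      obtain ⟨N, hN, hs⟩ := mem_nhdsWithin_iff_exists_mem_nhds_inter.1
        (tl (Metric.closedBall_mem_nhds _ hη))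
      exact ⟨N, hN, fun z hz => by simpa [Real.dist_eq] using hs hz⟩
    have nr : ∀ η > 0, ∃ N ∈ 𝓝 p, ∀ z ∈ N ∩ {q | γ q.2 < q.1}, |v z.1 z.2 - b| ≤ η := by
      intro η hη
      obtain ⟨N, hN, hs⟩ := mem_nhdsWithin_iff_exists_mem_nhds_inter.1
        (tr (Metric.closedBall_mem_nhds _ hη))
      exact ⟨N, hN, fun z hz => by simpa [Real.dist_eq] using hs hz⟩
    have hline : Continuous fun x : ℝ => (x, p.2) := by fun_prop
    have hnear : ∀ᶠ z in 𝓝 p, z.1 ≠ γ z.2 → |v z.1 z.2| ≤ M := by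
      filter_upwards [hU.mem_nhds hpU, hΩo.mem_nhds hp] with z hzU hzΩ hne
      exact abs_le_of_mem_regularPoints hΩo hM hzΩ (hreg z hzU hne)
    have hal : |a| ≤ M := by
      have t1 : Tendsto (fun x : ℝ => (x, p.2)) (𝓝[<] p.1) (𝓝[{q | q.1 < γ q.2}] p) := by
        refine tendsto_nhdsWithin_iff.2 ⟨(hline.tendsto p.1).mono_left nhdsWithin_le_nhds, ?_⟩
        filter_upwards [self_mem_nhdsWithin] with x hx
        simpa [hγp] using hx
      refine le_of_tendsto (tl.comp t1).abs ?_
      filter_upwards [t1.eventually (hnear.filter_mono nhdsWithin_le_nhds), self_mem_nhdsWithin]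
        with x hx hlt
      exact hx (by simpa [hγp] using (show x < p.1 from hlt).ne)
    have hbl : |b| ≤ M := by
      have t1 : Tendsto (fun x : ℝ => (x, p.2)) (𝓝[>] p.1) (𝓝[{q | γ q.2 < q.1}] p) := by
        refine tendsto_nhdsWithin_iff.2 ⟨(hline.tendsto p.1).mono_left nhdsWithin_le_nhds, ?_⟩
        filter_upwards [self_mem_nhdsWithin] with x hx
        simpa [hγp] using hx
      refine le_of_tendsto (tr.comp t1).abs ?_
      filter_upwards [t1.eventually (hnear.filter_mono nhdsWithin_le_nhds), self_mem_nhdsWithin]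
        with x hx hlt
      exact hx (by simpa [hγp] using (show p.1 < x from hlt).ne')
    have hopenL : ∀ᶠ r in 𝓝 p, r ∈ {q : ℝ × ℝ | q.1 < γ q.2} → {q : ℝ × ℝ | q.1 < γ q.2} ∈ 𝓝 r := by
      filter_upwards [hU.mem_nhds hpU] with r hrU hr
      exact mem_of_superset (oL.mem_nhds ⟨hrU, hr⟩) inter_subset_right
    have hopenR : ∀ᶠ r in 𝓝 p, r ∈ {q : ℝ × ℝ | γ q.2 < q.1} → {q : ℝ × ℝ | γ q.2 < q.1} ∈ 𝓝 r := by
      filter_upwards [hU.mem_nhds hpU] with r hrU hr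
      exact mem_of_superset (oR.mem_nhds ⟨hrU, hr⟩) inter_subset_right
    have hslope : Tendsto (fun h : ℝ => (p.1 - γ (p.2 - h)) / h) (𝓝[>] 0) (𝓝 (deriv γ p.2)) := by
      have hd : HasDerivAt (fun h : ℝ => - γ (p.2 - h)) (deriv γ p.2) 0 := by
        have h1 : HasDerivAt (fun h : ℝ => p.2 - h) (-1) 0 := by
          simpa using (hasDerivAt_id (0 : ℝ)).const_sub p.2
        have h2 : HasDerivAt γ (deriv γ p.2) (p.2 - 0) := by simpa using hγ.hasDerivAt
        have h3 := (h2.comp (0 : ℝ) h1).neg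
        simp only [mul_neg, mul_one, neg_neg] at h3
        exact h3
      have := hd.tendsto_slope_zero_right
      refine this.congr fun h => ?_
      simp [hγp]; ring
    -- With equal traces, `v` is close to `a` on both sides and the line itself is a null set, so
    -- the whole neighbourhood can serve as the region `R`.
    rcases hba.eq_or_lt with heq | hlt
    · refine key a hal fun η hη => ?_
      refine hV.eventually_le_sub_of_tendsto hΩ hΩo hM hp (R := univ) (by simp) ?_ (by simp) hη
      intro η hη
      obtain ⟨N₁, hN₁, h₁⟩ := nl η hη
      obtain ⟨N₂, hN₂, h₂⟩ := nr η hη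
      refine ⟨N₁ ∩ N₂ ∩ U, inter_mem (inter_mem hN₁ hN₂) (hU.mem_nhds hpU), ?_⟩
      have hnull : volume (U \ ((U ∩ {q : ℝ × ℝ | q.1 < γ q.2}) ∪ (U ∩ {q : ℝ × ℝ | γ q.2 < q.1}))) = 0 := by
        refine volume_eq_zero_of_countable_slices
          (hU.measurableSet.diff (oL.union oR).measurableSet) fun t => ?_
        refine (countable_singleton (γ t)).mono fun x hx => ?_
        by_contra hne
        rcases lt_or_gt_of_ne hne with hl | hl
        · exact hx.2 (Or.inl ⟨hx.1, hl⟩)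
        · exact hx.2 (Or.inr ⟨hx.1, hl⟩)
      filter_upwards [compl_mem_ae_iff.2 hnull] with z hz hzN
      rcases lt_trichotomy z.1 (γ z.2) with hl | hl | hl
      · exact h₁ z ⟨hzN.1.1.1, hl⟩
      · exact absurd ⟨hzN.1.2, fun h => h.elim (fun h => h.2.ne hl) (fun h => h.2.ne' hl)⟩ hz
      · rw [← heq]; exact h₂ z ⟨hzN.1.1.2, hl⟩
    -- If the line is slower than the left characteristic, that characteristic, traced backwards,
    -- lies to the left of the line. Otherwise `γ' ≥ 2a > 2b`, and the right characteristic lies to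
    -- its right. The Rankine–Hugoniot condition plays no role.
    · by_cases hcase : deriv γ p.2 < 2 * a
      · refine key a hal fun η hη => ?_
        refine hV.eventually_le_sub_of_tendsto hΩ hΩo hM hp hopenL ?_ ?_ hη
        · intro η hη
          obtain ⟨N, hN, h₁⟩ := nl η hη
          exact ⟨N, hN, Eventually.of_forall h₁⟩
        · filter_upwards [hslope.eventually_lt_const hcase, self_mem_nhdsWithin] with h hh hpos
          rw [div_lt_iff₀ hpos] at hh
          simp
          linarith
      · refine key b hbl fun η hη => ?_
        refine hV.eventually_le_sub_of_tendsto hΩ hΩo hM hp hopenR ?_ ?_ hη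
        · intro η hη
          obtain ⟨N, hN, h₁⟩ := nr η hη
          exact ⟨N, hN, Eventually.of_forall h₁⟩
        · have hcase' : 2 * b < deriv γ p.2 := by linarith [not_lt.1 hcase]
          filter_upwards [hslope.eventually_const_lt hcase', self_mem_nhdsWithin] with h hh hpos
          rw [lt_div_iff₀ hpos] at hh
          simp
          linarith

end PiecewiseSmooth

/-! ### Time slices and the attainment of the initial value. -/

/-- The integrands differ only on two strips of width `η`, where they are bounded by `M`. This
transfers convergence in the sense of distributions to integrals over intervals. -/
theorem abs_integral_mul_bump_sub_le {g : ℝ → ℝ} (hg : AEStronglyMeasurable g) {M : ℝ}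
    (hM : ∀ᵐ x, |g x| ≤ M) {a b η : ℝ} (hab : a ≤ b) (hη : 0 ≤ η) {ψ : ℝ → ℝ}
    (hψ : Continuous ψ) (h1 : ∀ x ∈ Icc a b, ψ x = 1) (h0 : ∀ x ∉ Icc (a - η) (b + η), ψ x = 0)
    (hψ01 : ∀ x, ψ x ∈ Icc (0 : ℝ) 1) :
    |(∫ x, g x * ψ x) - ∫ x in Icc a b, g x| ≤ 2 * η * M := by
  have hbd : ∀ s : Set ℝ, MeasurableSet s → volume s ≠ ⊤ → IntegrableOn g s := by
    intro s hs hfin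
    refine Measure.integrableOn_of_bounded hfin hg (M := M) (ae_restrict_of_ae ?_)
    simpa using hM
  have hsub : Icc a b ⊆ Icc (a - η) (b + η) := Icc_subset_Icc (by linarith) (by linarith)
  have e1 : ∫ x, g x * ψ x = ∫ x in Icc (a - η) (b + η), g x * ψ x := by
    rw [setIntegral_eq_integral_of_forall_compl_eq_zero]
    intro x hx; rw [h0 x hx, mul_zero]
  have i1 : IntegrableOn (fun x => g x * ψ x) (Icc (a - η) (b + η)) := by
    refine (hbd _ measurableSet_Icc (by simp)).mul_continuousOn hψ.continuousOn isCompact_Icc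
  have e2 : ∫ x in Icc a b, g x = ∫ x in Icc a b, g x * ψ x := by
    refine setIntegral_congr_fun measurableSet_Icc fun x hx => ?_
    simp only [h1 x hx, mul_one]
  have e3 : (∫ x in Icc (a - η) (b + η), g x * ψ x) - ∫ x in Icc a b, g x * ψ x
      = ∫ x in Icc (a - η) (b + η) \ Icc a b, g x * ψ x := by
    rw [setIntegral_sdiff measurableSet_Icc i1 hsub]
  rw [e1, e2, e3]
  have hvol : volume.real (Icc (a - η) (b + η) \ Icc a b) = 2 * η := by
    rw [measureReal_sdiff hsub measurableSet_Icc (h₁ := by simp), Real.volume_real_Icc_of_le (by linarith),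
      Real.volume_real_Icc_of_le hab]
    ring
  have := norm_setIntegral_le_of_norm_le_const_ae' (μ := volume)
    (s := Icc (a - η) (b + η) \ Icc a b) (f := fun x => g x * ψ x) (C := M)
    (measure_lt_top_of_subset sdiff_subset (by simp)) (by
      filter_upwards [hM] with x hx _
      rw [norm_mul, Real.norm_eq_abs, Real.norm_eq_abs, abs_of_nonneg (hψ01 x).1]
      nlinarith [abs_nonneg (g x), (hψ01 x).2, (hψ01 x).1])
  rw [hvol, Real.norm_eq_abs] at this
  linarith

theorem exists_testFunction_approx_indicator {a b η : ℝ} (hab : a < b) (hη : 0 < η) :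
    ∃ ψ : ℝ → ℝ, IsTestFunction ψ ∧ (∀ x ∈ Icc a b, ψ x = 1) ∧
      (∀ x ∉ Icc (a - η) (b + η), ψ x = 0) ∧ ∀ x, ψ x ∈ Icc (0 : ℝ) 1 := by
  let β : ContDiffBump ((a + b) / 2) := ⟨(b - a) / 2, (b - a) / 2 + η, by linarith, by linarith⟩
  refine ⟨β, ⟨β.contDiff, β.hasCompactSupport⟩, fun x hx => ?_, fun x hx => ?_,
    fun x => ⟨β.nonneg, β.le_one⟩⟩
  · apply β.one_of_mem_closedBall
    rw [Real.closedBall_eq_Icc]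
    exact ⟨by simp only [β]; linarith [hx.1], by simp only [β]; linarith [hx.2]⟩
  · apply β.zero_of_le_dist
    by_contra! h
    apply hx
    have h2 : x ∈ Metric.ball ((a + b) / 2) β.rOut := h
    rw [Real.ball_eq_Ioo] at h2
    simp only [β] at h2
    exact ⟨by linarith [h2.1], by linarith [h2.2]⟩

section Slices

variable {Ω : Set (ℝ × ℝ)} {v : ℝ → ℝ → ℝ} {V : ℝ × ℝ → ℝ}

theorem slice_bound (hΩo : IsOpen Ω) {M : ℝ} (hM : ∀ᵐ z : ℝ × ℝ, z ∈ Ω → |v z.1 z.2| ≤ M)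
    (hv : IsStablePiecewiseSmooth Ω v) {t : ℝ} (ht : ∀ x, (x, t) ∈ Ω) :
    ∀ᵐ x, |v x t| ≤ M := by
  filter_upwards [(countable_slice_irregular hΩo hv t).ae_notMem volume] with x hx
  have hx' : (x, t) ∈ regularPoints v := by
    by_contra h
    exact hx ⟨ht x, h⟩
  exact abs_le_of_mem_regularPoints hΩo hM (ht x) hx'

/-- Measurability of a single slice is not part of the solution class; it follows because `v(·, t)`
agrees a.e. with the derivative of `V(·, t)`. -/
theorem IsHopfPotential.slice_measurable (hV : IsHopfPotential Ω v V) (hΩo : IsOpen Ω)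
    (hv : IsStablePiecewiseSmooth Ω v) {t : ℝ} (ht : ∀ x, (x, t) ∈ Ω) :
    AEStronglyMeasurable (fun x => v x t) := by
  refine AEStronglyMeasurable.congr (f := deriv fun x => V (x, t))
    (measurable_deriv _).aestronglyMeasurable ?_
  filter_upwards [(countable_slice_irregular hΩo hv t).ae_notMem volume] with x hx
  have hx' : (x, t) ∈ regularPoints v := by
    by_contra h
    exact hx ⟨ht x, h⟩
  exact (hV.hasDerivAt_fst hΩo (ht x) (continuousAt_of_mem_regularPoints hx')).deriv

/-- The fundamental theorem of calculus for a continuous function differentiable off a countable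
set. -/
theorem IsHopfPotential.slice_integral (hV : IsHopfPotential Ω v V) (hΩ : Convex ℝ Ω)
    (hΩo : IsOpen Ω) {M : ℝ} (hM : ∀ᵐ z : ℝ × ℝ, z ∈ Ω → |v z.1 z.2| ≤ M)
    (hv : IsStablePiecewiseSmooth Ω v) {t : ℝ} (ht : ∀ x, (x, t) ∈ Ω) {a b : ℝ} (hab : a ≤ b) :
    V (b, t) - V (a, t) = ∫ x in Icc a b, v x t := by
  have hc : Continuous fun x : ℝ => V (x, t) := by
    have := (hV.continuousOn hΩ hΩo hM).comp_continuous (f := fun x : ℝ => (x, t))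
      (by fun_prop) ht
    exact this
  have := integral_eq_of_hasDerivAt_off_countable_of_le (fun x => V (x, t)) (fun x => v x t) hab
    (countable_slice_irregular hΩo hv t) hc.continuousOn (fun x hx => by
      have hx' : (x, t) ∈ regularPoints v := by
        by_contra h
        exact hx.2 ⟨ht x, h⟩
      exact hV.hasDerivAt_fst hΩo (ht x) (continuousAt_of_mem_regularPoints hx')) (by
      rw [intervalIntegrable_iff_integrableOn_Icc_of_le hab]
      refine Measure.integrableOn_of_bounded (by simp) (hV.slice_measurable hΩo hv ht) (M := M)
        (ae_restrict_of_ae ?_)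
      simpa using slice_bound hΩo hM hv ht)
  rw [← this, intervalIntegral.integral_of_le hab, integral_Icc_eq_integral_Ioc]

/-- If the initial value is attained in the sense of distributions, the increments of the potential
converge to the integrals of the initial value. -/
theorem IsHopfPotential.tendsto_sub (hV : IsHopfPotential Ω v V) (hΩ : Convex ℝ Ω)
    (hΩo : IsOpen Ω) {M : ℝ} (hM : ∀ᵐ z : ℝ × ℝ, z ∈ Ω → |v z.1 z.2| ≤ M)
    (hv : IsStablePiecewiseSmooth Ω v) (ht : ∀ᶠ t in 𝓝[>] (0 : ℝ), ∀ x, (x, t) ∈ Ω)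
    {w : ℝ → ℝ} (hw : AEStronglyMeasurable w) {N : ℝ} (hN : ∀ᵐ x, |w x| ≤ N)
    (hinit : ∀ ψ : ℝ → ℝ, IsTestFunction ψ →
      Tendsto (fun t => ∫ x, v x t * ψ x) (𝓝[>] 0) (𝓝 (∫ x, w x * ψ x)))
    {a b : ℝ} (hab : a < b) :
    Tendsto (fun t => V (b, t) - V (a, t)) (𝓝[>] 0) (𝓝 (∫ x in Icc a b, w x)) := by
  rw [Metric.tendsto_nhds]
  intro ε hε
  have hMN : 0 < 4 * (|M| + |N| + 1) := by positivity
  set η := ε / (4 * (|M| + |N| + 1)) with hηd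
  have hη : 0 < η := by positivity
  obtain ⟨ψ, hψ, h1, h0, h01⟩ := exists_testFunction_approx_indicator hab hη
  filter_upwards [ht, Metric.tendsto_nhds.1 (hinit ψ hψ) (ε / 2) (half_pos hε)] with t htt htd
  have b1 := abs_integral_mul_bump_sub_le (hV.slice_measurable hΩo hv htt)
    (slice_bound hΩo hM hv htt) hab.le hη.le hψ.1.continuous h1 h0 h01
  have b2 := abs_integral_mul_bump_sub_le hw hN hab.le hη.le hψ.1.continuous h1 h0 h01
  rw [hV.slice_integral hΩ hΩo hM hv htt hab.le]
  rw [Real.dist_eq] at htd ⊢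
  have hηε : 2 * η * M + 2 * η * N < ε / 2 := by
    have : η * (4 * (|M| + |N| + 1)) = ε := by rw [hηd]; field_simp
    nlinarith [le_abs_self M, le_abs_self N]
  rw [abs_le] at b1 b2
  rw [abs_lt] at htd ⊢
  constructor <;> linarith

/-- The potential attains the primitive of the initial value, up to a constant. -/
theorem IsHopfPotential.exists_const (hV : IsHopfPotential Ω v V) (hΩ : Convex ℝ Ω)
    (hΩo : IsOpen Ω) {M : ℝ} (hM : ∀ᵐ z : ℝ × ℝ, z ∈ Ω → |v z.1 z.2| ≤ M)
    (hv : IsStablePiecewiseSmooth Ω v) (ht : ∀ᶠ t in 𝓝[>] (0 : ℝ), ∀ x, (x, t) ∈ Ω)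
    {w : ℝ → ℝ} (hw : AEStronglyMeasurable w) {N : ℝ} (hN : ∀ᵐ x, |w x| ≤ N)
    (hinit : ∀ ψ : ℝ → ℝ, IsTestFunction ψ →
      Tendsto (fun t => ∫ x, v x t * ψ x) (𝓝[>] 0) (𝓝 (∫ x, w x * ψ x)))
    {W : ℝ → ℝ} (hW : ∀ a b, a < b → ∫ x in Icc a b, w x = W b - W a) :
    ∃ c, ∀ p ∈ Ω, 0 < p.2 → |V p - W p.1 - c| ≤ M ^ 2 * p.2 := by
  -- The potential is `M²`-Lipschitz in time, so it has a limit on the vertical line over `0`; the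
  -- limits elsewhere follow from the convergence of the increments in `x`.
  have hlim0 : ∃ c, Tendsto (fun t => V (0, t)) (𝓝[>] (0 : ℝ)) (𝓝 c) := by
    apply cauchy_map_iff_exists_tendsto.1
    rw [Metric.cauchy_iff]
    refine ⟨inferInstance, fun ε hε => ?_⟩
    have hM1 : 0 < M ^ 2 + 1 := by positivity
    have hs : {t | ∀ x, (x, t) ∈ Ω} ∩ Ioo 0 (ε / (M ^ 2 + 1)) ∈ 𝓝[>] (0 : ℝ) :=
      inter_mem ht (Ioo_mem_nhdsGT (by positivity))
    refine ⟨_, image_mem_map hs, ?_⟩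
    rintro _ ⟨s, hs, rfl⟩ _ ⟨r, hr, rfl⟩
    have h1 := hV.abs_sub_le hΩ hΩo hM (hr.1 0) (hs.1 0)
    rw [Real.dist_eq]
    refine h1.trans_lt ?_
    have h2 : |s - r| < ε / (M ^ 2 + 1) := by
      rw [abs_lt]; constructor <;> linarith [hs.2.1, hs.2.2, hr.2.1, hr.2.2]
    rw [lt_div_iff₀ hM1] at h2
    simp only [sub_self, abs_zero, mul_zero, zero_add]
    nlinarith [abs_nonneg (s - r)]
  obtain ⟨c, hc⟩ := hlim0
  have hlim : ∀ x, Tendsto (fun t => V (x, t)) (𝓝[>] (0 : ℝ)) (𝓝 (W x - W 0 + c)) := by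
    intro x
    rcases lt_trichotomy x 0 with hx | rfl | hx
    · have := hc.sub (hV.tendsto_sub hΩ hΩo hM hv ht hw hN hinit hx)
      rw [hW _ _ hx] at this
      convert! this using 2
      · ring
      · ring
    · simpa using hc
    · have := hc.add (hV.tendsto_sub hΩ hΩo hM hv ht hw hN hinit hx)
      rw [hW _ _ hx] at this
      convert! this using 2
      · ring
      · ring
  refine ⟨c - W 0, fun p hp hp2 => ?_⟩
  have h1 : Tendsto (fun s => |V p - V (p.1, s)|) (𝓝[>] (0 : ℝ))
      (𝓝 |V p - (W p.1 - W 0 + c)|) := (tendsto_const_nhds.sub (hlim p.1)).abs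
  have h2 : V p - W p.1 - (c - W 0) = V p - (W p.1 - W 0 + c) := by ring
  rw [h2]
  refine le_of_tendsto h1 ?_
  filter_upwards [ht, Ioo_mem_nhdsGT hp2] with s hs hs2
  refine (hV.abs_sub_le hΩ hΩo hM (hs p.1) hp).trans ?_
  simp only [sub_self, abs_zero, mul_zero, zero_add]
  rw [abs_of_pos (by linarith [hs2.2])]
  have := hs2.1
  nlinarith [sq_nonneg M]

end Slices

/-! ### Comparison with the Hopf–Lax solution. -/

/-- Uniqueness for the potentials: the potential of a stable piecewise smooth solution is the given
Hopf–Lax solution `U`. -/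
theorem IsHopfPotential.eq_of_hopfLax {T : EReal} {v : ℝ → ℝ → ℝ} {V U : ℝ × ℝ → ℝ}
    (hV : IsHopfPotential (timeStrip T) v V) {M : ℝ} (hM0 : 0 ≤ M)
    (hM : ∀ᵐ z : ℝ × ℝ, z ∈ timeStrip T → |v z.1 z.2| ≤ M)
    (hv : IsStablePiecewiseSmooth (timeStrip T) v)
    (hUc : Continuous U)
    (hUsub : ∀ (p : ℝ × ℝ) (h q : ℝ), 0 ≤ h → U p - U (p - h • (q, (1 : ℝ))) ≤ h * (q ^ 2 / 4))
    (hUmin : ∀ x t, 0 < t → ∃ q, U (x - q * t, 0) + t * (q ^ 2 / 4) ≤ U (x, t))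
    {c : ℝ} (hc : ∀ p ∈ timeStrip T, 0 < p.2 → |V p - U (p.1, 0) - c| ≤ M ^ 2 * p.2)
    {p : ℝ × ℝ} (hp : p ∈ timeStrip T) : V p = U p + c := by
  have hΩ := convex_timeStrip T
  have hΩo := isOpen_timeStrip T
  have hlow : ∀ {r : ℝ × ℝ}, r ∈ timeStrip T → ∀ {x s : ℝ}, 0 < s → s ≤ r.2 →
      (x, s) ∈ timeStrip T := fun hr x s hs hsr =>
    ⟨hs, lt_of_le_of_lt (by exact_mod_cast hsr) hr.2⟩
  apply le_antisymm
  -- Upper bound: the subsolution inequality for `V` is applied along the ray that is optimal for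
  -- `U`, from height `s` up to `p`, and then `s → 0`.
  · obtain ⟨q, hq⟩ := hUmin p.1 p.2 hp.1
    have hineq : ∀ s ∈ Ioo 0 p.2,
        V p ≤ U (p.1 - q * (p.2 - s), 0) + c + M ^ 2 * s + (p.2 - s) * (q ^ 2 / 4) := by
      intro s hs
      have hmem : (p.1 - q * (p.2 - s), s) ∈ timeStrip T := hlow hp hs.1 hs.2.le
      have e : ((p.1 - q * (p.2 - s), s) : ℝ × ℝ) + (p.2 - s) • (q, (1 : ℝ)) = p := by
        ext <;> simp; ring
      have h1 := hV.add_smul_sub_le hΩ hΩo (p := (p.1 - q * (p.2 - s), s)) (h := p.2 - s) (q := q)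
        (by linarith [hs.2]) hmem (by rw [e]; exact hp)
      rw [e] at h1
      have h2 := (abs_le.1 (hc _ hmem hs.1)).2
      simp only at h2
      linarith
    have hcont : Continuous fun s : ℝ =>
        U (p.1 - q * (p.2 - s), 0) + c + M ^ 2 * s + (p.2 - s) * (q ^ 2 / 4) := by fun_prop
    have ht := (hcont.tendsto 0).mono_left (nhdsWithin_le_nhds (s := Ioi 0))
    have hle := ge_of_tendsto ht (b := V p) (by
      filter_upwards [Ioo_mem_nhdsGT (show (0 : ℝ) < p.2 from hp.1)] with s hs using hineq s hs)
    simp only [sub_zero, mul_zero, add_zero] at hle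
    linarith
  · by_contra! hlt
    obtain ⟨P, hP, hst⟩ := hv
    set ε := U p + c - V p with hε
    have hεpos : 0 < ε := by linarith
    have hp2 : 0 < p.2 := hp.1
    set δ := ε / (4 * p.2) with hδ
    have hδpos : 0 < δ := by positivity
    have hδp : δ * p.2 = ε / 4 := by rw [hδ]; field_simp
    obtain ⟨τ, hτ0, hτp, hτM⟩ : ∃ τ, 0 < τ ∧ τ < p.2 ∧ M ^ 2 * τ ≤ ε / 4 := by
      refine ⟨min (p.2 / 2) (ε / (4 * (M ^ 2 + 1))), by positivity,
        (min_le_left _ _).trans_lt (by linarith), ?_⟩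
      calc M ^ 2 * min (p.2 / 2) (ε / (4 * (M ^ 2 + 1)))
          ≤ (M ^ 2 + 1) * (ε / (4 * (M ^ 2 + 1))) := by
            gcongr
            · linarith
            · exact min_le_right _ _
        _ = ε / 4 := by field_simp
    -- The penalty `δ t` makes the comparison strict. With `δ p.2 = ε/4` one has `F p = 3ε/4`, while
    -- `M² τ ≤ ε/4` gives `F < ε/4` at height `τ`.
    set F : ℝ × ℝ → ℝ := fun r => U r + c - V r - δ * r.2 with hF
    have hFc : ContinuousOn F (timeStrip T) := by
      have := hV.continuousOn hΩ hΩo hM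
      exact ((hUc.continuousOn.add continuousOn_const).sub this).sub
        (continuous_const.mul continuous_snd).continuousOn
    -- A backward cone with apex `p`, wide enough that backward rays of speed at most `2M` starting
    -- in it stay in it down to height `τ`.
    set K : Set (ℝ × ℝ) := {r | τ ≤ r.2 ∧ r.2 ≤ p.2 ∧ |r.1 - p.1| ≤ (2 * M + 1) * (p.2 - r.2)}
      with hK
    have hKΩ : K ⊆ timeStrip T := fun r hr => hlow hp (x := r.1) (hτ0.trans_le hr.1) hr.2.1
    have hKcl : IsClosed K := by
      have h1 : IsClosed {r : ℝ × ℝ | τ ≤ r.2} := isClosed_le continuous_const continuous_snd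
      have h2 : IsClosed {r : ℝ × ℝ | r.2 ≤ p.2} := isClosed_le continuous_snd continuous_const
      have h3 : IsClosed {r : ℝ × ℝ | |r.1 - p.1| ≤ (2 * M + 1) * (p.2 - r.2)} :=
        isClosed_le (by fun_prop) (by fun_prop)
      exact h1.inter (h2.inter h3)
    have hKc : IsCompact K := by
      refine IsCompact.of_isClosed_subset (isCompact_Icc (a := ((p.1 - (2 * M + 1) * p.2, τ) : ℝ × ℝ))
        (b := (p.1 + (2 * M + 1) * p.2, p.2))) hKcl fun r hr => ?_
      have h1 := abs_le.1 hr.2.2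
      have h2 := hr.1
      have : 0 ≤ (2 * M + 1) * r.2 := mul_nonneg (by linarith) (by linarith)
      refine ⟨⟨?_, hr.1⟩, ⟨?_, hr.2.1⟩⟩ <;> simp only <;> nlinarith
    -- Only finitely many levels are attained at exceptional points of the compact set `K`, so a
    -- level avoiding all of them exists between the bottom values and `F p`.
    obtain ⟨l, hl1, hl2⟩ : ∃ l ∈ Ioo (ε / 4) (3 * ε / 4), l ∉ F '' (K ∩ P) := by
      have hfin : (F '' (K ∩ P)).Finite := (hP K hKΩ hKc).image F
      obtain ⟨l, hl⟩ := ((Ioo_infinite (show ε / 4 < 3 * ε / 4 by linarith)).sdiff hfin).nonempty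
      exact ⟨l, hl.1, hl.2⟩
    have hSc : IsCompact (K ∩ F ⁻¹' Ici l) :=
      hKc.of_isClosed_subset ((hFc.mono hKΩ).preimage_isClosed_of_isClosed hKcl isClosed_Ici)
        inter_subset_left
    have hpK : p ∈ K := ⟨hτp.le, le_rfl, by simp⟩
    have hSne : (K ∩ F ⁻¹' Ici l).Nonempty := by
      refine ⟨p, hpK, ?_⟩
      have := hl1.2
      simp only [mem_preimage, hF, mem_Ici, hδp]
      linarith
    -- The earliest point of the cone where `F` reaches the level `l`: strictly earlier points of
    -- the cone have `F < l`.
    obtain ⟨r, ⟨hrK, hrF⟩, hrmin⟩ := hSc.exists_isMinOn hSne continuous_snd.continuousOn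
    have hrΩ := hKΩ hrK
    have hrτ : τ < r.2 := by
      refine lt_of_le_of_ne hrK.1 fun he => ?_
      have h1 := (abs_le.1 (hc r hrΩ hrΩ.1)).1
      have h2 := hUsub r r.2 0 hrΩ.1.le
      have h3 : r - r.2 • ((0 : ℝ), (1 : ℝ)) = (r.1, 0) := by ext <;> simp
      rw [h3] at h2
      have h4 : l ≤ F r := hrF
      have h5 : 0 < δ * r.2 := mul_pos hδpos hrΩ.1
      have h6 := hl1.1
      simp only [hF] at h4
      rw [← he] at h1
      nlinarith
    have hback : ∀ q : ℝ, |q| ≤ 2 * M → ∀ᶠ h in 𝓝[>] (0 : ℝ), F (r - h • (q, (1 : ℝ))) < l := by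
      intro q hq
      filter_upwards [Ioo_mem_nhdsGT (sub_pos.2 hrτ)] with h hh
      by_contra! hge
      have hm : r - h • (q, (1 : ℝ)) ∈ K := by
        have h1 := hrK.2.1
        have h2 := hrK.2.2
        refine ⟨?_, ?_, ?_⟩
        · simp; linarith [hh.2]
        · simp; linarith [hh.1]
        · simp only [Prod.fst_sub, Prod.smul_fst, smul_eq_mul, Prod.snd_sub, Prod.smul_snd, mul_one]
          rw [abs_le] at h2 hq ⊢
          have := hh.1
          constructor <;> nlinarith
      have h3 : r.2 ≤ (r - h • (q, (1 : ℝ))).2 := hrmin ⟨hm, hge⟩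
      simp at h3
      linarith [hh.1]
    have hFr : F r = l := by
      refine le_antisymm ?_ hrF
      have h1 : ContinuousAt F r := hFc.continuousAt (hΩo.mem_nhds hrΩ)
      have h2 : Tendsto (fun h : ℝ => r - h • ((0 : ℝ), (1 : ℝ))) (𝓝[>] 0) (𝓝 r) := by
        have : Continuous fun h : ℝ => r - h • ((0 : ℝ), (1 : ℝ)) := by fun_prop
        simpa using (this.tendsto 0).mono_left (nhdsWithin_le_nhds (s := Ioi 0))
      refine le_of_tendsto (h1.tendsto.comp h2) ?_
      filter_upwards [hback 0 (by simpa using hM0)] with h hh using hh.le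
    have hrP : r ∉ P := fun h => hl2 ⟨r, ⟨hrK, h⟩, hFr⟩
    obtain ⟨q, hq, hqV⟩ := hV.exists_backward_direction hΩ hΩo hM hrΩ (hst r ⟨hrΩ, hrP⟩)
    -- Along the backward direction at `r`, the two Hopf–Lax inequalities give `F(r - h(q,1)) ≥ F r
    -- + δh/2 > l`, although this point is earlier than `r`.
    obtain ⟨h, h1, h2, h3⟩ := ((hqV (δ / 2) (half_pos hδpos)).and
      ((hback q hq).and self_mem_nhdsWithin)).exists
    have h3' : 0 < h := h3
    have h4 := hUsub r h q h3'.le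
    rw [← hFr] at h2
    simp only [hF, Prod.snd_sub, Prod.smul_snd, smul_eq_mul, mul_one] at h2
    nlinarith

/-! ### The two-shock function and its explicit potential. -/

theorem measurable_heavisideFn : Measurable heavisideFn :=
  Measurable.ite measurableSet_Ioi measurable_const measurable_const

theorem heavisideFn_of_pos {x : ℝ} (h : 0 < x) : heavisideFn x = 1 := if_pos h

theorem heavisideFn_of_nonpos {x : ℝ} (h : x ≤ 0) : heavisideFn x = 0 := if_neg h.not_gt

theorem heavisideFn_mem_Icc (x : ℝ) : heavisideFn x ∈ Icc (0 : ℝ) 1 := by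
  unfold heavisideFn; split_ifs <;> simp

theorem tendsto_heavisideFn {ι : Type*} {l : Filter ι} {f : ι → ℝ} {a : ℝ} (ha : a ≠ 0)
    (hf : Tendsto f l (𝓝 a)) : Tendsto (fun i => heavisideFn (f i)) l (𝓝 (heavisideFn a)) := by
  rcases lt_or_gt_of_ne ha with h | h
  · refine tendsto_const_nhds.congr' ?_
    filter_upwards [hf.eventually_lt_const h] with i hi
    rw [heavisideFn_of_nonpos h.le, heavisideFn_of_nonpos hi.le]
  · refine tendsto_const_nhds.congr' ?_
    filter_upwards [hf.eventually_const_lt h] with i hi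
    rw [heavisideFn_of_pos h, heavisideFn_of_pos hi]

theorem abs_twoStep_le (u₀ : ℝ) {e₁ e₂ : ℝ} (he₁ : 0 < e₁) (he₂ : 0 < e₂) (y z : ℝ) :
    |u₀ + e₁ * heavisideFn y + e₂ * heavisideFn z| ≤ |u₀| + e₁ + e₂ := by
  have h1 := heavisideFn_mem_Icc y
  have h2 := heavisideFn_mem_Icc z
  rw [abs_le]
  constructor
  · nlinarith [neg_abs_le u₀, h1.1, h2.1]
  · nlinarith [le_abs_self u₀, h1.2, h2.2]

/-- Weak continuity of two-step functions with respect to the positions of the jumps. -/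
theorem tendsto_integral_twoStep {ι : Type*} {l : Filter ι} [l.IsCountablyGenerated]
    (u₀ : ℝ) {e₁ e₂ : ℝ} (he₁ : 0 < e₁) (he₂ : 0 < e₂) {f₁ f₂ : ι → ℝ} {b₁ b₂ : ℝ}
    (h₁ : Tendsto f₁ l (𝓝 b₁)) (h₂ : Tendsto f₂ l (𝓝 b₂)) {ψ : ℝ → ℝ} (hψ : IsTestFunction ψ) :
    Tendsto (fun i => ∫ x, (u₀ + e₁ * heavisideFn (-x + f₁ i) + e₂ * heavisideFn (-x + f₂ i)) * ψ x)
      l (𝓝 (∫ x, (u₀ + e₁ * heavisideFn (-x + b₁) + e₂ * heavisideFn (-x + b₂)) * ψ x)) := by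
  have hint : Integrable ψ := hψ.1.continuous.integrable_of_hasCompactSupport hψ.2
  refine tendsto_integral_filter_of_dominated_convergence (fun x => (|u₀| + e₁ + e₂) * ‖ψ x‖)
    (Eventually.of_forall fun i => ?_) (Eventually.of_forall fun i => Eventually.of_forall fun x => ?_)
    (hint.norm.const_mul _) ?_
  · have m : ∀ b : ℝ, Measurable fun x : ℝ => heavisideFn (-x + b) := fun b =>
      measurable_heavisideFn.comp (by fun_prop)
    exact (((measurable_const.add ((m _).const_mul _)).add
      ((m _).const_mul _)).mul hψ.1.continuous.measurable).aestronglyMeasurable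
  · rw [norm_mul]
    exact mul_le_mul_of_nonneg_right (abs_twoStep_le u₀ he₁ he₂ _ _) (norm_nonneg _)
  · filter_upwards [(countable_singleton b₁).ae_notMem volume,
      (countable_singleton b₂).ae_notMem volume] with x hx1 hx2
    have n1 : -x + b₁ ≠ 0 := fun h => hx1 (by simp only [mem_singleton_iff]; linarith)
    have n2 : -x + b₂ ≠ 0 := fun h => hx2 (by simp only [mem_singleton_iff]; linarith)
    exact ((tendsto_const_nhds.add ((tendsto_heavisideFn n1 (h₁.const_add _)).const_mul _)).add
      ((tendsto_heavisideFn n2 (h₂.const_add _)).const_mul _)).mul_const _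

theorem twoJumpData_eq (u₀ e₁ e₂ : ℝ) {x₁ x₂ : ℝ} (hx : x₁ < x₂) (x : ℝ) :
    twoJumpData u₀ e₁ e₂ x₁ x₂ x
      = u₀ + e₁ * heavisideFn (-x + x₁) + e₂ * heavisideFn (-x + x₂) := by
  unfold twoJumpData
  split_ifs with h1 h2
  · rw [heavisideFn_of_pos (by linarith), heavisideFn_of_pos (by linarith)]; ring
  · rw [heavisideFn_of_nonpos (by linarith), heavisideFn_of_pos (by linarith)]; ring
  · rw [heavisideFn_of_nonpos (by linarith), heavisideFn_of_nonpos (by linarith)]; ring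

/-- The trajectory of the centre of the jumps. -/
noncomputable def hopfCenter (u₀ e₁ e₂ x₁ x₂ t : ℝ) : ℝ :=
  (e₁ * x₁ + e₂ * x₂) / (e₁ + e₂) + (2 * u₀ + e₁ + e₂) * t

/-- The distance of the shocks. -/
noncomputable def hopfGap (e₁ e₂ x₁ x₂ t : ℝ) : ℝ := max (x₂ - x₁ - (e₁ + e₂) * t) 0

/-- The primitive of a constant state `a`. -/
noncomputable def affinePotential (a c : ℝ) (p : ℝ × ℝ) : ℝ := a * p.1 - a ^ 2 * p.2 + c

/-- The potential of the two-shock solution. -/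
noncomputable def hopfPotential (u₀ e₁ e₂ x₁ x₂ : ℝ) (p : ℝ × ℝ) : ℝ :=
  min (affinePotential (u₀ + e₁ + e₂) (- e₂ * x₂ - e₁ * x₁) p)
    (min (affinePotential (u₀ + e₂) (- e₂ * x₂) p) (affinePotential u₀ 0 p))

theorem continuous_affinePotential (a c : ℝ) : Continuous (affinePotential a c) := by
  unfold affinePotential; fun_prop

theorem hasFDerivAt_affinePotential (a c : ℝ) (p : ℝ × ℝ) :
    HasFDerivAt (affinePotential a c)
      (a • ContinuousLinearMap.fst ℝ ℝ ℝ - a ^ 2 • ContinuousLinearMap.snd ℝ ℝ ℝ) p := by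
  have h := (a • ContinuousLinearMap.fst ℝ ℝ ℝ - a ^ 2 • ContinuousLinearMap.snd ℝ ℝ ℝ).hasFDerivAt
    (x := p)
  exact h.add_const c

theorem exists_lipschitzWith_affinePotential (a c : ℝ) :
    ∃ C, LipschitzWith C (affinePotential a c) := by
  refine ⟨_, lipschitzWith_of_nnnorm_fderiv_le (𝕜 := ℝ)
    (C := ‖a • ContinuousLinearMap.fst ℝ ℝ ℝ - a ^ 2 • ContinuousLinearMap.snd ℝ ℝ ℝ‖₊)
    (fun p => (hasFDerivAt_affinePotential a c p).differentiableAt) fun p => ?_⟩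
  rw [(hasFDerivAt_affinePotential a c p).fderiv]

/-- Again `a q - a² ≤ q²/4`. Inequalities of this form survive taking minima, hence pass to
`hopfPotential`. -/
theorem affinePotential_sub_le (a c : ℝ) (p : ℝ × ℝ) (h q : ℝ) (hh : 0 ≤ h) :
    affinePotential a c p ≤ affinePotential a c (p - h • (q, (1 : ℝ))) + h * (q ^ 2 / 4) := by
  simp only [affinePotential, Prod.fst_sub, Prod.smul_fst, smul_eq_mul, Prod.snd_sub,
    Prod.smul_snd, mul_one]
  nlinarith [mul_nonneg hh (sq_nonneg (a - q / 2))]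

section TwoShock

variable {u₀ e₁ e₂ x₁ x₂ : ℝ}

theorem mergeTime_mul (he₁ : 0 < e₁) (he₂ : 0 < e₂) :
    (e₁ + e₂) * mergeTime e₁ e₂ x₁ x₂ = x₂ - x₁ := by
  unfold mergeTime; field_simp

/-- Momentum conservation fixes the motion of the centre through the merger; the distance decreases
at rate `e₁ + e₂` and then stays zero. In these variables both regimes are one formula, continuous
in `t` and ready to be smoothed. -/
theorem hopfPhase₁_eq (he₁ : 0 < e₁) (he₂ : 0 < e₂) (t : ℝ) :
    hopfPhase₁ u₀ e₁ e₂ x₁ x₂ t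
      = hopfCenter u₀ e₁ e₂ x₁ x₂ t - e₂ / (e₁ + e₂) * hopfGap e₁ e₂ x₁ x₂ t := by
  have hm := mergeTime_mul (x₁ := x₁) (x₂ := x₂) he₁ he₂
  have hE : 0 < e₁ + e₂ := by linarith
  have hx2 : x₂ = x₁ + (e₁ + e₂) * mergeTime e₁ e₂ x₁ x₂ := by linarith
  unfold hopfPhase₁ hopfCenter hopfGap
  generalize mergeTime e₁ e₂ x₁ x₂ = s at *
  subst hx2
  rcases le_or_gt t s with h | h
  · rw [heavisideFn_of_nonpos (by linarith), max_eq_left (by nlinarith)]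
    field_simp; ring
  · rw [heavisideFn_of_pos (by linarith), max_eq_right (by nlinarith)]
    field_simp; ring

theorem hopfPhase₂_eq (he₁ : 0 < e₁) (he₂ : 0 < e₂) (t : ℝ) :
    hopfPhase₂ u₀ e₁ e₂ x₁ x₂ t
      = hopfCenter u₀ e₁ e₂ x₁ x₂ t + e₁ / (e₁ + e₂) * hopfGap e₁ e₂ x₁ x₂ t := by
  have hm := mergeTime_mul (x₁ := x₁) (x₂ := x₂) he₁ he₂
  have hE : 0 < e₁ + e₂ := by linarith
  have hx2 : x₂ = x₁ + (e₁ + e₂) * mergeTime e₁ e₂ x₁ x₂ := by linarith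
  unfold hopfPhase₂ hopfCenter hopfGap
  generalize mergeTime e₁ e₂ x₁ x₂ = s at *
  subst hx2
  rcases le_or_gt t s with h | h
  · rw [heavisideFn_of_nonpos (by linarith), max_eq_left (by nlinarith)]
    field_simp; ring
  · rw [heavisideFn_of_pos (by linarith), max_eq_right (by nlinarith)]
    field_simp; ring

theorem continuous_hopfPhase₁ (he₁ : 0 < e₁) (he₂ : 0 < e₂) :
    Continuous (hopfPhase₁ u₀ e₁ e₂ x₁ x₂) := by
  rw [funext (hopfPhase₁_eq (u₀ := u₀) (x₁ := x₁) (x₂ := x₂) he₁ he₂)]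
  unfold hopfCenter hopfGap; fun_prop

theorem continuous_hopfPhase₂ (he₁ : 0 < e₁) (he₂ : 0 < e₂) :
    Continuous (hopfPhase₂ u₀ e₁ e₂ x₁ x₂) := by
  rw [funext (hopfPhase₂_eq (u₀ := u₀) (x₁ := x₁) (x₂ := x₂) he₁ he₂)]
  unfold hopfCenter hopfGap; fun_prop

theorem hopfPhase₁_le_hopfPhase₂ (he₁ : 0 < e₁) (he₂ : 0 < e₂) (t : ℝ) :
    hopfPhase₁ u₀ e₁ e₂ x₁ x₂ t ≤ hopfPhase₂ u₀ e₁ e₂ x₁ x₂ t := by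
  rw [hopfPhase₁_eq he₁ he₂, hopfPhase₂_eq he₁ he₂]
  have h : 0 ≤ hopfGap e₁ e₂ x₁ x₂ t := le_max_right _ _
  have h1 : 0 ≤ e₂ / (e₁ + e₂) * hopfGap e₁ e₂ x₁ x₂ t := by positivity
  have h2 : 0 ≤ e₁ / (e₁ + e₂) * hopfGap e₁ e₂ x₁ x₂ t := by positivity
  linarith

theorem hopfPhase₁_of_le {t : ℝ} (ht : t ≤ mergeTime e₁ e₂ x₁ x₂) :
    hopfPhase₁ u₀ e₁ e₂ x₁ x₂ t = x₁ + (2 * u₀ + e₁ + 2 * e₂) * t := by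
  rw [hopfPhase₁, heavisideFn_of_nonpos (by linarith)]; ring

theorem hopfPhase₂_of_le {t : ℝ} (ht : t ≤ mergeTime e₁ e₂ x₁ x₂) :
    hopfPhase₂ u₀ e₁ e₂ x₁ x₂ t = x₂ + (2 * u₀ + e₂) * t := by
  rw [hopfPhase₂, heavisideFn_of_nonpos (by linarith)]; ring

theorem hopfGap_of_ge (he₁ : 0 < e₁) (he₂ : 0 < e₂) {t : ℝ} (ht : mergeTime e₁ e₂ x₁ x₂ ≤ t) :
    hopfGap e₁ e₂ x₁ x₂ t = 0 := by
  have := mergeTime_mul (x₁ := x₁) (x₂ := x₂) he₁ he₂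
  exact max_eq_right (by nlinarith)

theorem hopfPhase₁_of_ge (he₁ : 0 < e₁) (he₂ : 0 < e₂) {t : ℝ} (ht : mergeTime e₁ e₂ x₁ x₂ ≤ t) :
    hopfPhase₁ u₀ e₁ e₂ x₁ x₂ t = hopfCenter u₀ e₁ e₂ x₁ x₂ t := by
  rw [hopfPhase₁_eq he₁ he₂, hopfGap_of_ge he₁ he₂ ht]; ring

theorem hopfPhase₂_of_ge (he₁ : 0 < e₁) (he₂ : 0 < e₂) {t : ℝ} (ht : mergeTime e₁ e₂ x₁ x₂ ≤ t) :
    hopfPhase₂ u₀ e₁ e₂ x₁ x₂ t = hopfCenter u₀ e₁ e₂ x₁ x₂ t := by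
  rw [hopfPhase₂_eq he₁ he₂, hopfGap_of_ge he₁ he₂ ht]; ring

theorem mergeTime_pos (he₁ : 0 < e₁) (he₂ : 0 < e₂) (hx : x₁ < x₂) :
    0 < mergeTime e₁ e₂ x₁ x₂ := div_pos (by linarith) (by linarith)

theorem hopfTwoShock_left (he₁ : 0 < e₁) (he₂ : 0 < e₂) {x t : ℝ}
    (h : x < hopfPhase₁ u₀ e₁ e₂ x₁ x₂ t) :
    hopfTwoShock u₀ e₁ e₂ x₁ x₂ x t = u₀ + e₁ + e₂ := by
  have := hopfPhase₁_le_hopfPhase₂ (u₀ := u₀) (x₁ := x₁) (x₂ := x₂) he₁ he₂ t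
  rw [hopfTwoShock, heavisideFn_of_pos (by linarith), heavisideFn_of_pos (by linarith)]; ring

theorem hopfTwoShock_mid {x t : ℝ} (h₁ : hopfPhase₁ u₀ e₁ e₂ x₁ x₂ t ≤ x)
    (h₂ : x < hopfPhase₂ u₀ e₁ e₂ x₁ x₂ t) :
    hopfTwoShock u₀ e₁ e₂ x₁ x₂ x t = u₀ + e₂ := by
  rw [hopfTwoShock, heavisideFn_of_nonpos (by linarith), heavisideFn_of_pos (by linarith)]; ring

theorem hopfTwoShock_right (he₁ : 0 < e₁) (he₂ : 0 < e₂) {x t : ℝ}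
    (h : hopfPhase₂ u₀ e₁ e₂ x₁ x₂ t ≤ x) :
    hopfTwoShock u₀ e₁ e₂ x₁ x₂ x t = u₀ := by
  have := hopfPhase₁_le_hopfPhase₂ (u₀ := u₀) (x₁ := x₁) (x₂ := x₂) he₁ he₂ t
  rw [hopfTwoShock, heavisideFn_of_nonpos (by linarith), heavisideFn_of_nonpos (by linarith)]; ring

/-- The affine pieces for the outer left and middle states agree on `x = x₁ + (2u₀ + e₁ + 2e₂)t`,
those for the two outer states on the trajectory of the centre. The bound by the first phase puts
`p` to the left of both lines, where the steepest piece is smallest. -/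
theorem hopfPotential_left (he₁ : 0 < e₁) (he₂ : 0 < e₂) {p : ℝ × ℝ}
    (h : p.1 ≤ hopfPhase₁ u₀ e₁ e₂ x₁ x₂ p.2) :
    hopfPotential u₀ e₁ e₂ x₁ x₂ p
      = affinePotential (u₀ + e₁ + e₂) (- e₂ * x₂ - e₁ * x₁) p := by
  have hE : 0 < e₁ + e₂ := by linarith
  rw [hopfPhase₁_eq he₁ he₂, hopfCenter, hopfGap] at h
  have h1 := le_max_left (x₂ - x₁ - (e₁ + e₂) * p.2) 0
  have h2 := le_max_right (x₂ - x₁ - (e₁ + e₂) * p.2) 0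
  generalize max (x₂ - x₁ - (e₁ + e₂) * p.2) 0 = D at *
  have h' : (e₁ + e₂) * p.1 ≤ e₁ * x₁ + e₂ * x₂ + (e₁ + e₂) * ((2 * u₀ + e₁ + e₂) * p.2) - e₂ * D := by
    have := mul_le_mul_of_nonneg_left h hE.le
    refine this.trans_eq ?_
    field_simp
  refine min_eq_left (le_min ?_ ?_)
  · unfold affinePotential
    have : 0 ≤ x₁ + (2 * u₀ + e₁ + 2 * e₂) * p.2 - p.1 := by
      refine nonneg_of_mul_nonneg_right (a := e₁ + e₂) ?_ hE
      nlinarith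
    nlinarith
  · unfold affinePotential
    nlinarith

theorem hopfPotential_right (he₁ : 0 < e₁) (he₂ : 0 < e₂) {p : ℝ × ℝ}
    (h : hopfPhase₂ u₀ e₁ e₂ x₁ x₂ p.2 ≤ p.1) :
    hopfPotential u₀ e₁ e₂ x₁ x₂ p = affinePotential u₀ 0 p := by
  have hE : 0 < e₁ + e₂ := by linarith
  rw [hopfPhase₂_eq he₁ he₂, hopfCenter, hopfGap] at h
  have h1 := le_max_left (x₂ - x₁ - (e₁ + e₂) * p.2) 0
  have h2 := le_max_right (x₂ - x₁ - (e₁ + e₂) * p.2) 0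
  generalize max (x₂ - x₁ - (e₁ + e₂) * p.2) 0 = D at *
  have h' : e₁ * x₁ + e₂ * x₂ + (e₁ + e₂) * ((2 * u₀ + e₁ + e₂) * p.2) + e₁ * D ≤ (e₁ + e₂) * p.1 := by
    have := mul_le_mul_of_nonneg_left h hE.le
    refine Eq.trans_le ?_ this
    field_simp
  have hA : affinePotential u₀ 0 p ≤ affinePotential (u₀ + e₂) (- e₂ * x₂) p := by
    unfold affinePotential
    have : 0 ≤ p.1 - (x₂ + (2 * u₀ + e₂) * p.2) := by
      refine nonneg_of_mul_nonneg_right (a := e₁ + e₂) ?_ hE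
      nlinarith
    nlinarith
  rw [hopfPotential, min_eq_right hA, min_eq_right]
  unfold affinePotential
  nlinarith

/-- The middle region is empty after the merger, so only the linear formulas for the phases are
needed. -/
theorem hopfPotential_mid (he₁ : 0 < e₁) (he₂ : 0 < e₂) {p : ℝ × ℝ}
    (h₁ : hopfPhase₁ u₀ e₁ e₂ x₁ x₂ p.2 ≤ p.1) (h₂ : p.1 < hopfPhase₂ u₀ e₁ e₂ x₁ x₂ p.2) :
    hopfPotential u₀ e₁ e₂ x₁ x₂ p = affinePotential (u₀ + e₂) (- e₂ * x₂) p := by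
  have ht : p.2 ≤ mergeTime e₁ e₂ x₁ x₂ := by
    by_contra! h
    rw [hopfPhase₁_of_ge he₁ he₂ h.le] at h₁
    rw [hopfPhase₂_of_ge he₁ he₂ h.le] at h₂
    linarith
  rw [hopfPhase₁_of_le ht] at h₁
  rw [hopfPhase₂_of_le ht] at h₂
  rw [hopfPotential, min_eq_left (a := affinePotential (u₀ + e₂) (- e₂ * x₂) p), min_eq_right]
  · unfold affinePotential; nlinarith
  · unfold affinePotential; nlinarith

theorem continuous_hopfPotential : Continuous (hopfPotential u₀ e₁ e₂ x₁ x₂) :=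
  (continuous_affinePotential _ _).min
    ((continuous_affinePotential _ _).min (continuous_affinePotential _ _))

theorem exists_lipschitzWith_hopfPotential :
    ∃ C, LipschitzWith C (hopfPotential u₀ e₁ e₂ x₁ x₂) := by
  obtain ⟨C₀, h₀⟩ := exists_lipschitzWith_affinePotential (u₀ + e₁ + e₂) (- e₂ * x₂ - e₁ * x₁)
  obtain ⟨C₁, h₁⟩ := exists_lipschitzWith_affinePotential (u₀ + e₂) (- e₂ * x₂)
  obtain ⟨C₂, h₂⟩ := exists_lipschitzWith_affinePotential u₀ 0
  exact ⟨_, h₀.min (h₁.min h₂)⟩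

theorem hopfPotential_sub_le (p : ℝ × ℝ) (h q : ℝ) (hh : 0 ≤ h) :
    hopfPotential u₀ e₁ e₂ x₁ x₂ p - hopfPotential u₀ e₁ e₂ x₁ x₂ (p - h • (q, (1 : ℝ)))
      ≤ h * (q ^ 2 / 4) := by
  rw [sub_le_iff_le_add', hopfPotential, hopfPotential, min_add, min_add]
  exact min_le_min (affinePotential_sub_le _ _ _ _ _ hh)
    (min_le_min (affinePotential_sub_le _ _ _ _ _ hh) (affinePotential_sub_le _ _ _ _ _ hh))

/-- For the affine piece with slope `a` that realizes the minimum at `(x, t)`, the Hopf–Lax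
inequality is an equality along its characteristic, of speed `q = 2a`. -/
theorem exists_hopfPotential_le (x t : ℝ) :
    ∃ q, hopfPotential u₀ e₁ e₂ x₁ x₂ (x - q * t, 0) + t * (q ^ 2 / 4)
      ≤ hopfPotential u₀ e₁ e₂ x₁ x₂ (x, t) := by
  have key : ∀ a c, (∀ p, hopfPotential u₀ e₁ e₂ x₁ x₂ p ≤ affinePotential a c p) →
      hopfPotential u₀ e₁ e₂ x₁ x₂ (x, t) = affinePotential a c (x, t) →
      ∃ q, hopfPotential u₀ e₁ e₂ x₁ x₂ (x - q * t, 0) + t * (q ^ 2 / 4)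
      ≤ hopfPotential u₀ e₁ e₂ x₁ x₂ (x, t) := by
    intro a c hle he
    refine ⟨2 * a, ?_⟩
    have := hle (x - 2 * a * t, 0)
    rw [he]
    simp only [affinePotential] at this ⊢
    linarith
  rcases min_choice (affinePotential (u₀ + e₁ + e₂) (- e₂ * x₂ - e₁ * x₁) (x, t))
    (min (affinePotential (u₀ + e₂) (- e₂ * x₂) (x, t)) (affinePotential u₀ 0 (x, t))) with h | h
  · exact key _ _ (fun p => min_le_left _ _) h
  · rcases min_choice (affinePotential (u₀ + e₂) (- e₂ * x₂) (x, t))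
      (affinePotential u₀ 0 (x, t)) with h' | h'
    · exact key _ _ (fun p => (min_le_right _ _).trans (min_le_left _ _)) (h.trans h')
    · exact key _ _ (fun p => (min_le_right _ _).trans (min_le_right _ _)) (h.trans h')

/-- Off the shocks, the two-shock solution is locally constant and it is locally the gradient of
the potential. -/
theorem hopfTwoShock_eventually (he₁ : 0 < e₁) (he₂ : 0 < e₂) {p : ℝ × ℝ}
    (h₁ : p.1 ≠ hopfPhase₁ u₀ e₁ e₂ x₁ x₂ p.2) (h₂ : p.1 ≠ hopfPhase₂ u₀ e₁ e₂ x₁ x₂ p.2) :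
    (∀ᶠ q in 𝓝 p, hopfTwoShock u₀ e₁ e₂ x₁ x₂ q.1 q.2 = hopfTwoShock u₀ e₁ e₂ x₁ x₂ p.1 p.2) ∧
    HasFDerivAt (hopfPotential u₀ e₁ e₂ x₁ x₂)
      (hopfTwoShock u₀ e₁ e₂ x₁ x₂ p.1 p.2 • ContinuousLinearMap.fst ℝ ℝ ℝ
        - hopfTwoShock u₀ e₁ e₂ x₁ x₂ p.1 p.2 ^ 2 • ContinuousLinearMap.snd ℝ ℝ ℝ) p := by
  have c1 : Continuous fun q : ℝ × ℝ => hopfPhase₁ u₀ e₁ e₂ x₁ x₂ q.2 :=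
    (continuous_hopfPhase₁ he₁ he₂).comp continuous_snd
  have c2 : Continuous fun q : ℝ × ℝ => hopfPhase₂ u₀ e₁ e₂ x₁ x₂ q.2 :=
    (continuous_hopfPhase₂ he₁ he₂).comp continuous_snd
  rcases lt_or_gt_of_ne h₁ with h | h
  · have hn := (isOpen_lt continuous_fst c1).mem_nhds h
    rw [hopfTwoShock_left he₁ he₂ h]
    refine ⟨?_, (hasFDerivAt_affinePotential _ _ p).congr_of_eventuallyEq
      (f := affinePotential (u₀ + e₁ + e₂) (- e₂ * x₂ - e₁ * x₁)) ?_⟩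
    · filter_upwards [hn] with q hq using hopfTwoShock_left he₁ he₂ hq
    · filter_upwards [hn] with q hq using hopfPotential_left he₁ he₂ (le_of_lt hq)
  rcases lt_or_gt_of_ne h₂ with h' | h'
  · have hn := (isOpen_lt c1 continuous_fst).mem_nhds h
    have hn' := (isOpen_lt continuous_fst c2).mem_nhds h'
    rw [hopfTwoShock_mid (le_of_lt h) h']
    refine ⟨?_, (hasFDerivAt_affinePotential _ _ p).congr_of_eventuallyEq
      (f := affinePotential (u₀ + e₂) (- e₂ * x₂)) ?_⟩
    · filter_upwards [hn, hn'] with q hq hq' using hopfTwoShock_mid (le_of_lt hq) hq'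
    · filter_upwards [hn, hn'] with q hq hq' using hopfPotential_mid he₁ he₂ (le_of_lt hq) hq'
  · have hn := (isOpen_lt c2 continuous_fst).mem_nhds h'
    rw [hopfTwoShock_right he₁ he₂ (le_of_lt h')]
    refine ⟨?_, (hasFDerivAt_affinePotential _ _ p).congr_of_eventuallyEq
      (f := affinePotential u₀ 0) ?_⟩
    · filter_upwards [hn] with q hq using hopfTwoShock_right he₁ he₂ (le_of_lt hq)
    · filter_upwards [hn] with q hq using hopfPotential_right he₁ he₂ (le_of_lt hq)

theorem ae_ne_hopfPhase (he₁ : 0 < e₁) (he₂ : 0 < e₂) :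
    ∀ᵐ p : ℝ × ℝ, p.1 ≠ hopfPhase₁ u₀ e₁ e₂ x₁ x₂ p.2 ∧ p.1 ≠ hopfPhase₂ u₀ e₁ e₂ x₁ x₂ p.2 := by
  have key : ∀ φ : ℝ → ℝ, Continuous φ → ∀ᵐ p : ℝ × ℝ, p.1 ≠ φ p.2 := by
    intro φ hφ
    rw [ae_iff]
    refine volume_eq_zero_of_countable_slices ?_ fun t => ?_
    · simp only [ne_eq, not_not]
      exact (isClosed_eq continuous_fst (hφ.comp continuous_snd)).measurableSet
    · refine (countable_singleton (φ t)).mono fun x hx => ?_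
      simpa using hx
  exact (key _ (continuous_hopfPhase₁ he₁ he₂)).and (key _ (continuous_hopfPhase₂ he₁ he₂))

end TwoShock

/-! ### The two-shock function as the unique stable integral solution. -/

/-- A Lipschitz potential yields a weakly divergence-free field. -/
theorem integral_lineDeriv_potential_eq_zero {U : ℝ × ℝ → ℝ} {C : NNReal} (hU : LipschitzWith C U)
    {ψ : ℝ × ℝ → ℝ} (hψ : IsTestFunction ψ) :
    ∫ p, (lineDeriv ℝ U p (1, 0) * fderiv ℝ ψ p (0, 1)
      - lineDeriv ℝ U p (0, 1) * fderiv ℝ ψ p (1, 0)) = 0 := by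
  have hd : ContDiff ℝ 2 ψ := contDiff_infty.1 hψ.1 2
  have hd1 : ∀ w : ℝ × ℝ, ContDiff ℝ 1 fun p => fderiv ℝ ψ p w := fun w =>
    (hd.fderiv_right (m := 1) (by norm_num)).clm_apply contDiff_const
  have hcs : ∀ w : ℝ × ℝ, HasCompactSupport fun p => fderiv ℝ ψ p w := fun w =>
    hψ.2.fderiv_apply (𝕜 := ℝ) w
  have hint : ∀ w z : ℝ × ℝ, Integrable fun p => lineDeriv ℝ U p w * fderiv ℝ ψ p z := by
    intro w z
    have := (hU.locallyIntegrable_lineDeriv (μ := volume) w).integrable_smul_left_of_hasCompactSupport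
      (hd1 z).continuous (hcs z)
    simpa [mul_comm] using this
  -- Integration by parts moves both derivatives onto `ψ`; the two terms then cancel by symmetry of
  -- the second derivative.
  have hibp : ∀ w z : ℝ × ℝ, ∫ p, lineDeriv ℝ U p w * fderiv ℝ ψ p z
      = ∫ p, (- fderiv ℝ (fderiv ℝ ψ) p w z) * U p := by
    intro w z
    obtain ⟨D, hD⟩ := (hd1 z).lipschitzWith_of_hasCompactSupport (hcs z) one_ne_zero
    rw [hU.integral_lineDeriv_mul_eq hD (hcs z)]
    congr 1; ext p
    congr 1
    have h1 : HasFDerivAt (fun p => fderiv ℝ ψ p z) ((fderiv ℝ (fderiv ℝ ψ) p).flip z) p := by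
      have h2 : HasFDerivAt (fderiv ℝ ψ) (fderiv ℝ (fderiv ℝ ψ) p) p :=
        ((hd.fderiv_right (m := 1) (by norm_num)).differentiable (by simp) p).hasFDerivAt
      have := h2.clm_apply (hasFDerivAt_const z p)
      simpa using this
    rw [(h1.hasLineDerivAt (-w)).lineDeriv]
    simp
  rw [integral_sub (hint _ _) (hint _ _), hibp, hibp, sub_eq_zero]
  congr 1; ext p
  have hs : IsSymmSndFDerivAt ℝ ψ p := hd.contDiffAt.isSymmSndFDerivAt (by simp)
  rw [hs.eq]

theorem isStableLinePoint_of_affine {v : ℝ → ℝ → ℝ} {p : ℝ × ℝ} {U : Set (ℝ × ℝ)} (hU : IsOpen U)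
    (hpU : p ∈ U) {α β a b : ℝ} (hp : p.1 = α + β * p.2) (hba : b < a)
    (hl : ∀ q ∈ U, q.1 < α + β * q.2 → v q.1 q.2 = a)
    (hr : ∀ q ∈ U, α + β * q.2 < q.1 → v q.1 q.2 = b) : IsStableLinePoint v p :=
  ⟨fun t => α + β * t, fun _ => a, fun _ => b, U, hp.symm, by fun_prop, hU, hpU,
    continuousOn_const, contDiffOn_const, continuousOn_const, contDiffOn_const, hl, hr,
    fun _ _ _ _ => hba⟩

section TwoShock

variable {u₀ e₁ e₂ x₁ x₂ : ℝ}

theorem measurable_hopfTwoShock (he₁ : 0 < e₁) (he₂ : 0 < e₂) :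
    Measurable fun p : ℝ × ℝ => hopfTwoShock u₀ e₁ e₂ x₁ x₂ p.1 p.2 := by
  have c1 : Measurable fun q : ℝ × ℝ => - q.1 + hopfPhase₁ u₀ e₁ e₂ x₁ x₂ q.2 :=
    measurable_fst.neg.add ((continuous_hopfPhase₁ he₁ he₂).measurable.comp measurable_snd)
  have c2 : Measurable fun q : ℝ × ℝ => - q.1 + hopfPhase₂ u₀ e₁ e₂ x₁ x₂ q.2 :=
    measurable_fst.neg.add ((continuous_hopfPhase₂ he₁ he₂).measurable.comp measurable_snd)
  exact (measurable_const.add ((measurable_heavisideFn.comp c1).const_mul _)).add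
    ((measurable_heavisideFn.comp c2).const_mul _)

theorem abs_hopfTwoShock_le (he₁ : 0 < e₁) (he₂ : 0 < e₂) (x t : ℝ) :
    |hopfTwoShock u₀ e₁ e₂ x₁ x₂ x t| ≤ |u₀| + e₁ + e₂ :=
  abs_twoStep_le u₀ he₁ he₂ _ _

theorem isIntegralSolution_hopfTwoShock (he₁ : 0 < e₁) (he₂ : 0 < e₂) (Ω : Set (ℝ × ℝ)) :
    IsIntegralSolution hopfFlux Ω (hopfTwoShock u₀ e₁ e₂ x₁ x₂) := by
  have hm := measurable_hopfTwoShock (u₀ := u₀) (x₁ := x₁) (x₂ := x₂) he₁ he₂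
  have hbd : ∀ p : ℝ × ℝ, |hopfTwoShock u₀ e₁ e₂ x₁ x₂ p.1 p.2| ≤ |u₀| + e₁ + e₂ := fun p =>
    abs_hopfTwoShock_le he₁ he₂ _ _
  refine ⟨?_, ?_, ?_⟩
  · refine LocallyIntegrable.locallyIntegrableOn ?_ Ω
    refine (locallyIntegrable_const (|u₀| + e₁ + e₂)).mono hm.aestronglyMeasurable ?_
    filter_upwards with p
    exact (hbd p).trans (le_abs_self _)
  · refine LocallyIntegrable.locallyIntegrableOn ?_ Ω
    refine (locallyIntegrable_const ((|u₀| + e₁ + e₂) ^ 2)).mono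
      (hm.pow_const 2).aestronglyMeasurable ?_
    filter_upwards with p
    rw [Real.norm_eq_abs, Real.norm_eq_abs, abs_pow, hopfFlux, abs_pow]
    exact pow_le_pow_left₀ (abs_nonneg _) ((hbd p).trans (le_abs_self _)) 2
  · intro ψ hψ hs
    obtain ⟨C, hC⟩ := exists_lipschitzWith_hopfPotential (u₀ := u₀) (e₁ := e₁) (e₂ := e₂)
      (x₁ := x₁) (x₂ := x₂)
    rw [setIntegral_eq_integral_of_forall_compl_eq_zero]
    · refine Eq.trans (integral_congr_ae ?_) (integral_lineDeriv_potential_eq_zero hC hψ)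
      filter_upwards [ae_ne_hopfPhase (u₀ := u₀) (x₁ := x₁) (x₂ := x₂) he₁ he₂] with p hp
      have h := (hopfTwoShock_eventually he₁ he₂ hp.1 hp.2).2
      rw [(h.hasLineDerivAt _).lineDeriv, (h.hasLineDerivAt _).lineDeriv]
      simp [hopfFlux]
    · intro p hp
      have h0 : fderiv ℝ ψ p = 0 := by
        by_contra hne
        exact hp (hs (support_fderiv_subset ℝ hne))
      simp [h0]

theorem isStablePiecewiseSmooth_hopfTwoShock (he₁ : 0 < e₁) (he₂ : 0 < e₂) (Ω : Set (ℝ × ℝ)) :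
    IsStablePiecewiseSmooth Ω (hopfTwoShock u₀ e₁ e₂ x₁ x₂) := by
  set s := mergeTime e₁ e₂ x₁ x₂ with hs
  have c1 : Continuous fun q : ℝ × ℝ => hopfPhase₁ u₀ e₁ e₂ x₁ x₂ q.2 :=
    (continuous_hopfPhase₁ he₁ he₂).comp continuous_snd
  have c2 : Continuous fun q : ℝ × ℝ => hopfPhase₂ u₀ e₁ e₂ x₁ x₂ q.2 :=
    (continuous_hopfPhase₂ he₁ he₂).comp continuous_snd
  -- The only exceptional point is the one where the shocks merge. Afterwards the two phases
  -- coincide, and the single shock is treated as a case of the first phase.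
  refine ⟨{(hopfCenter u₀ e₁ e₂ x₁ x₂ s, s)},
    fun K _ _ => (finite_singleton _).subset inter_subset_right, fun p hp => ?_⟩
  have oB : IsOpen {q : ℝ × ℝ | q.2 < s} := isOpen_lt continuous_snd continuous_const
  have oA : IsOpen {q : ℝ × ℝ | s < q.2} := isOpen_lt continuous_const continuous_snd
  by_cases h₁ : p.1 = hopfPhase₁ u₀ e₁ e₂ x₁ x₂ p.2
  · right
    rcases lt_trichotomy p.2 s with ht | ht | ht
    · have h12 : p.1 < hopfPhase₂ u₀ e₁ e₂ x₁ x₂ p.2 := by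
        rw [h₁, hopfPhase₁_of_le ht.le, hopfPhase₂_of_le ht.le]
        have := mergeTime_mul (x₁ := x₁) (x₂ := x₂) he₁ he₂
        nlinarith
      refine isStableLinePoint_of_affine (oB.inter (isOpen_lt continuous_fst c2)) ⟨ht, h12⟩
        (h₁.trans (hopfPhase₁_of_le ht.le)) (a := u₀ + e₁ + e₂) (b := u₀ + e₂) (by linarith) ?_ ?_
      · rintro q ⟨hq, -⟩ hlt
        rw [← hopfPhase₁_of_le (le_of_lt hq)] at hlt
        exact hopfTwoShock_left he₁ he₂ hlt
      · rintro q ⟨hq, hq2⟩ hlt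
        rw [← hopfPhase₁_of_le (le_of_lt hq)] at hlt
        exact hopfTwoShock_mid hlt.le hq2
    · refine absurd ?_ hp.2
      rw [mem_singleton_iff]
      refine Prod.ext ?_ ht
      rw [h₁, ht, hopfPhase₁_of_ge he₁ he₂ hs.ge]
    · refine isStableLinePoint_of_affine oA ht
        (h₁.trans (hopfPhase₁_of_ge he₁ he₂ (le_of_lt ht)))
        (a := u₀ + e₁ + e₂) (b := u₀) (by linarith) ?_ ?_
      · intro q hq hlt
        have h := hopfPhase₁_of_ge (u₀ := u₀) he₁ he₂ (le_of_lt hq)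
        exact hopfTwoShock_left he₁ he₂ (hlt.trans_eq h.symm)
      · intro q hq hlt
        have h := hopfPhase₂_of_ge (u₀ := u₀) he₁ he₂ (le_of_lt hq)
        exact hopfTwoShock_right he₁ he₂ (h.trans_le hlt.le)
  by_cases h₂ : p.1 = hopfPhase₂ u₀ e₁ e₂ x₁ x₂ p.2
  · right
    have ht : p.2 < s := by
      by_contra! h
      exact h₁ (by rw [h₂, hopfPhase₁_of_ge he₁ he₂ h, hopfPhase₂_of_ge he₁ he₂ h])
    have h12 : hopfPhase₁ u₀ e₁ e₂ x₁ x₂ p.2 < p.1 := by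
      rw [h₂, hopfPhase₁_of_le ht.le, hopfPhase₂_of_le ht.le]
      have := mergeTime_mul (x₁ := x₁) (x₂ := x₂) he₁ he₂
      nlinarith
    refine isStableLinePoint_of_affine (oB.inter (isOpen_lt c1 continuous_fst)) ⟨ht, h12⟩
      (h₂.trans (hopfPhase₂_of_le ht.le)) (a := u₀ + e₂) (b := u₀) (by linarith) ?_ ?_
    · rintro q ⟨hq, hq1⟩ hlt
      rw [← hopfPhase₂_of_le (le_of_lt hq)] at hlt
      exact hopfTwoShock_mid (le_of_lt hq1) hlt
    · rintro q ⟨hq, -⟩ hlt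
      rw [← hopfPhase₂_of_le (le_of_lt hq)] at hlt
      exact hopfTwoShock_right he₁ he₂ hlt.le
  · left
    exact contDiffAt_const.congr_of_eventuallyEq (hopfTwoShock_eventually he₁ he₂ h₁ h₂).1

theorem hopfPhase₁_zero (he₁ : 0 < e₁) (he₂ : 0 < e₂) (hx : x₁ < x₂) :
    hopfPhase₁ u₀ e₁ e₂ x₁ x₂ 0 = x₁ := by
  rw [hopfPhase₁_of_le (mergeTime_pos he₁ he₂ hx).le]; ring

theorem hopfPhase₂_zero (he₁ : 0 < e₁) (he₂ : 0 < e₂) (hx : x₁ < x₂) :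
    hopfPhase₂ u₀ e₁ e₂ x₁ x₂ 0 = x₂ := by
  rw [hopfPhase₂_of_le (mergeTime_pos he₁ he₂ hx).le]; ring

theorem hopfTwoShock_zero (he₁ : 0 < e₁) (he₂ : 0 < e₂) (hx : x₁ < x₂) (x : ℝ) :
    hopfTwoShock u₀ e₁ e₂ x₁ x₂ x 0 = twoJumpData u₀ e₁ e₂ x₁ x₂ x := by
  rw [twoJumpData_eq u₀ e₁ e₂ hx, hopfTwoShock, hopfPhase₁_zero he₁ he₂ hx,
    hopfPhase₂_zero he₁ he₂ hx]

theorem isGeneralizedCauchySolution_hopfTwoShock (he₁ : 0 < e₁) (he₂ : 0 < e₂) (hx : x₁ < x₂)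
    (T : EReal) : IsGeneralizedCauchySolution hopfFlux T (twoJumpData u₀ e₁ e₂ x₁ x₂)
      (hopfTwoShock u₀ e₁ e₂ x₁ x₂) where
  integral := isIntegralSolution_hopfTwoShock he₁ he₂ _
  initial ψ hψ := by
    have h := tendsto_integral_twoStep u₀ he₁ he₂
      (((continuous_hopfPhase₁ (u₀ := u₀) (x₁ := x₁) (x₂ := x₂) he₁ he₂).tendsto 0).mono_left
        (nhdsWithin_le_nhds (s := Ioi 0)))
      (((continuous_hopfPhase₂ (u₀ := u₀) (x₁ := x₁) (x₂ := x₂) he₁ he₂).tendsto 0).mono_left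
        (nhdsWithin_le_nhds (s := Ioi 0))) hψ
    rw [hopfPhase₁_zero he₁ he₂ hx, hopfPhase₂_zero he₁ he₂ hx] at h
    simp only [twoJumpData_eq u₀ e₁ e₂ hx]
    exact h
  bounded := ⟨_, Eventually.of_forall fun p => abs_hopfTwoShock_le he₁ he₂ p.1 p.2⟩
  stable := isStablePiecewiseSmooth_hopfTwoShock he₁ he₂ _

theorem hasDerivAt_hopfPotential_fst (he₁ : 0 < e₁) (he₂ : 0 < e₂) {p : ℝ × ℝ}
    (h₁ : p.1 ≠ hopfPhase₁ u₀ e₁ e₂ x₁ x₂ p.2) (h₂ : p.1 ≠ hopfPhase₂ u₀ e₁ e₂ x₁ x₂ p.2) :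
    HasDerivAt (fun x => hopfPotential u₀ e₁ e₂ x₁ x₂ (x, p.2))
      (hopfTwoShock u₀ e₁ e₂ x₁ x₂ p.1 p.2) p.1 := by
  have h := (hopfTwoShock_eventually he₁ he₂ h₁ h₂).2
  have hl : HasDerivAt (fun x : ℝ => (x, p.2)) ((1 : ℝ), (0 : ℝ)) p.1 :=
    (hasDerivAt_id p.1).prodMk (hasDerivAt_const p.1 p.2)
  have := h.comp_hasDerivAt p.1 hl
  simp only [sub_apply, smul_apply, ContinuousLinearMap.coe_fst', ContinuousLinearMap.coe_snd',
    smul_eq_mul, mul_one, mul_zero, sub_zero] at this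
  exact this

theorem integral_twoJumpData (he₁ : 0 < e₁) (he₂ : 0 < e₂) (hx : x₁ < x₂) {a b : ℝ} (hab : a < b) :
    ∫ x in Icc a b, twoJumpData u₀ e₁ e₂ x₁ x₂ x
      = hopfPotential u₀ e₁ e₂ x₁ x₂ (b, 0) - hopfPotential u₀ e₁ e₂ x₁ x₂ (a, 0) := by
  have hc : Continuous fun x : ℝ => hopfPotential u₀ e₁ e₂ x₁ x₂ (x, 0) :=
    continuous_hopfPotential.comp (by fun_prop)
  have hm : Measurable fun x => twoJumpData u₀ e₁ e₂ x₁ x₂ x := by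
    simp only [← hopfTwoShock_zero (u₀ := u₀) he₁ he₂ hx]
    exact (measurable_hopfTwoShock he₁ he₂).comp (by fun_prop : Measurable fun x : ℝ => (x, (0 : ℝ)))
  have := integral_eq_of_hasDerivAt_off_countable_of_le
    (fun x => hopfPotential u₀ e₁ e₂ x₁ x₂ (x, 0)) (twoJumpData u₀ e₁ e₂ x₁ x₂) hab.le
    (s := {x₁, x₂}) (by simp) hc.continuousOn (fun x hxx => by
      have hne := hxx.2
      simp only [mem_insert_iff, mem_singleton_iff, not_or] at hne
      rw [← hopfTwoShock_zero (u₀ := u₀) he₁ he₂ hx]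
      exact hasDerivAt_hopfPotential_fst (p := (x, 0)) he₁ he₂
        (by simpa [hopfPhase₁_zero he₁ he₂ hx] using hne.1)
        (by simpa [hopfPhase₂_zero he₁ he₂ hx] using hne.2)) (by
      rw [intervalIntegrable_iff_integrableOn_Icc_of_le hab.le]
      refine Measure.integrableOn_of_bounded (by simp) hm.aestronglyMeasurable
        (M := |u₀| + e₁ + e₂) (Eventually.of_forall fun x => ?_)
      rw [← hopfTwoShock_zero (u₀ := u₀) he₁ he₂ hx]
      exact abs_hopfTwoShock_le he₁ he₂ x 0)
  rw [← this, intervalIntegral.integral_of_le hab.le, integral_Icc_eq_integral_Ioc]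

/-- Uniqueness of the stable piecewise smooth solution. -/
theorem IsGeneralizedCauchySolution.ae_eq_hopfTwoShock (he₁ : 0 < e₁) (he₂ : 0 < e₂) (hx : x₁ < x₂)
    {T : EReal} (hT : 0 < T) {v : ℝ → ℝ → ℝ}
    (hv : IsGeneralizedCauchySolution hopfFlux T (twoJumpData u₀ e₁ e₂ x₁ x₂) v) :
    ∀ᵐ p ∂(volume.restrict (timeStrip T)), v p.1 p.2 = hopfTwoShock u₀ e₁ e₂ x₁ x₂ p.1 p.2 := by
  have hΩ := convex_timeStrip T
  have hΩo := isOpen_timeStrip T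
  obtain ⟨M, hM⟩ := hv.bounded
  have hM' : ∀ᵐ z : ℝ × ℝ, z ∈ timeStrip T → |v z.1 z.2| ≤ |M| := by
    filter_upwards [(ae_restrict_iff' hΩo.measurableSet).1 hM] with z hz hzΩ
    exact (hz hzΩ).trans (le_abs_self M)
  obtain ⟨V, hV⟩ := hv.integral.exists_hopfPotential hΩ hΩo hM
  have ht : ∀ᶠ t in 𝓝[>] (0 : ℝ), ∀ x, (x, t) ∈ timeStrip T := by
    obtain ⟨r, hr0, hrT⟩ := EReal.lt_iff_exists_real_btwn.1 hT
    have hr0' : (0 : ℝ) < r := by exact_mod_cast hr0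
    filter_upwards [Ioo_mem_nhdsGT hr0'] with t htt x
    exact ⟨htt.1, lt_trans (by exact_mod_cast htt.2) hrT⟩
  have hwm : AEStronglyMeasurable (twoJumpData u₀ e₁ e₂ x₁ x₂) := by
    rw [← funext (hopfTwoShock_zero (u₀ := u₀) he₁ he₂ hx)]
    exact ((measurable_hopfTwoShock he₁ he₂).comp
      (by fun_prop : Measurable fun x : ℝ => (x, (0 : ℝ)))).aestronglyMeasurable
  obtain ⟨c, hc⟩ := hV.exists_const hΩ hΩo hM' hv.stable ht hwm (N := |u₀| + e₁ + e₂)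
    (Eventually.of_forall fun x => by
      rw [← hopfTwoShock_zero (u₀ := u₀) he₁ he₂ hx]
      exact abs_hopfTwoShock_le he₁ he₂ x 0) hv.initial
    (W := fun x => hopfPotential u₀ e₁ e₂ x₁ x₂ (x, 0))
    (fun a b hab => integral_twoJumpData he₁ he₂ hx hab)
  -- Equality of the potentials up to a constant identifies their `x`-derivatives, which are `v` and
  -- `u*` at almost every point.
  have heq : ∀ p ∈ timeStrip T, V p = hopfPotential u₀ e₁ e₂ x₁ x₂ p + c := fun p hp =>
    hV.eq_of_hopfLax (abs_nonneg M) hM' hv.stable continuous_hopfPotential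
      hopfPotential_sub_le (fun x t _ => exists_hopfPotential_le x t) hc hp
  rw [ae_restrict_iff' hΩo.measurableSet]
  filter_upwards [ae_mem_regularPoints hΩo hv.stable,
    ae_ne_hopfPhase (u₀ := u₀) (x₁ := x₁) (x₂ := x₂) he₁ he₂] with p hp hne hpΩ
  have h1 := hV.hasDerivAt_fst hΩo hpΩ (continuousAt_of_mem_regularPoints (hp hpΩ))
  have h2 := (hasDerivAt_hopfPotential_fst he₁ he₂ hne.1 hne.2).add_const c
  refine h1.unique (h2.congr_of_eventuallyEq (Eventually.of_forall fun x => ?_))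
  exact heq (x, p.2) ⟨hpΩ.1, hpΩ.2⟩

end TwoShock

/-! ### Regularizing kernels -/

/-- The distribution function of a kernel. -/
noncomputable def kernelCdf (ω : ℝ → ℝ) (z : ℝ) : ℝ := ∫ η in Iic z, ω η

/-- The weight which the product of two regularized Heaviside functions puts on the first jump. -/
noncomputable def kernelWeight (ω₁ ω₂ : ℝ → ℝ) (ρ : ℝ) : ℝ := ∫ z, ω₁ z * kernelCdf ω₂ (z + ρ)

/-- The first absolute moment of a kernel. -/
noncomputable def kernelMoment (ω : ℝ → ℝ) : ℝ := ∫ z, |z| * ω z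

namespace IsRegKernel

variable {ω ω₁ ω₂ : ℝ → ℝ}

/-- A non-integrable function has integral `0` by convention, so the normalization to one forces
integrability. -/
theorem integrable (h : IsRegKernel ω) : Integrable ω := by
  by_contra hn
  have := h.integral_eq_one
  rw [integral_undef hn] at this
  exact zero_ne_one this

theorem integrable_abs_mul (h : IsRegKernel ω) : Integrable fun z => |z| * ω z := by
  -- The power three suffices: `|z| (1 + z²) ≤ (1 + |z|)³`, which leaves the integrable majorant `C
  -- / (1 + z²)`.
  obtain ⟨C, hC⟩ := h.decay 3
  refine (integrable_inv_one_add_sq.const_mul C).mono'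
    (by have := h.smooth.continuous; fun_prop) (Eventually.of_forall fun z => ?_)
  have h1 := hC z
  have h0 := h.nonneg z
  rw [abs_of_nonneg h0] at h1
  rw [Real.norm_eq_abs, abs_mul, abs_abs, abs_of_nonneg h0, ← div_eq_mul_inv,
    le_div_iff₀ (by positivity)]
  refine le_trans ?_ h1
  have e : z ^ 2 = |z| ^ 2 := (sq_abs z).symm
  rw [e]
  have : |z| * (1 + |z| ^ 2) ≤ (1 + |z|) ^ 3 := by nlinarith [abs_nonneg z, sq_nonneg |z|]
  nlinarith

theorem hasDerivAt_cdf (h : IsRegKernel ω) (z : ℝ) : HasDerivAt (kernelCdf ω) (ω z) z := by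
  have h1 : kernelCdf ω = fun z => kernelCdf ω 0 + ∫ x in (0 : ℝ)..z, ω x := by
    ext y
    rw [kernelCdf, kernelCdf, ← intervalIntegral.integral_Iic_sub_Iic h.integrable.integrableOn
      h.integrable.integrableOn]
    ring
  rw [h1]
  refine HasDerivAt.const_add _ ?_
  exact intervalIntegral.integral_hasDerivAt_right h.integrable.intervalIntegrable
    (h.smooth.continuous.stronglyMeasurableAtFilter _ _) h.smooth.continuous.continuousAt

theorem continuous_cdf (h : IsRegKernel ω) : Continuous (kernelCdf ω) :=
  continuous_iff_continuousAt.2 fun z => (h.hasDerivAt_cdf z).continuousAt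

theorem cdf_nonneg (h : IsRegKernel ω) (z : ℝ) : 0 ≤ kernelCdf ω z :=
  integral_nonneg fun y => h.nonneg y

theorem cdf_le_one (h : IsRegKernel ω) (z : ℝ) : kernelCdf ω z ≤ 1 := by
  rw [← h.integral_eq_one]
  exact setIntegral_le_integral h.integrable (Eventually.of_forall h.nonneg)

theorem moment_nonneg (h : IsRegKernel ω) : 0 ≤ kernelMoment ω :=
  integral_nonneg fun z => mul_nonneg (abs_nonneg z) (h.nonneg z)

/-- Markov's inequality for the left tail: on `η ≤ -y` one has `y ≤ |η|`. -/
theorem mul_cdf_le_moment (h : IsRegKernel ω) (y : ℝ) : y * kernelCdf ω (-y) ≤ kernelMoment ω := by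
  rcases le_or_gt y 0 with hy | hy
  · exact (mul_nonpos_of_nonpos_of_nonneg hy (h.cdf_nonneg _)).trans h.moment_nonneg
  · rw [kernelCdf, ← integral_const_mul]
    calc ∫ η in Iic (-y), y * ω η ≤ ∫ η in Iic (-y), |η| * ω η := by
          refine setIntegral_mono_on (h.integrable.const_mul y).integrableOn
            h.integrable_abs_mul.integrableOn measurableSet_Iic fun η hη => ?_
          have : y ≤ |η| := by
            rw [le_abs]; right; have : η ≤ -y := hη; linarith
          exact mul_le_mul_of_nonneg_right this (h.nonneg η)
      _ ≤ kernelMoment ω := setIntegral_le_integral h.integrable_abs_mul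
          (Eventually.of_forall fun z => mul_nonneg (abs_nonneg z) (h.nonneg z))

theorem tendsto_cdf_atBot (h : IsRegKernel ω) : Tendsto (kernelCdf ω) atBot (𝓝 0) := by
  have h1 : Tendsto (fun z : ℝ => kernelMoment ω * (-z)⁻¹) atBot (𝓝 (kernelMoment ω * 0)) :=
    (tendsto_inv_atTop_zero.comp tendsto_neg_atBot_atTop).const_mul _
  rw [mul_zero] at h1
  refine squeeze_zero' (Eventually.of_forall h.cdf_nonneg) ?_ h1
  filter_upwards [eventually_lt_atBot (0 : ℝ)] with z hz
  have := h.mul_cdf_le_moment (-z)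
  rw [neg_neg] at this
  rw [← div_eq_mul_inv, le_div_iff₀ (by linarith)]
  linarith

theorem tendsto_cdf_atTop (h : IsRegKernel ω) : Tendsto (kernelCdf ω) atTop (𝓝 1) := by
  rw [← h.integral_eq_one]
  exact (aecover_Iic tendsto_id).integral_tendsto_of_countably_generated h.integrable

theorem integrable_mul_of_bounded (h : IsRegKernel ω) {Q : ℝ → ℝ} (hQ : Continuous Q) {B : ℝ}
    (hB : ∀ z, |Q z| ≤ B) : Integrable fun z => ω z * Q z := by
  refine (h.integrable.const_mul B).mono'
    (h.smooth.continuous.mul hQ).aestronglyMeasurable (Eventually.of_forall fun z => ?_)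
  rw [norm_mul, Real.norm_eq_abs, Real.norm_eq_abs, abs_of_nonneg (h.nonneg z), mul_comm]
  exact mul_le_mul_of_nonneg_right (hB z) (h.nonneg z)

theorem abs_cdf_le_one (h : IsRegKernel ω) (z : ℝ) : |kernelCdf ω z| ≤ 1 := by
  rw [abs_of_nonneg (h.cdf_nonneg z)]; exact h.cdf_le_one z

theorem integrable_mul_cdf (h₁ : IsRegKernel ω₁) (h₂ : IsRegKernel ω₂) (ρ : ℝ) :
    Integrable fun z => ω₁ z * kernelCdf ω₂ (z + ρ) :=
  h₁.integrable_mul_of_bounded (h₂.continuous_cdf.comp (by fun_prop)) fun _ => h₂.abs_cdf_le_one _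

/-- After a translation in the second weight, the integrands add up to the derivative of a product
of two distribution functions, which rises from `0` to `1`. -/
theorem weight_add (h₁ : IsRegKernel ω₁) (h₂ : IsRegKernel ω₂) (ρ : ℝ) :
    kernelWeight ω₁ ω₂ ρ + kernelWeight ω₂ ω₁ (-ρ) = 1 := by
  have hshift : ∀ z, HasDerivAt (fun z : ℝ => z + ρ) 1 z := fun z => (hasDerivAt_id z).add_const ρ
  have hd : ∀ z, HasDerivAt (fun z => kernelCdf ω₁ z * kernelCdf ω₂ (z + ρ))
      (ω₁ z * kernelCdf ω₂ (z + ρ) + ω₂ (z + ρ) * kernelCdf ω₁ z) z := by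
    intro z
    have := (h₁.hasDerivAt_cdf z).mul ((h₂.hasDerivAt_cdf (z + ρ)).comp z (hshift z))
    convert! this using 1
    simp only [Function.comp_def]
    ring
  have i2 : Integrable fun z => ω₂ (z + ρ) * kernelCdf ω₁ z := by
    have := (h₂.integrable_mul_cdf h₁ (-ρ)).comp_add_right ρ
    simpa using this
  have e2 : ∫ z, ω₂ (z + ρ) * kernelCdf ω₁ z = kernelWeight ω₂ ω₁ (-ρ) := by
    have := integral_add_right_eq_self (μ := volume) (fun z => ω₂ z * kernelCdf ω₁ (z + -ρ)) ρ
    simpa [kernelWeight] using this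
  have t1 : Tendsto (fun z => kernelCdf ω₁ z * kernelCdf ω₂ (z + ρ)) atBot (𝓝 (0 * 0)) :=
    h₁.tendsto_cdf_atBot.mul (h₂.tendsto_cdf_atBot.comp (tendsto_atBot_add_const_right _ ρ tendsto_id))
  have t2 : Tendsto (fun z => kernelCdf ω₁ z * kernelCdf ω₂ (z + ρ)) atTop (𝓝 (1 * 1)) :=
    h₁.tendsto_cdf_atTop.mul (h₂.tendsto_cdf_atTop.comp (tendsto_atTop_add_const_right _ ρ tendsto_id))
  have := integral_of_hasDerivAt_of_tendsto hd ((h₁.integrable_mul_cdf h₂ ρ).add i2) t1 t2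
  rw [integral_add (h₁.integrable_mul_cdf h₂ ρ) i2, e2] at this
  rw [kernelWeight, this]; ring

theorem weight_self (h : IsRegKernel ω) : kernelWeight ω ω 0 = 1 / 2 := by
  have := h.weight_add h 0
  rw [neg_zero] at this
  linarith

theorem weight_nonneg (h₁ : IsRegKernel ω₁) (h₂ : IsRegKernel ω₂) (ρ : ℝ) :
    0 ≤ kernelWeight ω₁ ω₂ ρ :=
  integral_nonneg fun z => mul_nonneg (h₁.nonneg z) (h₂.cdf_nonneg _)

/-- Well separated jumps interact only through kernel tails: writing `ρ = (ρ - z) + z`, the first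
part is bounded by the tail estimate for `ω₁`, the second by the moment of `ω₂`. This decay controls
the residual away from the merger. -/
theorem mul_weight_neg_le (h₁ : IsRegKernel ω₁) (h₂ : IsRegKernel ω₂) {ρ : ℝ} :
    ρ * kernelWeight ω₂ ω₁ (-ρ) ≤ kernelMoment ω₁ + kernelMoment ω₂ := by
  have e : kernelMoment ω₁ + kernelMoment ω₂ = ∫ z, (kernelMoment ω₁ * ω₂ z + |z| * ω₂ z) := by
    rw [integral_add (h₂.integrable.const_mul _) h₂.integrable_abs_mul, integral_const_mul,
      h₂.integral_eq_one, mul_one, kernelMoment, kernelMoment]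
  rw [e, kernelWeight, ← integral_const_mul]
  refine integral_mono ((h₂.integrable_mul_cdf h₁ (-ρ)).const_mul ρ)
    ((h₂.integrable.const_mul _).add h₂.integrable_abs_mul) fun z => ?_
  have a1 := h₁.mul_cdf_le_moment (ρ - z)
  have a2 : z * kernelCdf ω₁ (z + -ρ) ≤ |z| := by
    have b1 := h₁.cdf_nonneg (z + -ρ)
    have b2 := h₁.cdf_le_one (z + -ρ)
    nlinarith [le_abs_self z, abs_nonneg z]
  have e2 : -(ρ - z) = z + -ρ := by ring
  rw [e2] at a1
  have := mul_le_mul_of_nonneg_left (add_le_add a1 a2) (h₂.nonneg z)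
  simp only
  nlinarith

/-- Pairing a concentrated kernel with a Lipschitz function. -/
theorem abs_integral_sub_le (h : IsRegKernel ω) {Q ψ : ℝ → ℝ} (hQ : Continuous Q) {B : ℝ}
    (hB : ∀ z, |Q z| ≤ B) {L : NNReal} (hψ : LipschitzWith L ψ) {S : ℝ} (hS : ∀ x, |ψ x| ≤ S)
    (φ : ℝ) {ε : ℝ} (hε : 0 < ε) :
    |(∫ z, ω z * Q z * ψ (φ - ε * z)) - ψ φ * ∫ z, ω z * Q z|
      ≤ B * L * kernelMoment ω * ε := by
  have hB0 : 0 ≤ B := (abs_nonneg _).trans (hB 0)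
  have i1 : Integrable fun z => ω z * Q z * ψ (φ - ε * z) := by
    have := h.integrable_mul_of_bounded (Q := fun z => Q z * ψ (φ - ε * z))
      (hQ.mul (hψ.continuous.comp (by fun_prop))) (B := B * S) fun z => by
        rw [abs_mul]; exact mul_le_mul (hB z) (hS _) (abs_nonneg _) hB0
    simpa only [mul_assoc] using this
  have i2 := (h.integrable_mul_of_bounded hQ hB).const_mul (ψ φ)
  rw [← integral_const_mul, ← integral_sub i1 i2]
  have i3 := h.integrable_abs_mul.const_mul (B * L * ε)
  have e : B * L * kernelMoment ω * ε = ∫ z, B * L * ε * (|z| * ω z) := by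
    rw [integral_const_mul, kernelMoment]; ring
  rw [e]
  refine (Real.norm_eq_abs _).symm.le.trans (norm_integral_le_of_norm_le i3 (Eventually.of_forall fun z => ?_))
  have e2 : ω z * Q z * ψ (φ - ε * z) - ψ φ * (ω z * Q z)
      = ω z * (Q z * (ψ (φ - ε * z) - ψ φ)) := by ring
  have h1 : |ψ (φ - ε * z) - ψ φ| ≤ L * (ε * |z|) := by
    have := hψ.dist_le_mul (φ - ε * z) φ
    rw [Real.dist_eq, Real.dist_eq] at this
    have e3 : |φ - ε * z - φ| = ε * |z| := by
      rw [sub_sub_cancel_left, abs_neg, abs_mul, abs_of_pos hε]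
    rwa [e3] at this
  rw [e2, Real.norm_eq_abs, abs_mul, abs_mul, abs_of_nonneg (h.nonneg z)]
  calc ω z * (|Q z| * |ψ (φ - ε * z) - ψ φ|) ≤ ω z * (B * (L * (ε * |z|))) := by
        refine mul_le_mul_of_nonneg_left ?_ (h.nonneg z)
        exact mul_le_mul (hB z) h1 (abs_nonneg _) hB0
    _ = B * L * ε * (|z| * ω z) := by ring

end IsRegKernel

theorem integral_rescale (G : ℝ → ℝ) (φ : ℝ) {ε : ℝ} (hε : 0 < ε) :
    ∫ x, G ((-x + φ) / ε) / ε = ∫ z, G z := by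
  rw [integral_div]
  have h1 : ∫ x, G ((-x + φ) / ε) = ∫ x, G (x / ε) := by
    rw [← integral_sub_left_eq_self (fun x : ℝ => G (x / ε)) volume φ]
    congr 1; ext x; congr 2; ring
  rw [h1, Measure.integral_comp_div, abs_of_pos hε, smul_eq_mul]
  field_simp

/-! ### The phases -/

/-- A smooth approximation of the positive part. -/
noncomputable def smoothPosPart (s : ℝ) : ℝ := s * Real.smoothTransition s

theorem contDiff_smoothPosPart : ContDiff ℝ (⊤ : ℕ∞) smoothPosPart :=
  contDiff_id.mul Real.smoothTransition.contDiff

theorem smoothPosPart_of_nonpos {s : ℝ} (h : s ≤ 0) : smoothPosPart s = 0 := by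
  rw [smoothPosPart, Real.smoothTransition.zero_of_nonpos h, mul_zero]

theorem smoothPosPart_of_one_le {s : ℝ} (h : 1 ≤ s) : smoothPosPart s = s := by
  rw [smoothPosPart, Real.smoothTransition.one_of_one_le h, mul_one]

theorem smoothPosPart_nonneg (s : ℝ) : 0 ≤ smoothPosPart s := by
  rcases le_or_gt s 0 with h | h
  · rw [smoothPosPart_of_nonpos h]
  · exact mul_nonneg h.le (Real.smoothTransition.nonneg s)

theorem smoothPosPart_le_one {s : ℝ} (hs : s ≤ 1) : smoothPosPart s ≤ 1 := by
  rcases le_or_gt s 0 with h | h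
  · rw [smoothPosPart_of_nonpos h]; exact zero_le_one
  · exact mul_le_one₀ hs (Real.smoothTransition.nonneg s) (Real.smoothTransition.le_one s)

theorem abs_smoothPosPart_sub_le (s : ℝ) : |smoothPosPart s - max s 0| ≤ 1 := by
  rcases le_or_gt 1 s with h | h
  · rw [smoothPosPart_of_one_le h, max_eq_left (by linarith)]; simp
  · have h1 := smoothPosPart_nonneg s
    have h2 := smoothPosPart_le_one h.le
    have h3 : 0 ≤ max s 0 := le_max_right _ _
    have h4 : max s 0 ≤ 1 := max_le h.le zero_le_one
    rw [abs_le]; constructor <;> linarith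

theorem deriv_smoothPosPart_of_one_lt {s : ℝ} (h : 1 < s) : deriv smoothPosPart s = 1 := by
  have : smoothPosPart =ᶠ[𝓝 s] id := by
    filter_upwards [lt_mem_nhds h] with y hy using smoothPosPart_of_one_le (le_of_lt hy)
  rw [this.deriv_eq, deriv_id]

theorem exists_abs_deriv_smoothPosPart_le : ∃ G, ∀ s, |deriv smoothPosPart s| ≤ G := by
  have hc : Continuous (deriv smoothPosPart) := contDiff_smoothPosPart.continuous_deriv (by simp)
  obtain ⟨G, hG⟩ := isCompact_Icc.exists_bound_of_continuousOn (hc.continuousOn (s := Icc (0 : ℝ) 1))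
  refine ⟨max G 1, fun s => ?_⟩
  rcases lt_or_ge s 0 with h | h
  · have : smoothPosPart =ᶠ[𝓝 s] fun _ => 0 := by
      filter_upwards [gt_mem_nhds h] with y hy using smoothPosPart_of_nonpos (le_of_lt hy)
    rw [this.deriv_eq]; simp
  rcases le_or_gt s 1 with h1 | h1
  · exact (hG s ⟨h, h1⟩).trans (le_max_left _ _)
  · rw [deriv_smoothPosPart_of_one_lt h1]; simp

/-- The regularized distance of the shocks. -/
noncomputable def regGap (e₁ e₂ x₁ x₂ t ε : ℝ) : ℝ :=
  ε * smoothPosPart ((x₂ - x₁ - (e₁ + e₂) * t) / ε)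

theorem abs_regGap_sub_le (e₁ e₂ x₁ x₂ t : ℝ) {ε : ℝ} (hε : 0 < ε) :
    |regGap e₁ e₂ x₁ x₂ t ε - hopfGap e₁ e₂ x₁ x₂ t| ≤ ε := by
  have h := abs_smoothPosPart_sub_le ((x₂ - x₁ - (e₁ + e₂) * t) / ε)
  have e : hopfGap e₁ e₂ x₁ x₂ t = ε * max ((x₂ - x₁ - (e₁ + e₂) * t) / ε) 0 := by
    rw [hopfGap, mul_max_of_nonneg _ _ hε.le, mul_zero, mul_div_cancel₀ _ hε.ne']
  rw [e, regGap, ← mul_sub, abs_mul, abs_of_pos hε]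
  exact mul_le_of_le_one_right hε.le h

theorem tendsto_regGap (e₁ e₂ x₁ x₂ t : ℝ) :
    Tendsto (fun ε => regGap e₁ e₂ x₁ x₂ t ε) (𝓝[>] 0) (𝓝 (hopfGap e₁ e₂ x₁ x₂ t)) := by
  rw [tendsto_iff_dist_tendsto_zero]
  refine squeeze_zero' (Eventually.of_forall fun _ => dist_nonneg) ?_
    ((continuous_id.tendsto (0 : ℝ)).mono_left nhdsWithin_le_nhds)
  filter_upwards [self_mem_nhdsWithin] with ε hε
  exact abs_regGap_sub_le e₁ e₂ x₁ x₂ t hε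

theorem hasDerivAt_regGap (e₁ e₂ x₁ x₂ t : ℝ) {ε : ℝ} (hε : 0 < ε) :
    HasDerivAt (fun t => regGap e₁ e₂ x₁ x₂ t ε)
      (-(e₁ + e₂) * deriv smoothPosPart ((x₂ - x₁ - (e₁ + e₂) * t) / ε)) t := by
  have h1 : HasDerivAt (fun t => (x₂ - x₁ - (e₁ + e₂) * t) / ε) (-(e₁ + e₂) / ε) t := by
    have := (((hasDerivAt_id t).const_mul (e₁ + e₂)).const_sub (x₂ - x₁)).div_const ε
    simpa using this
  have h2 := (contDiff_smoothPosPart.differentiable (by simp)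
    ((x₂ - x₁ - (e₁ + e₂) * t) / ε)).hasDerivAt
  have h3 := (h2.comp t h1).const_mul ε
  convert! h3 using 1
  field_simp

theorem contDiff_regGap (e₁ e₂ x₁ x₂ ε : ℝ) :
    ContDiff ℝ (⊤ : ℕ∞) fun t => regGap e₁ e₂ x₁ x₂ t ε :=
  contDiff_const.mul (contDiff_smoothPosPart.comp (by fun_prop))

/-- The regularized phases `c - b D / (e₁ + e₂)`. -/
noncomputable def regPhase (u₀ e₁ e₂ x₁ x₂ b t ε : ℝ) : ℝ :=
  hopfCenter u₀ e₁ e₂ x₁ x₂ t - b / (e₁ + e₂) * regGap e₁ e₂ x₁ x₂ t ε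

theorem contDiff_regPhase (u₀ e₁ e₂ x₁ x₂ b ε : ℝ) :
    ContDiff ℝ (⊤ : ℕ∞) fun t => regPhase u₀ e₁ e₂ x₁ x₂ b t ε := by
  refine ContDiff.sub ?_ (contDiff_const.mul (contDiff_regGap e₁ e₂ x₁ x₂ ε))
  unfold hopfCenter; fun_prop

theorem hasDerivAt_regPhase (u₀ : ℝ) {e₁ e₂ : ℝ} (he₁ : 0 < e₁) (he₂ : 0 < e₂) (x₁ x₂ b t : ℝ)
    {ε : ℝ} (hε : 0 < ε) :
    HasDerivAt (fun t => regPhase u₀ e₁ e₂ x₁ x₂ b t ε)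
      (2 * u₀ + e₁ + e₂ + b * deriv smoothPosPart ((x₂ - x₁ - (e₁ + e₂) * t) / ε)) t := by
  have h1 : HasDerivAt (hopfCenter u₀ e₁ e₂ x₁ x₂) (2 * u₀ + e₁ + e₂) t := by
    have := ((hasDerivAt_id t).const_mul (2 * u₀ + e₁ + e₂)).const_add
      ((e₁ * x₁ + e₂ * x₂) / (e₁ + e₂))
    rw [mul_one] at this
    exact this
  have h2 := h1.sub ((hasDerivAt_regGap e₁ e₂ x₁ x₂ t hε).const_mul (b / (e₁ + e₂)))
  convert! h2 using 1
  have : e₁ + e₂ ≠ 0 := by linarith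
  field_simp
  ring

theorem tendsto_regPhase (u₀ e₁ e₂ x₁ x₂ b t : ℝ) :
    Tendsto (fun ε => regPhase u₀ e₁ e₂ x₁ x₂ b t ε) (𝓝[>] 0)
      (𝓝 (hopfCenter u₀ e₁ e₂ x₁ x₂ t - b / (e₁ + e₂) * hopfGap e₁ e₂ x₁ x₂ t)) :=
  tendsto_const_nhds.sub ((tendsto_regGap e₁ e₂ x₁ x₂ t).const_mul _)

/-! ### Residual of the two-shock ansatz. -/

/-- The substitution `z = (-x + p)/ε` concentrates the integral at `p`. A jump interacts with itself
with weight `1/2`, which turns `2e` into `e`, and with the other jump with the weight at rescaled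
distance `ρ`. -/
theorem IsRegKernel.abs_pairing_sub_le {ω ω' : ℝ → ℝ} (h : IsRegKernel ω) (h' : IsRegKernel ω')
    {u₀ e e' d p ρ ε B S : ℝ} (he : 0 < e) (he' : 0 < e') (hε : 0 < ε)
    (hB : |d| + 2 * (|u₀| + e + e') ≤ B) {ψ : ℝ → ℝ} {L : NNReal} (hψ : LipschitzWith L ψ)
    (hS : ∀ x, |ψ x| ≤ S) :
    |(∫ x, ω ((-x + p) / ε) / ε * (d - 2 * (u₀ + e * kernelCdf ω ((-x + p) / ε)
        + e' * kernelCdf ω' ((-x + p) / ε + ρ))) * ψ x)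
      - ψ p * (d - 2 * u₀ - e - 2 * e' * kernelWeight ω ω' ρ)|
      ≤ B * L * kernelMoment ω * ε := by
  set Q : ℝ → ℝ := fun z => d - 2 * (u₀ + e * kernelCdf ω z + e' * kernelCdf ω' (z + ρ)) with hQ
  have hc := h.continuous_cdf
  have hc' := h'.continuous_cdf
  have hQc : Continuous Q := by fun_prop
  have hQB : ∀ z, |Q z| ≤ B := by
    intro z
    have a1 := h.cdf_nonneg z
    have a2 := h.cdf_le_one z
    have a3 := h'.cdf_nonneg (z + ρ)
    have a4 := h'.cdf_le_one (z + ρ)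
    have b1 := neg_abs_le u₀
    have b2 := le_abs_self u₀
    have b3 := neg_abs_le d
    have b4 := le_abs_self d
    simp only [hQ]
    rw [abs_le]
    constructor <;> nlinarith
  have e1 : ∫ x, ω ((-x + p) / ε) / ε * (d - 2 * (u₀ + e * kernelCdf ω ((-x + p) / ε)
        + e' * kernelCdf ω' ((-x + p) / ε + ρ))) * ψ x = ∫ z, ω z * Q z * ψ (p - ε * z) := by
    rw [← integral_rescale (fun z => ω z * Q z * ψ (p - ε * z)) p hε]
    congr 1; ext x
    have : p - ε * ((-x + p) / ε) = x := by field_simp; ring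
    simp only [this, hQ]
    ring
  have i1 : Integrable fun z => ω z * kernelCdf ω z := by
    simpa using h.integrable_mul_cdf h 0
  have e2 : ∫ z, ω z * Q z = d - 2 * u₀ - e - 2 * e' * kernelWeight ω ω' ρ := by
    have : (fun z => ω z * Q z) = fun z => (d - 2 * u₀) * ω z - 2 * e * (ω z * kernelCdf ω z)
        - 2 * e' * (ω z * kernelCdf ω' (z + ρ)) := by
      ext z; simp only [hQ]; ring
    have i2 : Integrable fun z => (d - 2 * u₀) * ω z - 2 * e * (ω z * kernelCdf ω z) :=
      (h.integrable.const_mul _).sub (i1.const_mul _)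
    rw [this, integral_sub i2 ((h.integrable_mul_cdf h' ρ).const_mul _),
      integral_sub (h.integrable.const_mul _) (i1.const_mul _), integral_const_mul,
      integral_const_mul, integral_const_mul, h.integral_eq_one]
    have hw := h.weight_self
    simp only [kernelWeight, add_zero] at hw
    rw [hw, kernelWeight]
    ring
  rw [e1, ← e2]
  exact h.abs_integral_sub_le hQc hQB hψ hS p hε

theorem conservationOp_hopf_smooth {ω₁ ω₂ : ℝ → ℝ} (h₁ : IsRegKernel ω₁) (h₂ : IsRegKernel ω₂)
    (u₀ e₁ e₂ : ℝ) {φ₁ φ₂ : ℝ → ℝ} {d₁ d₂ t : ℝ} (hφ₁ : HasDerivAt φ₁ d₁ t)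
    (hφ₂ : HasDerivAt φ₂ d₂ t) (ε x : ℝ) {u : ℝ → ℝ → ℝ}
    (hu : ∀ y s, u y s = u₀ + e₁ * kernelCdf ω₁ ((-y + φ₁ s) / ε)
      + e₂ * kernelCdf ω₂ ((-y + φ₂ s) / ε)) :
    conservationOp hopfFlux u x t
      = e₁ * (ω₁ ((-x + φ₁ t) / ε) / ε * (d₁ - 2 * u x t))
        + e₂ * (ω₂ ((-x + φ₂ t) / ε) / ε * (d₂ - 2 * u x t)) := by
  have ht : HasDerivAt (fun s => u x s) (e₁ * (ω₁ ((-x + φ₁ t) / ε) * (d₁ / ε))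
      + e₂ * (ω₂ ((-x + φ₂ t) / ε) * (d₂ / ε))) t := by
    have a₁ := (h₁.hasDerivAt_cdf ((-x + φ₁ t) / ε)).comp t ((hφ₁.const_add (-x)).div_const ε)
    have a₂ := (h₂.hasDerivAt_cdf ((-x + φ₂ t) / ε)).comp t ((hφ₂.const_add (-x)).div_const ε)
    have := ((a₁.const_mul e₁).const_add u₀).add (a₂.const_mul e₂)
    exact this.congr_of_eventuallyEq (Eventually.of_forall fun s => hu x s)
  have hx : HasDerivAt (fun y => u y t) (e₁ * (ω₁ ((-x + φ₁ t) / ε) * (-1 / ε))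
      + e₂ * (ω₂ ((-x + φ₂ t) / ε) * (-1 / ε))) x := by
    have n : ∀ b : ℝ, HasDerivAt (fun y : ℝ => (-y + b) / ε) (-1 / ε) x := fun b =>
      ((hasDerivAt_neg x).add_const b).div_const ε
    have a₁ := (h₁.hasDerivAt_cdf ((-x + φ₁ t) / ε)).comp x (n (φ₁ t))
    have a₂ := (h₂.hasDerivAt_cdf ((-x + φ₂ t) / ε)).comp x (n (φ₂ t))
    have := ((a₁.const_mul e₁).const_add u₀).add (a₂.const_mul e₂)
    exact this.congr_of_eventuallyEq (Eventually.of_forall fun s => hu s t)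
  have hx2 : HasDerivAt (fun y => hopfFlux (u y t)) _ x := hx.pow 2
  rw [conservationOp, ht.deriv, hx2.deriv]
  push_cast
  ring

/-- The residual of the two-shock ansatz is of order `ε` in the sense of distributions. -/
theorem exists_residual_bound {ω₁ ω₂ : ℝ → ℝ} (h₁ : IsRegKernel ω₁) (h₂ : IsRegKernel ω₂)
    (u₀ : ℝ) {e₁ e₂ : ℝ} (he₁ : 0 < e₁) (he₂ : 0 < e₂) (x₁ x₂ : ℝ) {ψ : ℝ → ℝ}
    (hψ : IsTestFunction ψ) :
    ∃ C, ∀ ε > 0, ∀ t, ∀ u : ℝ → ℝ → ℝ,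
      (∀ y s, u y s = u₀ + e₁ * kernelCdf ω₁ ((-y + regPhase u₀ e₁ e₂ x₁ x₂ e₂ s ε) / ε)
        + e₂ * kernelCdf ω₂ ((-y + regPhase u₀ e₁ e₂ x₁ x₂ (-e₁) s ε) / ε)) →
      |∫ x, conservationOp hopfFlux u x t * ψ x| ≤ C * ε := by
  obtain ⟨L, hL⟩ := (contDiff_infty.1 hψ.1 1).lipschitzWith_of_hasCompactSupport hψ.2 one_ne_zero
  obtain ⟨S, hS⟩ := hψ.1.continuous.bounded_above_of_compact_support hψ.2
  obtain ⟨G, hG⟩ := exists_abs_deriv_smoothPosPart_le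
  set m := kernelMoment ω₁ + kernelMoment ω₂ with hm
  have hm0 : 0 ≤ m := add_nonneg h₁.moment_nonneg h₂.moment_nonneg
  set B := |2 * u₀ + e₁ + e₂| + (e₁ + e₂) * G + 2 * (|u₀| + e₁ + e₂) with hB
  have hG0 : 0 ≤ G := (abs_nonneg _).trans (hG 0)
  -- The first two terms bound the errors of concentrating at the phases; the last bounds the
  -- remaining multiple of `ψ p₁ - ψ p₂`.
  refine ⟨e₁ * (B * L * kernelMoment ω₁) + e₂ * (B * L * kernelMoment ω₂)
    + e₁ * e₂ * (3 + G + 2 * m) * L, fun ε hε t u hu => ?_⟩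
  set s := (x₂ - x₁ - (e₁ + e₂) * t) / ε with hs
  set g := smoothPosPart s with hg
  set g' := deriv smoothPosPart s with hg'
  set p₁ := regPhase u₀ e₁ e₂ x₁ x₂ e₂ t ε with hp₁
  set p₂ := regPhase u₀ e₁ e₂ x₁ x₂ (-e₁) t ε with hp₂
  set d₁ := 2 * u₀ + e₁ + e₂ + e₂ * g' with hd₁
  set d₂ := 2 * u₀ + e₁ + e₂ + -e₁ * g' with hd₂
  have hE : e₁ + e₂ ≠ 0 := by linarith
  have hp : p₂ = p₁ + ε * g := by
    rw [hp₁, hp₂, regPhase, regPhase, regGap]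
    field_simp
    ring
  have hg'G := hG s
  have hD₁ : |d₁| + 2 * (|u₀| + e₁ + e₂) ≤ B := by
    have : |d₁| ≤ |2 * u₀ + e₁ + e₂| + e₂ * G := by
      refine (abs_add_le _ _).trans ?_
      rw [abs_mul, abs_of_pos he₂]
      gcongr
    linarith [mul_nonneg he₁.le hG0]
  have hD₂ : |d₂| + 2 * (|u₀| + e₂ + e₁) ≤ B := by
    have : |d₂| ≤ |2 * u₀ + e₁ + e₂| + e₁ * G := by
      refine (abs_add_le _ _).trans ?_
      rw [abs_mul, abs_neg, abs_of_pos he₁]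
      gcongr
    linarith [mul_nonneg he₂.le hG0]
  have b₁ := h₁.abs_pairing_sub_le h₂ (p := p₁) (ρ := g) he₁ he₂ hε hD₁ hL hS
  have b₂ := h₂.abs_pairing_sub_le h₁ (p := p₂) (ρ := -g) he₂ he₁ hε hD₂ hL hS
  have z₁ : ∀ x, (-x + p₁) / ε + g = (-x + p₂) / ε := fun x => by
    rw [hp]; field_simp; ring
  have z₂ : ∀ x, (-x + p₂) / ε + -g = (-x + p₁) / ε := fun x => by
    rw [← z₁]; ring
  have cont : ∀ {ω ω' : ℝ → ℝ}, IsRegKernel ω → IsRegKernel ω' → ∀ e e' d p ρ : ℝ,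
      Integrable fun x => ω ((-x + p) / ε) / ε * (d - 2 * (u₀ + e * kernelCdf ω ((-x + p) / ε)
        + e' * kernelCdf ω' ((-x + p) / ε + ρ))) * ψ x := by
    intro ω ω' h h' e e' d p ρ
    have c1 := h.continuous_cdf
    have c2 := h'.continuous_cdf
    have c3 := h.smooth.continuous
    have c4 := hψ.1.continuous
    exact Continuous.integrable_of_hasCompactSupport (by fun_prop) hψ.2.mul_left
  have split : ∫ x, conservationOp hopfFlux u x t * ψ x
      = e₁ * (∫ x, ω₁ ((-x + p₁) / ε) / ε * (d₁ - 2 * (u₀ + e₁ * kernelCdf ω₁ ((-x + p₁) / ε)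
        + e₂ * kernelCdf ω₂ ((-x + p₁) / ε + g))) * ψ x)
      + e₂ * (∫ x, ω₂ ((-x + p₂) / ε) / ε * (d₂ - 2 * (u₀ + e₂ * kernelCdf ω₂ ((-x + p₂) / ε)
        + e₁ * kernelCdf ω₁ ((-x + p₂) / ε + -g))) * ψ x) := by
    rw [← integral_const_mul, ← integral_const_mul,
      ← integral_add ((cont h₁ h₂ _ _ _ _ _).const_mul _) ((cont h₂ h₁ _ _ _ _ _).const_mul _)]
    congr 1; ext x
    rw [conservationOp_hopf_smooth h₁ h₂ u₀ e₁ e₂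
      (hasDerivAt_regPhase u₀ he₁ he₂ x₁ x₂ e₂ t hε)
      (hasDerivAt_regPhase u₀ he₁ he₂ x₁ x₂ (-e₁) t hε) ε x hu, z₁, z₂, hu]
    ring
  have hw := h₁.weight_add h₂ g
  have hw1 := h₁.weight_nonneg h₂ g
  have hw2 := h₂.weight_nonneg h₁ (-g)
  set J := kernelWeight ω₁ ω₂ g with hJ
  have hJ2 : kernelWeight ω₂ ω₁ (-g) = 1 - J := by linarith
  -- Either the rescaled distance `g` is at most `1` and the other factor is bounded, or `g' = 1`
  -- and the product is `2 g (1 - J)`, bounded by the tail estimate.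
  have hkey : g * |1 + g' - 2 * J| ≤ 3 + G + 2 * m := by
    have hg0 : 0 ≤ g := smoothPosPart_nonneg s
    rcases le_or_gt s 1 with h | h
    · have h3 : g ≤ 1 := smoothPosPart_le_one h
      have h4 : |1 + g' - 2 * J| ≤ 3 + G := by
        have := abs_le.1 hg'G
        rw [abs_le]; constructor <;> linarith
      linarith [mul_le_of_le_one_left (abs_nonneg (1 + g' - 2 * J)) h3]
    · have h3 : g' = 1 := deriv_smoothPosPart_of_one_lt h
      have h4 := h₁.mul_weight_neg_le h₂ (ρ := g)
      rw [hJ2] at h4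
      rw [h3, abs_of_nonneg (by linarith)]
      linarith
  -- The common drift `2u₀ + e₁ + e₂` makes the two coefficients opposite for every `g'` and `J`,
  -- because the two weights sum to one.
  have hcancel : e₁ * (ψ p₁ * (d₁ - 2 * u₀ - e₁ - 2 * e₂ * J))
      + e₂ * (ψ p₂ * (d₂ - 2 * u₀ - e₂ - 2 * e₁ * (1 - J)))
      = e₁ * e₂ * (1 + g' - 2 * J) * (ψ p₁ - ψ p₂) := by
    rw [hd₁, hd₂]; ring
  have hdiff : |e₁ * e₂ * (1 + g' - 2 * J) * (ψ p₁ - ψ p₂)|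
      ≤ e₁ * e₂ * (3 + G + 2 * m) * L * ε := by
    have hl := hL.dist_le_mul p₁ p₂
    have hg0 : 0 ≤ g := smoothPosPart_nonneg s
    rw [Real.dist_eq, Real.dist_eq, hp, sub_add_cancel_left, abs_neg, abs_mul, abs_of_pos hε,
      abs_of_nonneg hg0, ← hp] at hl
    rw [abs_mul, abs_mul, abs_of_pos (mul_pos he₁ he₂)]
    calc e₁ * e₂ * |1 + g' - 2 * J| * |ψ p₁ - ψ p₂|
        ≤ e₁ * e₂ * |1 + g' - 2 * J| * (L * (ε * g)) := by gcongr
      _ = e₁ * e₂ * (g * |1 + g' - 2 * J|) * L * ε := by ring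
      _ ≤ _ := by gcongr
  rw [hJ2] at b₂
  rw [split]
  rw [← hcancel] at hdiff
  set I₁ := ∫ x, ω₁ ((-x + p₁) / ε) / ε * (d₁ - 2 * (u₀ + e₁ * kernelCdf ω₁ ((-x + p₁) / ε)
        + e₂ * kernelCdf ω₂ ((-x + p₁) / ε + g))) * ψ x
  set I₂ := ∫ x, ω₂ ((-x + p₂) / ε) / ε * (d₂ - 2 * (u₀ + e₂ * kernelCdf ω₂ ((-x + p₂) / ε)
        + e₁ * kernelCdf ω₁ ((-x + p₂) / ε + -g))) * ψ x
  set R₁ := ψ p₁ * (d₁ - 2 * u₀ - e₁ - 2 * e₂ * J)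
  set R₂ := ψ p₂ * (d₂ - 2 * u₀ - e₂ - 2 * e₁ * (1 - J))
  calc |e₁ * I₁ + e₂ * I₂|
      = |e₁ * (I₁ - R₁) + e₂ * (I₂ - R₂) + (e₁ * R₁ + e₂ * R₂)| := by congr 1; ring
    _ ≤ e₁ * |I₁ - R₁| + e₂ * |I₂ - R₂| + |e₁ * R₁ + e₂ * R₂| := by
        refine (abs_add_three _ _ _).trans_eq ?_
        rw [abs_mul, abs_mul, abs_of_pos he₁, abs_of_pos he₂]
    _ ≤ e₁ * (B * L * kernelMoment ω₁ * ε) + e₂ * (B * L * kernelMoment ω₂ * ε)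
        + e₁ * e₂ * (3 + G + 2 * m) * L * ε := by gcongr
    _ = _ := by ring

/-- The two-shock ansatz. -/
noncomputable def twoShockAnsatz (u₀ e₁ e₂ x₁ x₂ : ℝ) {ω₁ ω₂ : ℝ → ℝ} (h₁ : IsRegKernel ω₁)
    (h₂ : IsRegKernel ω₂) : ShockAnsatz where
  u₀ _ _ := u₀
  e k _ _ := ![e₁, e₂] k
  φ k := regPhase u₀ e₁ e₂ x₁ x₂ (![e₂, -e₁] k)
  ω := ![ω₁, ω₂]
  smooth_u₀ := contDiff_const
  smooth_e _ := contDiff_const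
  smooth_φ _ ε _ := contDiff_regPhase _ _ _ _ _ _ ε
  kernel k := by fin_cases k <;> assumption

section TwoShockAnsatz

variable {u₀ e₁ e₂ x₁ x₂ : ℝ} {ω₁ ω₂ : ℝ → ℝ}

theorem twoShockAnsatz_singular (h₁ : IsRegKernel ω₁) (h₂ : IsRegKernel ω₂) (x t ε : ℝ) :
    (twoShockAnsatz u₀ e₁ e₂ x₁ x₂ h₁ h₂).singular x t ε
      = u₀ + e₁ * heavisideFn (-x + regPhase u₀ e₁ e₂ x₁ x₂ e₂ t ε)
        + e₂ * heavisideFn (-x + regPhase u₀ e₁ e₂ x₁ x₂ (-e₁) t ε) := by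
  simp [ShockAnsatz.singular, twoShockAnsatz, Fin.sum_univ_two, add_assoc]

theorem twoShockAnsatz_smooth (h₁ : IsRegKernel ω₁) (h₂ : IsRegKernel ω₂) (x t ε : ℝ) :
    (twoShockAnsatz u₀ e₁ e₂ x₁ x₂ h₁ h₂).smooth x t ε
      = u₀ + e₁ * kernelCdf ω₁ ((-x + regPhase u₀ e₁ e₂ x₁ x₂ e₂ t ε) / ε)
        + e₂ * kernelCdf ω₂ ((-x + regPhase u₀ e₁ e₂ x₁ x₂ (-e₁) t ε) / ε) := by
  simp [ShockAnsatz.smooth, twoShockAnsatz, Fin.sum_univ_two, add_assoc, regHeaviside, kernelCdf]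

theorem tendsto_regPhase_hopfPhase₁ (he₁ : 0 < e₁) (he₂ : 0 < e₂) (t : ℝ) :
    Tendsto (fun ε => regPhase u₀ e₁ e₂ x₁ x₂ e₂ t ε) (𝓝[>] 0)
      (𝓝 (hopfPhase₁ u₀ e₁ e₂ x₁ x₂ t)) := by
  rw [hopfPhase₁_eq he₁ he₂]
  exact tendsto_regPhase _ _ _ _ _ _ _

theorem tendsto_regPhase_hopfPhase₂ (he₁ : 0 < e₁) (he₂ : 0 < e₂) (t : ℝ) :
    Tendsto (fun ε => regPhase u₀ e₁ e₂ x₁ x₂ (-e₁) t ε) (𝓝[>] 0)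
      (𝓝 (hopfPhase₂ u₀ e₁ e₂ x₁ x₂ t)) := by
  have := tendsto_regPhase u₀ e₁ e₂ x₁ x₂ (-e₁) t
  rw [hopfPhase₂_eq he₁ he₂]
  rwa [neg_div, neg_mul, sub_neg_eq_add] at this

/-- For `ε ≤ x₂ - x₁` the smoothed positive part is exact at `t = 0`, so the initial value is
attained without error. -/
theorem regPhase_zero (he₁ : 0 < e₁) (he₂ : 0 < e₂) {ε : ℝ} (hε : 0 < ε) (hεx : ε ≤ x₂ - x₁) :
    regPhase u₀ e₁ e₂ x₁ x₂ e₂ 0 ε = x₁ ∧ regPhase u₀ e₁ e₂ x₁ x₂ (-e₁) 0 ε = x₂ := by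
  have h : regGap e₁ e₂ x₁ x₂ 0 ε = x₂ - x₁ := by
    rw [regGap, mul_zero, sub_zero, smoothPosPart_of_one_le ((one_le_div hε).2 hεx),
      mul_div_cancel₀ _ hε.ne']
  have hE : e₁ + e₂ ≠ 0 := by linarith
  rw [regPhase, regPhase, hopfCenter, h]
  constructor <;> (field_simp; ring)

theorem twoShockAnsatz_yieldsSolution (h₁ : IsRegKernel ω₁) (h₂ : IsRegKernel ω₂) (he₁ : 0 < e₁)
    (he₂ : 0 < e₂) (hx : x₁ < x₂) (T : ℝ) :
    (twoShockAnsatz u₀ e₁ e₂ x₁ x₂ h₁ h₂).YieldsSolution hopfFlux T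
      (twoJumpData u₀ e₁ e₂ x₁ x₂) (hopfTwoShock u₀ e₁ e₂ x₁ x₂) where
  asymptotic :=
    { equation := fun ψ hψ => by
        obtain ⟨C, hC⟩ := exists_residual_bound h₁ h₂ u₀ he₁ he₂ x₁ x₂ hψ
        refine ⟨C, ?_⟩
        filter_upwards [self_mem_nhdsWithin] with ε hε t _
        exact hC ε hε t _ fun y s => twoShockAnsatz_smooth h₁ h₂ y s ε
      initial := fun ψ _ => by
        refine ⟨0, ?_⟩
        filter_upwards [Ioc_mem_nhdsGT (sub_pos.2 hx)] with ε hε t ht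
        rw [mem_singleton_iff.1 ht]
        have h := regPhase_zero (u₀ := u₀) he₁ he₂ hε.1 hε.2
        simp only [twoShockAnsatz_singular, h.1, h.2, twoJumpData_eq u₀ e₁ e₂ hx, sub_self, zero_mul,
          integral_zero, abs_zero, le_refl] }
  weak_limit t _ ψ hψ := by
    simp only [twoShockAnsatz_singular]
    exact tendsto_integral_twoStep u₀ he₁ he₂ (tendsto_regPhase_hopfPhase₁ he₁ he₂ t)
      (tendsto_regPhase_hopfPhase₂ he₁ he₂ t) hψ

end TwoShockAnsatz

theorem theorem1p3 (u₀ e₁ e₂ x₁ x₂ : ℝ) (he₁ : 0 < e₁) (he₂ : 0 < e₂) (hx : x₁ < x₂) :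
    (∀ ω₁ ω₂ : ℝ → ℝ, IsRegKernel ω₁ → IsRegKernel ω₂ →
      ∃ A : ShockAnsatz,
        (A.ω 0 = ω₁ ∧ A.ω 1 = ω₂) ∧
        (∀ x t, A.u₀ x t = u₀ ∧ A.e 0 x t = e₁ ∧ A.e 1 x t = e₂) ∧
        (∀ t, 0 ≤ t →
          Tendsto (fun ε => A.φ 0 t ε) (𝓝[>] 0) (𝓝 (hopfPhase₁ u₀ e₁ e₂ x₁ x₂ t)) ∧
          Tendsto (fun ε => A.φ 1 t ε) (𝓝[>] 0) (𝓝 (hopfPhase₂ u₀ e₁ e₂ x₁ x₂ t))) ∧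
        ∀ T : ℝ, 0 < T →
          A.YieldsSolution hopfFlux T (twoJumpData u₀ e₁ e₂ x₁ x₂)
            (hopfTwoShock u₀ e₁ e₂ x₁ x₂)) ∧
    (∀ T : EReal, 0 < T →
      IsGeneralizedCauchySolution hopfFlux T (twoJumpData u₀ e₁ e₂ x₁ x₂)
        (hopfTwoShock u₀ e₁ e₂ x₁ x₂) ∧
      ∀ v : ℝ → ℝ → ℝ,
        IsGeneralizedCauchySolution hopfFlux T (twoJumpData u₀ e₁ e₂ x₁ x₂) v →
        ∀ᵐ p ∂(volume.restrict (timeStrip T)),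
          v p.1 p.2 = hopfTwoShock u₀ e₁ e₂ x₁ x₂ p.1 p.2) := by
  refine ⟨fun ω₁ ω₂ h₁ h₂ => ⟨twoShockAnsatz u₀ e₁ e₂ x₁ x₂ h₁ h₂, ⟨rfl, rfl⟩,
    fun x t => ⟨rfl, rfl, rfl⟩, fun t _ => ⟨tendsto_regPhase_hopfPhase₁ he₁ he₂ t,
      tendsto_regPhase_hopfPhase₂ he₁ he₂ t⟩,
    fun T _ => twoShockAnsatz_yieldsSolution h₁ h₂ he₁ he₂ hx T⟩,
    fun T hT => ⟨isGeneralizedCauchySolution_hopfTwoShock he₁ he₂ hx T,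
      fun v hv => hv.ae_eq_hopfTwoShock he₁ he₂ hx hT⟩⟩
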